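/- **Definitions.** For $m\ge 1$, an *$m$-modulo constraint* on a finite set $X$ of Boolean variables is a function $f:\{0,1\}^X\to\{0,1\}$ such that $f(x)=f(y)$ whenever $\sum_i x_i\equiv\sum_i y_i \pmod m$. A *clause* is a disjunction of literals. A system $F$ consists of finitely many constraints $c_1,\dots,c_r$ over Boolean variables $x_1,\dots,x_n$; its model count is the number of assignments in $\{0,1\}^n$ that satisfy all constraints. The incidence graph $G_F$ has as vertices the variables and the constraints of $F$, with an edge between $x_i$ and $c_j$ exactly if $x_i$ is a variable of $c_j$; $|G_F|=n+r$ is its number of vertices. The *width* of a tree decomposition $(T,b)$ is $\max_{t\in V(T)}|b(t)|$ (no $1$ is subtracted). The computational model is the random access machine with unit-cost arithmetic: it has registers and arrays of natural numbers for addressing and control (addition, truncated subtraction, multiplication, comparison) and arrays of complex numbers on which the *elementary arithmetic operations* $+,-,\cdot,/$, the conversion of a natural number to a complex number, and the production of the root of unity $e^{2\pi i/m}$ for a natural number $m$ are performed exactly. Each such operation, and each memory access, comparison and assignment, counts as one step. The control flow does not depend on complex numbers. The system is given by the lists of the variables that occur positively and negatively in each clause, and, for each modulo constraint, by its list of variables,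 its modulus $m$, and an acceptance table with one bit for each residue modulo $m$ (bit $q$ is $1$ exactly if the constraint accepts some assignment whose number of ones is congruent to $q$ modulo $m$). The tree decomposition $(T,b)$ is given by the lists of neighbours in $T$ and the bags. **Theorem.** There are a single program and an absolute constant $C$ such that the following holds. Let $w\ge 2$ be a natural number, let $F$ be a system with $|G_F|\ge 1$ whose constraints are clauses and $m$-modulo constraints with possibly different $m$, $1\le m\le w$, and let $(T,b)$ be a tree decomposition of $G_F$ of width $k$. On input $F$ and $(T,b)$, the program halts and outputs the model count of $F$, it uses at most $$C\cdot w^k\cdot k\cdot\log(w)\cdot|G_F|$$ elementary arithmetic operations on complex numbers, and its total number of steps (with all reading of the input, addressing and control) is at most $$C\cdot\bigl(w^k\cdot k\cdot\log(w)\cdot|G_F|+k\cdot|V(T)|\bigr).$$ In particular, the total number of steps is $O(w^k\cdot k\cdot\log(w)\cdot|G_F|)$ for tree decompositions with $O(|G_F|)$ nodes. -/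

import Mathlib

namespace ModCount

/-! ### Systems of clauses and modulo constraints -/

/-- A Boolean function of the variables in `X` is an `m`-modulo constraint (`m ≥ 1`) if its value
depends only on the residue modulo `m` of the number of variables that are set to true. -/
def IsModulo {X : Type} [Fintype X] (m : ℕ) (f : (X → Bool) → Bool) : Prop :=
  1 ≤ m ∧ ∀ x y : X → Bool,
    (∑ i, (x i).toNat) ≡ (∑ i, (y i).toNat) [MOD m] → f x = f y

/-- A constraint over the variables `Fin n`, tagged with its type: either the disjunction of the
literals `x_i` (`i ∈ pos`) and `¬ x_i` (`i ∈ neg`), or an `m`-modulo constraint `f` on the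
variables in `scope`. -/
inductive Constraint (n : ℕ) where
  | clause (pos neg : Finset (Fin n)) : Constraint n
  | modulo (m : ℕ) (scope : Finset (Fin n)) (f : (scope → Bool) → Bool) (hf : IsModulo m f) :
      Constraint n

namespace Constraint

variable {n : ℕ}

/-- The set of variables of a constraint. -/
def scope : Constraint n → Finset (Fin n)
  | clause pos neg => pos ∪ neg
  | modulo _ s _ _ => s

/-- The assignment `τ` satisfies the constraint. -/
def Sat (τ : Fin n → Bool) : Constraint n → Prop
  | clause pos neg => (∃ i ∈ pos, τ i = true) ∨ ∃ i ∈ neg, τ i = false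
  | modulo _ _ f _ => f (fun i => τ i) = true

/-- The modulus of a modulo constraint; `0` marks a clause. -/
def modulus : Constraint n → ℕ
  | clause _ _ => 0
  | modulo m _ _ _ => m

/-- The variables that occur positively, in increasing order. -/
def posVars : Constraint n → List ℕ
  | clause pos _ => ((List.finRange n).filter (· ∈ pos)).map Fin.val
  | modulo _ s _ _ => ((List.finRange n).filter (· ∈ s)).map Fin.val

/-- The variables that occur negatively, in increasing order. -/
def negVars : Constraint n → List ℕ
  | clause _ neg => ((List.finRange n).filter (· ∈ neg)).map Fin.val
  | modulo _ _ _ _ => []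

open Classical in
/-- The accepting states of a modulo constraint, as a list of `m` bits: bit `q` is `1` if the
constraint accepts the assignments whose number of ones is congruent to `q` modulo `m`. -/
noncomputable def acceptTable : Constraint n → List ℕ
  | clause _ _ => []
  | modulo m _ f _ => (List.range m).map fun q =>
      if ∃ x, (∑ i, (x i).toNat) ≡ q [MOD m] ∧ f x = true then 1 else 0

end Constraint

/-- The number of models of a system of constraints. -/
noncomputable def modelCount {n r : ℕ} (F : Fin r → Constraint n) : ℕ :=
  Nat.card {τ : Fin n → Bool // ∀ j, (F j).Sat τ}

/-- The incidence graph: variables on the left, constraints on the right. -/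
def incidenceGraph {n r : ℕ} (F : Fin r → Constraint n) : SimpleGraph (Fin n ⊕ Fin r) where
  Adj u v := (∃ i j, u = Sum.inl i ∧ v = Sum.inr j ∧ i ∈ (F j).scope) ∨
    ∃ i j, v = Sum.inl i ∧ u = Sum.inr j ∧ i ∈ (F j).scope
  symm := ⟨fun _ _ h => Or.symm h⟩
  loopless := ⟨by
    rintro v (⟨i, j, h, h', -⟩ | ⟨i, j, h, h', -⟩) <;> simp [h] at h'⟩

/-! ### Tree decompositions -/

/-- A tree decomposition of `G` whose tree has the nodes `Fin N`. -/
structure TreeDecomposition {V : Type} (G : SimpleGraph V) (N : ℕ) where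
  tree : SimpleGraph (Fin N)
  isTree : tree.IsTree
  bag : Fin N → Finset V
  cover : ∀ v, ∃ t, v ∈ bag t
  edge : ∀ u v, G.Adj u v → ∃ t, u ∈ bag t ∧ v ∈ bag t
  connected : ∀ v, (tree.induce {t | v ∈ bag t}).Connected

/-- The width is the maximal size of a bag (no `1` is subtracted). -/
def TreeDecomposition.width {V : Type} {G : SimpleGraph V} {N : ℕ}
    (D : TreeDecomposition G N) : ℕ :=
  Finset.univ.sup fun t => (D.bag t).card

/-! ### A random access machine with unit-cost arithmetic

The machine has registers and arrays of natural numbers, for addressing and control, and arrays of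
complex numbers, the operands of the arithmetic operations. The control flow never depends on the
complex numbers. A program mentions finitely many registers and arrays. -/

/-- A memory content: natural number registers, natural number arrays, complex arrays. -/
structure Store where
  reg : ℕ → ℕ
  mem : ℕ → ℕ → ℕ
  num : ℕ → ℕ → ℂ

/-- Expressions for natural numbers. -/
inductive IExp where
  | const (c : ℕ)
  | reg (x : ℕ)
  | load (a : ℕ) (i : IExp)
  | add (e e' : IExp)
  | sub (e e' : IExp)
  | mul (e e' : IExp)

namespace IExp

/-- The value (subtraction is truncated at `0`). -/
def eval (σ : Store) : IExp → ℕ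
  | const c => c
  | reg x => σ.reg x
  | load a i => σ.mem a (i.eval σ)
  | add e e' => e.eval σ + e'.eval σ
  | sub e e' => e.eval σ - e'.eval σ
  | mul e e' => e.eval σ * e'.eval σ

/-- The number of steps of the evaluation. -/
def steps : IExp → ℕ
  | const _ => 1
  | reg _ => 1
  | load _ i => i.steps + 1
  | add e e' => e.steps + e'.steps + 1
  | sub e e' => e.steps + e'.steps + 1
  | mul e e' => e.steps + e'.steps + 1

end IExp

/-- Expressions for complex numbers. -/
inductive NExp where
  | load (a : ℕ) (i : IExp)
  | ofNat (e : IExp)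
  | root (e : IExp)
  | add (z z' : NExp)
  | sub (z z' : NExp)
  | mul (z z' : NExp)
  | div (z z' : NExp)

namespace NExp

/-- The value; `root m` is the primitive `m`-th root of unity `exp (2πi/m)`. -/
noncomputable def eval (σ : Store) : NExp → ℂ
  | load a i => σ.num a (i.eval σ)
  | ofNat e => (e.eval σ : ℂ)
  | root e => Complex.exp (2 * Real.pi * Complex.I / (e.eval σ : ℂ))
  | add z z' => z.eval σ + z'.eval σ
  | sub z z' => z.eval σ - z'.eval σ
  | mul z z' => z.eval σ * z'.eval σ
  | div z z' => z.eval σ / z'.eval σ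

/-- The number of arithmetic operations on complex numbers in the evaluation. -/
def ops : NExp → ℕ
  | load _ _ => 0
  | ofNat _ => 1
  | root _ => 1
  | add z z' => z.ops + z'.ops + 1
  | sub z z' => z.ops + z'.ops + 1
  | mul z z' => z.ops + z'.ops + 1
  | div z z' => z.ops + z'.ops + 1

/-- The number of steps of the evaluation, including the arithmetic operations. -/
def steps : NExp → ℕ
  | load _ i => i.steps + 1
  | ofNat e => e.steps + 1
  | root e => e.steps + 1
  | add z z' => z.steps + z'.steps + 1
  | sub z z' => z.steps + z'.steps + 1
  | mul z z' => z.steps + z'.steps + 1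
  | div z z' => z.steps + z'.steps + 1

end NExp

/-- Comparisons of natural numbers. -/
inductive Test where
  | lt (e e' : IExp)
  | eq (e e' : IExp)

namespace Test

/-- The comparison is true. -/
def Holds (σ : Store) : Test → Prop
  | lt e e' => e.eval σ < e'.eval σ
  | eq e e' => e.eval σ = e'.eval σ

/-- The number of steps of the comparison. -/
def steps : Test → ℕ
  | lt e e' => e.steps + e'.steps + 1
  | eq e e' => e.steps + e'.steps + 1

end Test

namespace Store

/-- Write a register. -/
def setReg (σ : Store) (x v : ℕ) : Store :=
  { σ with reg := Function.update σ.reg x v }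

/-- Write a cell of a natural number array. -/
def setMem (σ : Store) (a i v : ℕ) : Store :=
  { σ with mem := Function.update σ.mem a (Function.update (σ.mem a) i v) }

/-- Write a cell of a complex array. -/
noncomputable def setNum (σ : Store) (a i : ℕ) (z : ℂ) : Store :=
  { σ with num := Function.update σ.num a (Function.update (σ.num a) i z) }

end Store

/-- Programs. -/
inductive Prog where
  | skip
  | setReg (x : ℕ) (e : IExp)
  | setMem (a : ℕ) (i e : IExp)
  | setNum (a : ℕ) (i : IExp) (z : NExp)
  | seq (p q : Prog)
  | ite (b : Test) (p q : Prog)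
  | loop (b : Test) (p : Prog)

/-- `Exec p σ a s σ'`: the program `p`, started in `σ`, halts in `σ'` after `s` steps in total,
`a` of which are arithmetic operations on complex numbers. `loop b p` repeats `p` while `b`
holds. -/
inductive Exec : Prog → Store → ℕ → ℕ → Store → Prop where
  | skip (σ : Store) : Exec .skip σ 0 1 σ
  | setReg (x : ℕ) (e : IExp) (σ : Store) :
      Exec (.setReg x e) σ 0 (e.steps + 1) (σ.setReg x (e.eval σ))
  | setMem (a : ℕ) (i e : IExp) (σ : Store) :
      Exec (.setMem a i e) σ 0 (i.steps + e.steps + 1) (σ.setMem a (i.eval σ) (e.eval σ))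
  | setNum (a : ℕ) (i : IExp) (z : NExp) (σ : Store) :
      Exec (.setNum a i z) σ z.ops (i.steps + z.steps + 1) (σ.setNum a (i.eval σ) (z.eval σ))
  | seq {p q : Prog} {σ σ' σ'' : Store} {a s a' s' : ℕ} :
      Exec p σ a s σ' → Exec q σ' a' s' σ'' → Exec (.seq p q) σ (a + a') (s + s') σ''
  | ite_true {b : Test} {p q : Prog} {σ σ' : Store} {a s : ℕ} :
      b.Holds σ → Exec p σ a s σ' → Exec (.ite b p q) σ a (b.steps + s) σ'
  | ite_false {b : Test} {p q : Prog} {σ σ' : Store} {a s : ℕ} :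
      ¬ b.Holds σ → Exec q σ a s σ' → Exec (.ite b p q) σ a (b.steps + s) σ'
  | loop_true {b : Test} {p : Prog} {σ σ' σ'' : Store} {a s a' s' : ℕ} :
      b.Holds σ → Exec p σ a s σ' → Exec (.loop b p) σ' a' s' σ'' →
        Exec (.loop b p) σ (a + a') (b.steps + s + s') σ''
  | loop_false {b : Test} {p : Prog} {σ : Store} :
      ¬ b.Holds σ → Exec (.loop b p) σ 0 b.steps σ

/-! ### The input format

A family of lists `l 0, …, l (c - 1)` is stored in two arrays: the concatenation of the lists, and
the position at which each list starts. -/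

/-- The position at which the `i`-th list starts (the total length for `i ≥ c`). -/
def starts {c : ℕ} (l : Fin c → List ℕ) (i : ℕ) : ℕ :=
  (((List.ofFn l).take i).map List.length).sum

/-- The concatenation of the lists, continued by `0`. -/
def entries {c : ℕ} (l : Fin c → List ℕ) (i : ℕ) : ℕ :=
  (List.ofFn l).flatten.getD i 0

/-- The members of a set of vertices of the incidence graph, in increasing order; the variable `i`
has the number `i`, the constraint `j` the number `n + j`. -/
def vertexList {n r : ℕ} (B : Finset (Fin n ⊕ Fin r)) : List ℕ :=
  ((List.finRange n).filter (Sum.inl · ∈ B)).map Fin.val ++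
    ((List.finRange r).filter (Sum.inr · ∈ B)).map (fun j => n + j.val)

open Classical in
/-- The neighbours of a node of a tree, in increasing order. -/
noncomputable def neighbourList {N : ℕ} (T : SimpleGraph (Fin N)) (t : Fin N) : List ℕ :=
  ((List.finRange N).filter (T.Adj t ·)).map Fin.val

/-- The initial store for the system `F` and the tree decomposition `D`. Everything that is not
listed is `0`. -/
noncomputable def input {n r N : ℕ} (F : Fin r → Constraint n)
    (D : TreeDecomposition (incidenceGraph F) N) : Store where
  reg
    | 0 => n
    | 1 => r
    | 2 => N
    | _ => 0
  mem
    | 0 => fun j => if h : j < r then (F ⟨j, h⟩).modulus else 0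
    | 1 => starts fun j => (F j).posVars
    | 2 => entries fun j => (F j).posVars
    | 3 => starts fun j => (F j).negVars
    | 4 => entries fun j => (F j).negVars
    | 5 => starts fun j => (F j).acceptTable
    | 6 => entries fun j => (F j).acceptTable
    | 7 => starts (neighbourList D.tree)
    | 8 => entries (neighbourList D.tree)
    | 9 => starts fun t => vertexList (D.bag t)
    | 10 => entries fun t => vertexList (D.bag t)
    | _ => fun _ => 0
  num := fun _ _ => 0

end ModCount

namespace ModCount

/-! ### Notation for programs -/

/-! Let `W` be the maximum of 2 and all moduli. Every constraint is a sum over at most `W` states,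
where a state has a weight and contributes one factor for each true literal. If `p` literals are
true, a clause is `1 - 0 ^ p`: state 0 has weight 1 and factor 1, state 1 has weight -1 and factor
0. A modulo constraint with acceptance table `A` is, by Fourier inversion on the residues modulo `m`
(`sum_dft`), the sum over `s` of a Fourier coefficient of `A` times `(ω ^ s) ^ p` with `ω =
e^{2πi/m}`; state `s` has factor `ω ^ s`. This is `Constraint.sum_weight`. Consequently
(`sum_eq_modelCount`) the model count is a sum, over one value below `W` for each vertex of the
incidence graph, of a product of vertex weights and of factors that each depend on the two ends of
one edge. All interactions are now pairwise along edges, so tables for sets of vertices are combined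
by pointwise multiplication and no convolution of states is needed.

Such a sum is computed by variable elimination. The nodes of the tree are listed in breadth-first
order, the vertices are numbered `1, …, M` by the first bag that contains them, and they are summed
out from `M` down to `1`. Let `l i` consist of the vertices below `i` in the first bag of `i`; it
has fewer than `k` members. Of two vertices that share a bag, the smaller one lies in the first bag
of the greater one (`IsSearchOrder.mem_first_bag`). Hence `l i` contains all smaller neighbours of
`i`, and `l i` is contained in `{p} ∪ l p`, where `p` is the greatest member of `l i`
(`isElimination`). The message of `i` therefore depends on `l i` only and can be multiplied into the
table of the single vertex `p` (`message_congr`, `sumTo_eq_message`).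

A message has at most `W ^ (k - 1)` entries, each a sum of `W` terms with `O(k)` factors; the table
of `p` has at most `W ^ k` entries, each matched with its message entry by `O(k)` digit operations.
So a vertex costs `O(W ^ k * k)`, independently of the shape of the tree (`runs_eliminate`). The
other costs fit into this: a quadratic Fourier transform takes `O(W ^ 2)` steps, and a constraint
with a variable forces a bag with two members, so `k ≥ 2`; there are at most `k * (n + r)`
incidences, as each can be charged to the end that appears later; the work for the nodes of the tree
is `O(k)` per node and touches no complex number. The bound obtained has no logarithm; `log w ≥ log
2 > 1 / 2` puts it in.

The programs are verified by a Hoare logic with step bounds (`Runs`, `Runs.forReg`). Whatever a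
program does not mention as a target is preserved by `Exec.frame`. -/

instance (c : ℕ) : OfNat IExp c := ⟨.const c⟩
instance : Add IExp := ⟨.add⟩
instance : Sub IExp := ⟨.sub⟩
instance : Mul IExp := ⟨.mul⟩
instance : Add NExp := ⟨.add⟩
instance : Sub NExp := ⟨.sub⟩
instance : Mul NExp := ⟨.mul⟩
instance : Div NExp := ⟨.div⟩

namespace IExp

variable (σ : Store)

@[simp] lemma eval_ofNat (c : ℕ) : (no_index (OfNat.ofNat c : IExp)).eval σ = c := rfl
@[simp] lemma eval_reg (x : ℕ) : (reg x).eval σ = σ.reg x := rfl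
@[simp] lemma eval_load (a : ℕ) (i : IExp) : (load a i).eval σ = σ.mem a (i.eval σ) := rfl
@[simp] lemma eval_add (e e' : IExp) : (e + e').eval σ = e.eval σ + e'.eval σ := rfl
@[simp] lemma eval_sub (e e' : IExp) : (e - e').eval σ = e.eval σ - e'.eval σ := rfl
@[simp] lemma eval_mul (e e' : IExp) : (e * e').eval σ = e.eval σ * e'.eval σ := rfl

end IExp

namespace NExp

variable (σ : Store)

@[simp] lemma eval_load (a : ℕ) (i : IExp) : (load a i).eval σ = σ.num a (i.eval σ) := rfl
@[simp] lemma eval_ofNat (e : IExp) : (ofNat e).eval σ = (e.eval σ : ℂ) := rfl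
@[simp] lemma eval_root (e : IExp) :
    (root e).eval σ = Complex.exp (2 * Real.pi * Complex.I / (e.eval σ : ℂ)) := rfl
@[simp] lemma eval_add (e e' : NExp) : (e + e').eval σ = e.eval σ + e'.eval σ := rfl
@[simp] lemma eval_sub (e e' : NExp) : (e - e').eval σ = e.eval σ - e'.eval σ := rfl
@[simp] lemma eval_mul (e e' : NExp) : (e * e').eval σ = e.eval σ * e'.eval σ := rfl
@[simp] lemma eval_div (e e' : NExp) : (e / e').eval σ = e.eval σ / e'.eval σ := rfl

lemma ops_le_steps (z : NExp) : z.ops ≤ z.steps := by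
  induction z <;> simp only [ops, steps] <;> omega

end NExp

namespace Store

variable (σ : Store)

@[simp] lemma reg_setReg (x v y : ℕ) :
    (σ.setReg x v).reg y = if y = x then v else σ.reg y := by
  simp [setReg, Function.update_apply]
@[simp] lemma mem_setReg (x v : ℕ) : (σ.setReg x v).mem = σ.mem := rfl
@[simp] lemma num_setReg (x v : ℕ) : (σ.setReg x v).num = σ.num := rfl
@[simp] lemma reg_setMem (a i v : ℕ) : (σ.setMem a i v).reg = σ.reg := rfl
@[simp] lemma mem_setMem (a i v b : ℕ) :
    (σ.setMem a i v).mem b = if b = a then Function.update (σ.mem a) i v else σ.mem b := by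
  simp [setMem, Function.update_apply]
@[simp] lemma num_setMem (a i v : ℕ) : (σ.setMem a i v).num = σ.num := rfl
@[simp] lemma reg_setNum (a i : ℕ) (z : ℂ) : (σ.setNum a i z).reg = σ.reg := rfl
@[simp] lemma mem_setNum (a i : ℕ) (z : ℂ) : (σ.setNum a i z).mem = σ.mem := rfl
@[simp] lemma num_setNum (a i : ℕ) (z : ℂ) (b : ℕ) :
    (σ.setNum a i z).num b = if b = a then Function.update (σ.num a) i z else σ.num b := by
  simp [setNum, Function.update_apply]

end Store

/-! ### Syntactic properties of programs -/

namespace Prog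

infixr:60 " ;; " => Prog.seq

/-- The program may write the register `y`. -/
def writesReg : Prog → ℕ → Bool
  | skip, _ => false
  | setReg x _, y => x == y
  | setMem _ _ _, _ => false
  | setNum _ _ _, _ => false
  | seq p q, y => p.writesReg y || q.writesReg y
  | ite _ p q, y => p.writesReg y || q.writesReg y
  | loop _ p, y => p.writesReg y

/-- The program may write the natural number array `b`. -/
def writesMem : Prog → ℕ → Bool
  | skip, _ => false
  | setReg _ _, _ => false
  | setMem a _ _, b => a == b
  | setNum _ _ _, _ => false
  | seq p q, b => p.writesMem b || q.writesMem b
  | ite _ p q, b => p.writesMem b || q.writesMem b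
  | loop _ p, b => p.writesMem b

/-- The program may write the complex array `b`. -/
def writesNum : Prog → ℕ → Bool
  | skip, _ => false
  | setReg _ _, _ => false
  | setMem _ _ _, _ => false
  | setNum a _ _, b => a == b
  | seq p q, b => p.writesNum b || q.writesNum b
  | ite _ p q, b => p.writesNum b || q.writesNum b
  | loop _ p, b => p.writesNum b

/-- The program writes no complex array. -/
def discrete : Prog → Bool
  | skip => true
  | setReg _ _ => true
  | setMem _ _ _ => true
  | setNum _ _ _ => false
  | seq p q => p.discrete && q.discrete
  | ite _ p q => p.discrete && q.discrete
  | loop _ p => p.discrete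

/-- The program has no loops. -/
def straight : Prog → Bool
  | skip => true
  | setReg _ _ => true
  | setMem _ _ _ => true
  | setNum _ _ _ => true
  | seq p q => p.straight && q.straight
  | ite _ p q => p.straight && q.straight
  | loop _ _ => false

/-- A bound for the number of steps of a program without loops. -/
def cost : Prog → ℕ
  | skip => 1
  | setReg _ e => e.steps + 1
  | setMem _ i e => i.steps + e.steps + 1
  | setNum _ i z => i.steps + z.steps + 1
  | seq p q => p.cost + q.cost
  | ite b p q => b.steps + max p.cost q.cost
  | loop _ _ => 0

open Classical in
/-- The effect of a program without loops. -/
noncomputable def run : Prog → Store → Store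
  | skip, σ => σ
  | setReg x e, σ => σ.setReg x (e.eval σ)
  | setMem a i e, σ => σ.setMem a (i.eval σ) (e.eval σ)
  | setNum a i z, σ => σ.setNum a (i.eval σ) (z.eval σ)
  | seq p q, σ => q.run (p.run σ)
  | ite b p q, σ => if b.Holds σ then p.run σ else q.run σ
  | loop _ _, σ => σ

/-- The counting loop: `p` is repeated for the values `0, 1, …` of the register `x` that are smaller
than the register `y`. -/
def forReg (x y : ℕ) (p : Prog) : Prog :=
  .setReg x 0 ;; .loop (.lt (.reg x) (.reg y)) (p ;; .setReg x (.reg x + 1))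

end Prog

/-! ### Frames and the count of complex operations -/

/-- The stores agree on everything that the program does not write. -/
structure Frame (p : Prog) (σ σ' : Store) : Prop where
  reg : ∀ x, p.writesReg x = false → σ'.reg x = σ.reg x
  mem : ∀ a, p.writesMem a = false → σ'.mem a = σ.mem a
  num : ∀ a, p.writesNum a = false → σ'.num a = σ.num a

namespace Exec

variable {p : Prog} {σ σ' : Store} {a s : ℕ}

/-- The write sets are computable from the syntax, so for concrete programs and register numbers
each preservation fact below has the side condition `rfl`. The invariants of loops need to mention
only what changes. -/
lemma frame (h : Exec p σ a s σ') : Frame p σ σ' := by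
  induction h with
  | skip σ => exact ⟨fun _ _ => rfl, fun _ _ => rfl, fun _ _ => rfl⟩
  | setReg x e σ =>
    refine ⟨fun y hy => ?_, fun _ _ => rfl, fun _ _ => rfl⟩
    have : y ≠ x := by rintro rfl; simp [Prog.writesReg] at hy
    simp [this]
  | setMem a i e σ =>
    refine ⟨fun _ _ => rfl, fun b hb => ?_, fun _ _ => rfl⟩
    have : b ≠ a := by rintro rfl; simp [Prog.writesMem] at hb
    simp [this]
  | setNum a i z σ =>
    refine ⟨fun _ _ => rfl, fun _ _ => rfl, fun b hb => ?_⟩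
    have : b ≠ a := by rintro rfl; simp [Prog.writesNum] at hb
    simp [this]
  | seq _ _ ih ih' =>
    refine ⟨fun x hx => ?_, fun x hx => ?_, fun x hx => ?_⟩
    · simp only [Prog.writesReg, Bool.or_eq_false_iff] at hx
      rw [ih'.reg x hx.2, ih.reg x hx.1]
    · simp only [Prog.writesMem, Bool.or_eq_false_iff] at hx
      rw [ih'.mem x hx.2, ih.mem x hx.1]
    · simp only [Prog.writesNum, Bool.or_eq_false_iff] at hx
      rw [ih'.num x hx.2, ih.num x hx.1]
  | ite_true _ _ ih =>
    refine ⟨fun x hx => ?_, fun x hx => ?_, fun x hx => ?_⟩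
    · exact ih.reg x (by simp_all [Prog.writesReg])
    · exact ih.mem x (by simp_all [Prog.writesMem])
    · exact ih.num x (by simp_all [Prog.writesNum])
  | ite_false _ _ ih =>
    refine ⟨fun x hx => ?_, fun x hx => ?_, fun x hx => ?_⟩
    · exact ih.reg x (by simp_all [Prog.writesReg])
    · exact ih.mem x (by simp_all [Prog.writesMem])
    · exact ih.num x (by simp_all [Prog.writesNum])
  | loop_true _ _ _ ih ih' =>
    refine ⟨fun x hx => ?_, fun x hx => ?_, fun x hx => ?_⟩
    · rw [ih'.reg x hx, ih.reg x hx]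
    · rw [ih'.mem x hx, ih.mem x hx]
    · rw [ih'.num x hx, ih.num x hx]
  | loop_false _ => exact ⟨fun _ _ => rfl, fun _ _ => rfl, fun _ _ => rfl⟩

/-- Together with `ops_eq_zero` this lets the Hoare logic track total steps only: the complex
operations are bounded by the steps in the numerical phase and vanish in the phase that only handles
natural numbers. -/
lemma ops_le_steps (h : Exec p σ a s σ') : a ≤ s := by
  induction h with
  | setNum a i z σ => have := z.ops_le_steps; omega
  | _ => omega

lemma ops_eq_zero (h : Exec p σ a s σ') (hp : p.discrete = true) : a = 0 := by
  induction h with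
  | setNum a i z σ => simp [Prog.discrete] at hp
  | seq _ _ ih ih' =>
    simp only [Prog.discrete, Bool.and_eq_true] at hp
    rw [ih hp.1, ih' hp.2]
  | ite_true _ _ ih =>
    simp only [Prog.discrete, Bool.and_eq_true] at hp
    exact ih hp.1
  | ite_false _ _ ih =>
    simp only [Prog.discrete, Bool.and_eq_true] at hp
    exact ih hp.2
  | loop_true _ _ _ ih ih' => rw [ih hp, ih' hp]
  | _ => rfl

end Exec

/-! ### Hoare rules with step bounds -/

/-- The program halts within `T` steps in a store that satisfies `Q`. -/
def Runs (p : Prog) (σ : Store) (T : ℕ) (Q : Store → Prop) : Prop :=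
  ∃ a s σ', Exec p σ a s σ' ∧ s ≤ T ∧ Q σ'

namespace Runs

variable {p q : Prog} {σ : Store} {T T' T₁ T₂ : ℕ} {Q R : Store → Prop}

lemma mono (h : Runs p σ T Q) (hT : T ≤ T') (hQ : ∀ σ', Frame p σ σ' → Q σ' → R σ') :
    Runs p σ T' R := by
  obtain ⟨a, s, σ', h, hs, hq⟩ := h
  exact ⟨a, s, σ', h, hs.trans hT, hQ σ' h.frame hq⟩

lemma seq (h : Runs p σ T₁ R) (h' : ∀ σ', Frame p σ σ' → R σ' → Runs q σ' T₂ Q)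
    (hT : T₁ + T₂ ≤ T) : Runs (p ;; q) σ T Q := by
  obtain ⟨a, s, σ', h, hs, hr⟩ := h
  obtain ⟨a', s', σ'', h'', hs', hq⟩ := h' σ' h.frame hr
  exact ⟨_, _, σ'', h.seq h'', by omega, hq⟩

/-- Loop-free code is executed symbolically: `Prog.run` is unfolded by `simp`, and the bound
`Prog.cost`, which takes the dearer branch of a conditional, is evaluated by `decide`. -/
lemma exec_run {p : Prog} (hp : p.straight = true) (σ : Store) :
    ∃ a s, Exec p σ a s (p.run σ) ∧ s ≤ p.cost := by
  induction p generalizing σ with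
  | skip => exact ⟨_, _, .skip σ, le_rfl⟩
  | setReg x e => exact ⟨_, _, .setReg x e σ, le_rfl⟩
  | setMem a i e => exact ⟨_, _, .setMem a i e σ, le_rfl⟩
  | setNum a i z => exact ⟨_, _, .setNum a i z σ, le_rfl⟩
  | seq p q ihp ihq =>
    simp only [Prog.straight, Bool.and_eq_true] at hp
    obtain ⟨a, s, h, hs⟩ := ihp hp.1 σ
    obtain ⟨a', s', h', hs'⟩ := ihq hp.2 (p.run σ)
    exact ⟨_, _, h.seq h', by simp only [Prog.cost]; omega⟩
  | ite b p q ihp ihq =>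
    simp only [Prog.straight, Bool.and_eq_true] at hp
    by_cases hb : b.Holds σ
    · obtain ⟨a, s, h, hs⟩ := ihp hp.1 σ
      refine ⟨_, _, by simpa only [Prog.run, if_pos hb] using h.ite_true hb, ?_⟩
      simp only [Prog.cost]; omega
    · obtain ⟨a, s, h, hs⟩ := ihq hp.2 σ
      refine ⟨_, _, by simpa only [Prog.run, if_neg hb] using h.ite_false hb, ?_⟩
      simp only [Prog.cost]; omega
  | loop b p => simp [Prog.straight] at hp

lemma frame_run {p : Prog} (hp : p.straight = true) (σ : Store) : Frame p σ (p.run σ) :=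
  let ⟨_, _, h, _⟩ := exec_run hp σ
  h.frame

lemma straight (hp : p.straight = true) (hT : p.cost ≤ T) (hQ : Q (p.run σ)) : Runs p σ T Q := by
  obtain ⟨a, s, h, hs⟩ := exec_run hp σ
  exact ⟨a, s, _, h, hs.trans hT, hQ⟩

lemma straight_seq (hp : p.straight = true) (h : Runs q (p.run σ) T₂ Q) (hT : p.cost + T₂ ≤ T) :
    Runs (p ;; q) σ T Q :=
  seq (R := fun σ' => σ' = p.run σ) (straight hp le_rfl rfl) (fun _ _ e => e ▸ h) hT

lemma ite {b : Test} (ht : b.Holds σ → Runs p σ T₁ Q) (hf : ¬ b.Holds σ → Runs q σ T₁ Q)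
    (hT : b.steps + T₁ ≤ T) : Runs (.ite b p q) σ T Q := by
  by_cases hb : b.Holds σ
  · obtain ⟨a, s, σ', h, hs, hq⟩ := ht hb
    exact ⟨_, _, σ', h.ite_true hb, by omega, hq⟩
  · obtain ⟨a, s, σ', h, hs, hq⟩ := hf hb
    exact ⟨_, _, σ', h.ite_false hb, by omega, hq⟩

/-- The rule for counting loops whose invariant keeps track of the time. -/
lemma forReg_time {x y n : ℕ} (Inv : ℕ → ℕ → Store → Prop)
    (hx : p.writesReg x = false) (hy : p.writesReg y = false) (hxy : x ≠ y) (hn : σ.reg y = n)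
    (h0 : Inv 0 0 (σ.setReg x 0))
    (hs : ∀ i < n, ∀ t σ', Frame (.forReg x y p) σ σ' → σ'.reg x = i → Inv i t σ' →
      ∃ c, Runs p σ' c fun σ'' => Inv (i + 1) (t + (c + 7)) (σ''.setReg x (i + 1))) :
    ∃ t, Runs (.forReg x y p) σ (5 + t) (Inv n t) := by
  have hw : ∀ z, (Prog.forReg x y p).writesReg z = false ↔ x ≠ z ∧ p.writesReg z = false := by
    intro z
    simp only [Prog.forReg, Prog.writesReg, Bool.or_eq_false_iff, beq_eq_false_iff_ne]
    tauto
  have hwm : ∀ z, (Prog.forReg x y p).writesMem z = p.writesMem z := by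
    intro z; simp [Prog.forReg, Prog.writesMem]
  have hwn : ∀ z, (Prog.forReg x y p).writesNum z = p.writesNum z := by
    intro z; simp [Prog.forReg, Prog.writesNum]
  -- Induction on the number `d` of remaining iterations. An iteration costs 3 steps for the test
  -- and 4 for the increment besides its body, which gives the 7; the 5 in the result is the initial
  -- assignment (2) and the last, failing test (3).
  have key : ∀ d i t σ', i + d = n → Frame (.forReg x y p) σ σ' → σ'.reg x = i → Inv i t σ' →
      ∃ t', Runs (.loop (.lt (.reg x) (.reg y)) (p ;; .setReg x (.reg x + 1))) σ'
        (3 + t') (Inv n (t + t')) := by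
    intro d
    induction d with
    | zero =>
      intro i t σ' hi hf hi' hinv
      have hyn : σ'.reg y = n := by rw [hf.reg y ((hw y).2 ⟨hxy, hy⟩), hn]
      refine ⟨0, _, _, σ', Exec.loop_false ?_, ?_, ?_⟩
      · simp [Test.Holds, hyn, hi', ← hi]
      · simp [Test.steps, IExp.steps]
      · rw [add_zero] at hi; subst hi; exact hinv
    | succ d ih =>
      intro i t σ' hi hf hi' hinv
      have hyn : σ'.reg y = n := by rw [hf.reg y ((hw y).2 ⟨hxy, hy⟩), hn]
      obtain ⟨c, a, s, σ₁, he, hs1, hq⟩ := hs i (by omega) t σ' hf hi' hinv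
      have hx1 : σ₁.reg x = i := by rw [he.frame.reg x hx, hi']
      have hf1 : Frame (.forReg x y p) σ (σ₁.setReg x (i + 1)) := by
        refine ⟨fun z hz => ?_, fun z hz => ?_, fun z hz => ?_⟩
        · have := (hw z).1 hz
          rw [Store.reg_setReg, if_neg (Ne.symm this.1), he.frame.reg z this.2, hf.reg z hz]
        · rw [Store.mem_setReg, he.frame.mem z (by rw [← hwm, hz]), hf.mem z hz]
        · rw [Store.num_setReg, he.frame.num z (by rw [← hwn, hz]), hf.num z hz]
      obtain ⟨t', a', s', σ₂, he', hs', hq'⟩ := ih (i + 1) (t + (c + 7)) _ (by omega) hf1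
        (by simp) hq
      have hinc : Exec (.setReg x (.reg x + 1)) σ₁ 0 4 (σ₁.setReg x (i + 1)) := by
        have := Exec.setReg x (.reg x + 1) σ₁
        simpa [hx1, show (IExp.reg x + 1).steps + 1 = 4 from rfl] using this
      refine ⟨c + 7 + t', _, _, σ₂, Exec.loop_true ?_ (he.seq hinc) he', ?_, ?_⟩
      · simp only [Test.Holds, IExp.eval_reg]; omega
      · simp only [Test.steps, IExp.steps]; omega
      · rw [← add_assoc]; exact hq'
  obtain ⟨t, a, s, σ', he, hs', hq⟩ := key n 0 0 (σ.setReg x 0) (by omega)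
    ⟨fun z hz => by rw [Store.reg_setReg, if_neg (Ne.symm ((hw z).1 hz).1)],
      fun _ _ => rfl, fun _ _ => rfl⟩ (by simp) h0
  refine ⟨t, _, _, σ', (Exec.setReg x 0 σ).seq he, ?_, by simpa using hq⟩
  have : (0 : IExp).steps = 1 := rfl
  omega

/-- The rule for counting loops. -/
lemma forReg {x y n : ℕ} (Inv : ℕ → Store → Prop) (c : ℕ → ℕ)
    (hx : p.writesReg x = false) (hy : p.writesReg y = false) (hxy : x ≠ y) (hn : σ.reg y = n)
    (h0 : Inv 0 (σ.setReg x 0))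
    (hs : ∀ i < n, ∀ σ', Frame (.forReg x y p) σ σ' → σ'.reg x = i → Inv i σ' →
      Runs p σ' (c i) fun σ'' => Inv (i + 1) (σ''.setReg x (i + 1)))
    (hT : 5 + ∑ i ∈ Finset.range n, (c i + 7) ≤ T) : Runs (.forReg x y p) σ T (Inv n) := by
  obtain ⟨t, h⟩ := forReg_time (σ := σ) (n := n)
    (fun i t σ' => Inv i σ' ∧ t = ∑ j ∈ Finset.range i, (c j + 7))
    hx hy hxy hn ⟨h0, by simp⟩ fun i hi t σ' hf hi' hinv => ⟨c i, by
      refine (hs i hi σ' hf hi' hinv.1).mono le_rfl fun σ'' _ h => ⟨h, ?_⟩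
      rw [Finset.sum_range_succ, hinv.2]⟩
  obtain ⟨a, s, σ', he, hs', hq, ht⟩ := h
  exact ⟨a, s, σ', he, by omega, hq⟩

/-- The rule for counting loops whose body has a fixed time bound. -/
lemma forReg_const {x y n : ℕ} (Inv : ℕ → Store → Prop) (c : ℕ)
    (hx : p.writesReg x = false) (hy : p.writesReg y = false) (hxy : x ≠ y) (hn : σ.reg y = n)
    (h0 : Inv 0 (σ.setReg x 0))
    (hs : ∀ i < n, ∀ σ', Frame (.forReg x y p) σ σ' → σ'.reg x = i → Inv i σ' →
      Runs p σ' c fun σ'' => Inv (i + 1) (σ''.setReg x (i + 1)))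
    (hT : 5 + n * (c + 7) ≤ T) : Runs (.forReg x y p) σ T (Inv n) :=
  forReg Inv (fun _ => c) hx hy hxy hn h0 hs (by simpa using hT)

end Runs

end ModCount
namespace ModCount

/-! ### Variable elimination -/

open Finset Function

/-- The message of the vertex `i`: the sum, over the values of `i`, of the local factor of `i` and the
messages of the vertices `c` with parent `i`. -/
noncomputable def message (M W : ℕ) (par : ℕ → ℕ) (L : ℕ → (ℕ → ℕ) → ℂ) (i : ℕ) (τ : ℕ → ℕ) : ℂ :=
  ∑ s ∈ range W, (∏ c ∈ (Ioc i M).attach,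
    if par c.1 = i then message M W par L c.1 (update τ i s) else 1) * L i (update τ i s)
termination_by M - i
decreasing_by
  have := mem_Ioc.1 c.2
  omega

lemma message_eq (M W : ℕ) (par : ℕ → ℕ) (L : ℕ → (ℕ → ℕ) → ℂ) (i : ℕ) (τ : ℕ → ℕ) :
    message M W par L i τ = ∑ s ∈ range W, (∏ c ∈ Ioc i M,
      if par c = i then message M W par L c (update τ i s) else 1) * L i (update τ i s) := by
  rw [message]
  refine sum_congr rfl fun s _ => ?_
  rw [prod_attach (Ioc i M)
    fun c => if par c = i then message M W par L c (update τ i s) else 1]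

/-- The sum over the values of the vertices `1, …, i`. -/
noncomputable def sumTo (W : ℕ) : ℕ → ((ℕ → ℕ) → ℂ) → (ℕ → ℕ) → ℂ
  | 0, f => f
  | i + 1, f => sumTo W i fun τ => ∑ s ∈ range W, f (update τ (i + 1) s)

/-- An elimination order: `l i` are the neighbours of `i` that are eliminated after `i`, and `par i` is
the one among them that is eliminated first. -/
structure IsElimination (M : ℕ) (l : ℕ → List ℕ) (par : ℕ → ℕ) : Prop where
  lt : ∀ i, 1 ≤ i → i ≤ M → ∀ x ∈ l i, 1 ≤ x ∧ x < i
  par_lt : ∀ i, 1 ≤ i → i ≤ M → par i < i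
  nil : ∀ i, 1 ≤ i → i ≤ M → par i = 0 → l i = []
  subset : ∀ i, 1 ≤ i → i ≤ M → par i ≠ 0 → ∀ x ∈ l i, x = par i ∨ x ∈ l (par i)

section

variable {M W : ℕ} {l : ℕ → List ℕ} {par : ℕ → ℕ} {L : ℕ → (ℕ → ℕ) → ℂ}

/-- The value of `i` is summed out, and a child `c` of `i` depends on `l c`, which is contained in
`i :: l i` by `subset`. The induction runs from the greatest vertex downwards, as children have
greater numbers. -/
lemma message_congr (h : IsElimination M l par)
    (hL : ∀ i, 1 ≤ i → i ≤ M → ∀ τ τ' : ℕ → ℕ, (∀ x ∈ i :: l i, τ x = τ' x) → L i τ = L i τ')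
    {i : ℕ} (h1 : 1 ≤ i) (hM : i ≤ M) {τ τ' : ℕ → ℕ} (hτ : ∀ x ∈ l i, τ x = τ' x) :
    message M W par L i τ = message M W par L i τ' := by
  induction hd : M - i using Nat.strong_induction_on generalizing i τ τ' with
  | _ d ih =>
    rw [message_eq, message_eq]
    have hup : ∀ s, ∀ x ∈ i :: l i, update τ i s x = update τ' i s x := by
      intro s x hx
      by_cases hxi : x = i
      · subst hxi; simp
      · rw [update_of_ne hxi, update_of_ne hxi]
        exact hτ x (by simpa [hxi] using hx)
    refine sum_congr rfl fun s _ => ?_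
    rw [hL i h1 hM _ _ (hup s)]
    congr 1
    refine prod_congr rfl fun c hc => ?_
    rw [mem_Ioc] at hc
    split_ifs with hp
    · refine ih (M - c) (by omega) (by omega) hc.2 (fun x hx => hup s x ?_) rfl
      have := h.subset c (by omega) hc.2 (by omega) x hx
      rw [hp] at this
      simpa using this
    · rfl

/-- Summing out `i + 1` collects exactly the factors that depend on it: its local factor and the
messages of its children. The messages that survive belong to the eliminated vertices whose parent
is not yet eliminated. At the end those with parent 0 remain, one for each root of the elimination
forest. -/
lemma sumTo_eq_message (h : IsElimination M l par)
    (hL : ∀ i, 1 ≤ i → i ≤ M → ∀ τ τ' : ℕ → ℕ, (∀ x ∈ i :: l i, τ x = τ' x) → L i τ = L i τ')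
    (τ : ℕ → ℕ) :
    sumTo W M (fun τ => ∏ i ∈ Ioc 0 M, L i τ) τ =
      ∏ c ∈ Ioc 0 M, if par c = 0 then message M W par L c τ else 1 := by
  have key : ∀ d i, i + d = M → sumTo W M (fun τ => ∏ i ∈ Ioc 0 M, L i τ) =
      sumTo W i (fun τ => (∏ j ∈ Ioc 0 i, L j τ) *
        ∏ c ∈ Ioc i M, if par c ≤ i then message M W par L c τ else 1) := by
    intro d
    induction d with
    | zero => intro i hi; simp only [add_zero] at hi; subst hi; simp
    | succ d ih =>
      intro i hi
      rw [ih (i + 1) (by omega), sumTo]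
      congr 1
      funext τ
      rw [show Ioc i M = insert (i + 1) (Ioc (i + 1) M) by ext x; simp; omega,
        prod_insert (by simp), if_pos (by have := h.par_lt (i + 1) (by omega) (by omega); omega),
        message_eq, ← mul_assoc, mul_comm (∏ j ∈ Ioc 0 i, L j τ), mul_assoc, sum_mul]
      refine sum_congr rfl fun s _ => ?_
      rw [show Ioc 0 (i + 1) = insert (i + 1) (Ioc 0 i) by ext x; simp; omega,
        prod_insert (by simp)]
      -- The lists only contain smaller vertices, so the local factors of the vertices up to `i` do
      -- not see the value of `i + 1`.
      have h1 : ∏ j ∈ Ioc 0 i, L j (update τ (i + 1) s) = ∏ j ∈ Ioc 0 i, L j τ := by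
        refine prod_congr rfl fun j hj => hL j ?_ ?_ _ _ fun x hx => update_of_ne ?_ _ _
        · have := mem_Ioc.1 hj; omega
        · have := mem_Ioc.1 hj; omega
        · have hj := mem_Ioc.1 hj
          rcases List.mem_cons.1 hx with rfl | hx
          · omega
          · have := h.lt j (by omega) (by omega) x hx; omega
      have h2 : ∏ c ∈ Ioc (i + 1) M,
            (if par c ≤ i + 1 then message M W par L c (update τ (i + 1) s) else 1) =
          (∏ c ∈ Ioc (i + 1) M,
            if par c = i + 1 then message M W par L c (update τ (i + 1) s) else 1) *
          ∏ c ∈ Ioc (i + 1) M, if par c ≤ i then message M W par L c τ else 1 := by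
        rw [← prod_mul_distrib]
        refine prod_congr rfl fun c hc => ?_
        rw [mem_Ioc] at hc
        rcases lt_trichotomy (par c) (i + 1) with hp | hp | hp
        -- A message whose parent is smaller than `i + 1` does not depend on `i + 1`, because its
        -- list consists of the parent and vertices below the parent.
        · rw [if_pos hp.le, if_neg hp.ne, if_pos (by omega), one_mul]
          refine message_congr h hL (by omega) hc.2 fun x hx => update_of_ne ?_ _ _
          by_cases h0 : par c = 0
          · simp [h.nil c (by omega) hc.2 h0] at hx
          · rcases h.subset c (by omega) hc.2 h0 x hx with rfl | hx'
            · omega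
            · have := h.lt (par c) (by omega) (by omega) x hx'; omega
        · rw [if_pos hp.le, if_pos hp, if_neg (by omega), mul_one]
        · rw [if_neg (by omega), if_neg (by omega), if_neg (by omega), one_mul]
      rw [h1, h2]
      ring
  rw [key M 0 (by omega)]
  simp [sumTo]

end

/-- The assignment `g` of the vertices `1, …, M`, continued by `τ`. -/
def extend {M W : ℕ} (τ : ℕ → ℕ) (g : Fin M → Fin W) (x : ℕ) : ℕ :=
  if h : 1 ≤ x ∧ x ≤ M then g ⟨x - 1, by omega⟩ else τ x

/-- Turns the nested sums, which suit elimination, into one sum over functions, which can be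
reindexed by variables and constraints. The vertices start at 1, hence the shift in `extend`. -/
lemma sumTo_eq_sum (W M : ℕ) (f : (ℕ → ℕ) → ℂ) (τ : ℕ → ℕ) :
    sumTo W M f τ = ∑ g : Fin M → Fin W, f (extend τ g) := by
  induction M generalizing f with
  | zero =>
    rw [sumTo]
    simp only [univ_unique, sum_singleton]
    congr 1
    funext x
    rw [extend, dif_neg (by omega)]
  | succ M ih =>
    rw [sumTo, ih, ← (Fin.snocEquiv fun _ => Fin W).sum_comp,
      Fintype.sum_prod_type_right]
    refine sum_congr rfl fun g _ => ?_
    rw [← Fin.sum_univ_eq_sum_range fun s => f (update (extend τ g) (M + 1) s)]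
    refine sum_congr rfl fun s _ => ?_
    congr 1
    funext x
    change _ = extend τ (Fin.snoc g s : Fin (M + 1) → Fin W) x
    by_cases hx : x = M + 1
    · subst hx
      have : (⟨M + 1 - 1, by omega⟩ : Fin (M + 1)) = Fin.last M := by ext; simp
      rw [update_self, extend, dif_pos (by omega), this, Fin.snoc_last]
    · rw [update_of_ne hx]
      by_cases h : 1 ≤ x ∧ x ≤ M
      · have : (⟨x - 1, by omega⟩ : Fin (M + 1)) = Fin.castSucc ⟨x - 1, by omega⟩ := rfl
        rw [extend, extend, dif_pos h, dif_pos (by omega), this, Fin.snoc_castSucc]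
      · rw [extend, extend, dif_neg h, dif_neg (by omega)]

/-- A product over the ordered pairs of distinct vertices, grouped by the greater one. -/
lemma prod_prod_lt (M : ℕ) (h : ℕ → ℕ → ℂ) (hd : ∀ i, h i i = 1) :
    ∏ i ∈ Ioc 0 M, ∏ u ∈ Ioo 0 i, h i u * h u i = ∏ a ∈ Ioc 0 M, ∏ c ∈ Ioc 0 M, h a c := by
  induction M with
  | zero => simp
  | succ M ih =>
    have hI : Ioc 0 (M + 1) = insert (M + 1) (Ioc 0 M) := by ext x; simp; omega
    have hJ : Ioo 0 (M + 1) = Ioc 0 M := by ext x; simp only [mem_Ioo, mem_Ioc]; omega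
    rw [hI, prod_insert (by simp), ih, hJ, prod_insert (by simp), prod_insert (by simp), hd, one_mul]
    simp_rw [prod_insert (show M + 1 ∉ Ioc 0 M by simp)]
    rw [prod_mul_distrib, prod_mul_distrib]
    ring

end ModCount
namespace ModCount

/-! ### Constraints as sums over states -/

open Finset

/-- Inversion of the discrete Fourier transform. -/
lemma sum_dft (m : ℕ) (hm : 1 ≤ m) (A : ℕ → ℂ) (p : ℕ) :
    ∑ s ∈ range m, (∑ q ∈ range m, A q *
        (1 / Complex.exp (2 * Real.pi * Complex.I / m) ^ s) ^ q) / m *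
      (Complex.exp (2 * Real.pi * Complex.I / m) ^ s) ^ p = A (p % m) := by
  have hω := Complex.isPrimitiveRoot_exp m (by omega)
  set ω := Complex.exp (2 * Real.pi * Complex.I / m) with hωd
  have hω0 : ω ≠ 0 := Complex.exp_ne_zero _
  have hm0 : (m : ℂ) ≠ 0 := by exact_mod_cast (by omega : m ≠ 0)
  -- Orthogonality of characters: the ratio is an `m`-th root of unity, so its geometric sum
  -- vanishes unless the ratio is 1, that is, unless `q` is the residue of `p`.
  have hgeom : ∀ q ∈ range m, ∑ s ∈ range m, (ω ^ p / ω ^ q) ^ s = if q = p % m then (m : ℂ) else 0 := by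
    intro q hq
    split_ifs with h
    · have : ω ^ p = ω ^ q := by
        rw [h]
        conv_lhs => rw [← Nat.mod_add_div p m, pow_add, pow_mul, hω.pow_eq_one, one_pow, mul_one]
      rw [this, div_self (pow_ne_zero _ hω0)]
      simp
    · have h1 : ω ^ p / ω ^ q ≠ 1 := by
        rw [Ne, div_eq_one_iff_eq (pow_ne_zero _ hω0)]
        intro he
        apply h
        have h2 : ω ^ (p % m) = ω ^ q := by
          rw [← he]
          conv_rhs => rw [← Nat.mod_add_div p m, pow_add, pow_mul, hω.pow_eq_one, one_pow, mul_one]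
        exact (hω.pow_inj (Nat.mod_lt _ hm) (mem_range.1 hq) h2).symm
      rw [geom_sum_eq h1, div_pow, ← pow_mul, ← pow_mul, mul_comm p, mul_comm q, pow_mul, pow_mul,
        hω.pow_eq_one]
      simp
  calc _ = ∑ s ∈ range m, ∑ q ∈ range m, A q / m * (ω ^ p / ω ^ q) ^ s := by
        refine sum_congr rfl fun s _ => ?_
        rw [sum_div, sum_mul]
        refine sum_congr rfl fun q _ => ?_
        rw [div_pow, div_pow, one_pow, ← pow_mul, ← pow_mul, ← pow_mul, ← pow_mul, mul_comm p s,
          mul_comm q s]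
        ring
    _ = ∑ q ∈ range m, A q / m * if q = p % m then (m : ℂ) else 0 := by
        rw [sum_comm]
        refine sum_congr rfl fun q hq => ?_
        rw [← mul_sum, hgeom q hq]
    _ = A (p % m) := by
        simp only [mul_ite, mul_zero]
        rw [sum_ite_eq', if_pos (mem_range.2 (Nat.mod_lt _ hm))]
        field_simp

namespace Constraint

variable {n : ℕ}

/-- The value `v` of the variable `x` makes a literal of the constraint true; the variables of a modulo
constraint count as positive literals. -/
def Lit (c : Constraint n) (x v : ℕ) : Prop := (v = 1 ∧ x ∈ c.posVars) ∨ v = 0 ∧ x ∈ c.negVars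

/-- The weight of a state of the constraint. -/
noncomputable def weight (c : Constraint n) (s : ℕ) : ℂ :=
  if c.modulus = 0 then if s = 0 then 1 else if s = 1 then -1 else 0
  else if c.posVars = [] then if s = 0 then (c.acceptTable.getD 0 0 : ℂ) else 0
  else if s < c.modulus then
    (∑ q ∈ range c.modulus, (c.acceptTable.getD q 0 : ℂ) *
      (1 / Complex.exp (2 * Real.pi * Complex.I / c.modulus) ^ s) ^ q) / c.modulus
  else 0

/-- The factor that each true literal contributes to a state of the constraint. -/
noncomputable def factor (c : Constraint n) (s : ℕ) : ℂ :=
  if c.modulus = 0 then if s = 0 then 1 else 0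
  else if c.posVars = [] then 0
  else if s < c.modulus then Complex.exp (2 * Real.pi * Complex.I / c.modulus) ^ s
  else 0

@[simp] lemma mem_posVars_clause {pos neg : Finset (Fin n)} {x : Fin n} :
    (x : ℕ) ∈ (clause pos neg).posVars ↔ x ∈ pos := by
  simp [posVars, Fin.val_inj]

@[simp] lemma mem_negVars_clause {pos neg : Finset (Fin n)} {x : Fin n} :
    (x : ℕ) ∈ (clause pos neg).negVars ↔ x ∈ neg := by
  simp [negVars, Fin.val_inj]

@[simp] lemma mem_posVars_modulo {m : ℕ} {S : Finset (Fin n)} {f : (S → Bool) → Bool}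
    {hf : IsModulo m f} {x : Fin n} : (x : ℕ) ∈ (modulo m S f hf).posVars ↔ x ∈ S := by
  simp [posVars, Fin.val_inj]

open Classical in
-- The table bit only asserts that some assignment of the residue class is accepted; by `IsModulo`
-- all assignments of the class then have the same value.
lemma getD_acceptTable_modulo {m : ℕ} {S : Finset (Fin n)} {f : (S → Bool) → Bool}
    {hf : IsModulo m f} {q : ℕ} (hq : q < m) (x : S → Bool)
    (hx : (∑ i, (x i).toNat) ≡ q [MOD m]) :
    (modulo m S f hf).acceptTable.getD q 0 = if f x = true then 1 else 0 := by
  have : (∃ y, (∑ i, (y i).toNat) ≡ q [MOD m] ∧ f y = true) ↔ f x = true := by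
    constructor
    · rintro ⟨y, hy, hfy⟩
      rw [hf.2 x y (hx.trans hy.symm), hfy]
    · intro h
      exact ⟨x, hx, h⟩
  rw [acceptTable, List.getD_eq_getElem _ _ (by simpa using hq)]
  rw [List.getElem_map, List.getElem_range]
  exact if_congr this rfl rfl

open Classical in
/-- The sum over the states of a constraint is the truth value of the constraint. -/
lemma sum_weight (c : Constraint n) {W : ℕ} (hW : 2 ≤ W) (hc : c.modulus ≤ W) (τ : Fin n → Bool) :
    ∑ s ∈ range W, c.weight s *
      ∏ x : Fin n, (if c.Lit x (τ x).toNat then c.factor s else 1) =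
    if c.Sat τ then 1 else 0 := by
  simp_rw [prod_ite, prod_const_one, mul_one, prod_const]
  cases c with
  | clause pos neg =>
    -- All true literals contribute the same factor, so the product is a power with exponent `p`. A
    -- variable that occurs with both signs is counted once, since only one of its literals is true.
    set p := #{x : Fin n | (clause pos neg).Lit x (τ x).toNat} with hp
    rw [← sum_subset (s₁ := range 2) (by simpa using hW)]
    · have hsat : (clause pos neg).Sat τ ↔ p ≠ 0 := by
        rw [hp, Ne, card_eq_zero, filter_eq_empty_iff]
        simp only [Sat, Lit, mem_posVars_clause, mem_negVars_clause, mem_univ, true_imp_iff]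
        push Not
        constructor
        · rintro (⟨x, hx, h⟩ | ⟨x, hx, h⟩)
          · exact ⟨x, Or.inl ⟨by simp [h], hx⟩⟩
          · exact ⟨x, Or.inr ⟨by simp [h], hx⟩⟩
        · rintro ⟨x, ⟨h, hx⟩ | ⟨h, hx⟩⟩
          · exact Or.inl ⟨x, hx, by simpa using h⟩
          · exact Or.inr ⟨x, hx, by simpa using h⟩
      rw [sum_range_succ, sum_range_one, hsat]
      -- The two states add up to `1 - 0 ^ p`, which is 0 exactly if no literal is true.
      by_cases h : p = 0 <;> simp [h, weight, factor, modulus]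
    · intro s _ hs
      have : 2 ≤ s := by rw [mem_range] at hs; omega
      simp [weight, modulus, show s ≠ 0 by omega, show s ≠ 1 by omega]
  | modulo m S f hf =>
    have hm := hf.1
    have hm0 : m ≠ 0 := by omega
    set p := #{x : Fin n | (modulo m S f hf).Lit x (τ x).toNat} with hp
    have hp' : p = ∑ i : S, (τ i).toNat := by
      rw [hp, card_filter, Finset.sum_coe_sort S (fun i => (τ i).toNat),
        ← sum_subset (subset_univ S)]
      · refine sum_congr rfl fun x hx => ?_
        cases h : τ x <;> simp [Lit, negVars, hx]
      · intro x _ hx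
        simp [Lit, negVars, hx]
    trans ((if f (fun i => τ i) = true then 1 else 0 : ℕ) : ℂ)
    swap
    · rw [Nat.cast_ite, Nat.cast_one, Nat.cast_zero]
      exact if_congr Iff.rfl rfl rfl
    -- A modulo constraint without variables is a constant. It gets a single state, so that its
    -- weight needs no Fourier transform, which the time bound would not allow for bags of size 1.
    by_cases hS : (modulo m S f hf).posVars = []
    · have hS' : ∀ x, x ∉ S := fun x hx => by
        have := (mem_posVars_modulo (hf := hf)).2 hx
        rw [hS] at this
        simp at this
      have hp0 : p = 0 := by
        rw [hp']
        exact sum_eq_zero fun i _ => absurd i.2 (hS' i)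
      rw [sum_eq_single_of_mem 0 (mem_range.2 (by omega))
        fun s _ hs => by simp [weight, hS, modulus, hm0, hs]]
      rw [hp0, pow_zero, mul_one, weight, if_neg (show (modulo m S f hf).modulus ≠ 0 from hm0), if_pos hS, if_pos rfl,
        getD_acceptTable_modulo hm (fun i => τ i) (by rw [← hp', hp0])]
    · rw [← sum_subset (s₁ := range m) (range_subset_range.2 hc)]
      · have h := sum_dft m hm (fun q => ((modulo m S f hf).acceptTable.getD q 0 : ℂ)) p
        rw [getD_acceptTable_modulo (Nat.mod_lt _ hm) (fun i => τ i)
          (by rw [← hp']; exact (Nat.mod_modEq _ _).symm)] at h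
        rw [← h]
        refine sum_congr rfl fun s hs => ?_
        simp [weight, factor, modulus, hm0, hS, mem_range.1 hs]
      · intro s _ hs
        have : ¬ s < m := by simpa using hs
        simp [weight, modulus, hm0, hS, this]

end Constraint

open Classical in
/-- The model count as a sum over the values of the variables and the states of the constraints. -/
lemma sum_eq_modelCount {n r W : ℕ} (F : Fin r → Constraint n) (hW : 2 ≤ W)
    (hF : ∀ j, (F j).modulus ≤ W) :
    ∑ x : Fin n → Fin W, ∑ s : Fin r → Fin W,
      (∏ i, if (x i : ℕ) < 2 then (1 : ℂ) else 0) * ((∏ j, (F j).weight (s j)) *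
        ∏ j, ∏ i : Fin n, if (F j).Lit i (x i) then (F j).factor (s j) else 1) = modelCount F := by
  have h1 : ∀ x : Fin n → Fin W, ∑ s : Fin r → Fin W,
      (∏ i, if (x i : ℕ) < 2 then (1 : ℂ) else 0) * ((∏ j, (F j).weight (s j)) *
        ∏ j, ∏ i : Fin n, if (F j).Lit i (x i) then (F j).factor (s j) else 1) =
      (∏ i, if (x i : ℕ) < 2 then (1 : ℂ) else 0) * ∏ j, ∑ s ∈ range W, (F j).weight s *
        ∏ i : Fin n, if (F j).Lit i (x i) then (F j).factor s else 1 := by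
    intro x
    rw [← mul_sum]
    simp_rw [← prod_mul_distrib, ← Fin.sum_univ_eq_sum_range fun s => (F _).weight s *
        ∏ i : Fin n, if (F _).Lit i (x i) then (F _).factor s else 1]
    rw [Fintype.prod_sum]
  simp_rw [h1]
  let b : Bool → Fin W := fun v => ⟨v.toNat, by have := v.toNat_lt; omega⟩
  have hb : Function.Injective fun (τ : Fin n → Bool) i => b (τ i) := by
    intro τ τ' h
    funext i
    have := congrArg Fin.val (congrFun h i)
    revert this
    cases h1 : τ i <;> cases h2 : τ' i <;> simp [b, h1, h2]
  -- All vertices share the range `Fin W`. The weights of the variables annihilate every term with a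
  -- value of at least 2, so only the images of Boolean assignments count.
  rw [← Finset.sum_of_injOn (s := univ) (f := fun τ : Fin n → Bool => if ∀ j, (F j).Sat τ then (1 : ℂ) else 0)
    (fun τ i => b (τ i)) hb.injOn (fun _ _ => mem_coe.2 (mem_univ _)) ?_ ?_]
  · rw [modelCount, sum_boole, Nat.card_eq_fintype_card, Fintype.card_subtype]
  · intro x _ hx
    have : ∃ i, ¬ (x i : ℕ) < 2 := by
      by_contra! hcon
      refine hx ⟨fun i => decide ((x i : ℕ) = 1), mem_coe.2 (mem_univ _), ?_⟩
      funext i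
      ext
      have := hcon i
      by_cases h : (x i : ℕ) = 1
      · simp [b, h]
      · simp [b, h]; omega
    obtain ⟨i, hi⟩ := this
    rw [prod_eq_zero (mem_univ i) (if_neg hi), zero_mul]
  · intro τ _
    have h2 : ∀ i, (b (τ i) : ℕ) = (τ i).toNat := fun _ => rfl
    simp_rw [h2, fun j => (F j).sum_weight hW (hF j) τ]
    have h3 : ∀ i, (τ i).toNat < 2 := fun i => (τ i).toNat_lt
    simp only [h3, if_true, prod_const_one, one_mul]
    rw [prod_ite_zero]
    simp

end ModCount
namespace ModCount

/-! ### Search orders of trees -/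

/-- The nodes of a tree are numbered such that every node but the one with number `0` has a neighbour,
its parent, with a smaller number. -/
structure IsSearchOrder {V : Type} (G : SimpleGraph V) (pos : V → ℕ) (pa : V → V) : Prop where
  inj : Function.Injective pos
  lt : ∀ t, pos t ≠ 0 → pos (pa t) < pos t
  adj : ∀ t, pos t ≠ 0 → G.Adj (pa t) t

namespace IsSearchOrder

variable {V : Type} {G : SimpleGraph V} {pos : V → ℕ} {pa : V → V}

/-- In a tree every edge joins a node to its parent. -/
lemma eq_parent (h : IsSearchOrder G pos pa) (hG : G.IsTree) {x y : V} (hxy : G.Adj x y) :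
    (pos x ≠ 0 ∧ y = pa x) ∨ pos y ≠ 0 ∧ x = pa y := by
  -- The edges to parents already form a connected spanning subgraph, because every node reaches the
  -- root by descending numbers. A tree is minimal among connected graphs, so it has no further
  -- edge.
  let G' : SimpleGraph V := SimpleGraph.fromRel fun x y => pos x ≠ 0 ∧ y = pa x
  have hadj : ∀ t, pos t ≠ 0 → G'.Adj t (pa t) := by
    intro t ht
    refine ⟨fun he => ?_, Or.inl ⟨ht, rfl⟩⟩
    have := h.lt t ht
    rw [← he] at this
    exact lt_irrefl _ this
  have hroot : ∀ t, ∃ r, pos r = 0 ∧ G'.Reachable t r := by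
    intro t
    induction hd : pos t using Nat.strong_induction_on generalizing t with
    | _ d ih =>
      by_cases ht : pos t = 0
      · exact ⟨t, ht, .refl _⟩
      · obtain ⟨r, hr, hr'⟩ := ih _ (hd ▸ h.lt t ht) (pa t) rfl
        exact ⟨r, hr, (hadj t ht).reachable.trans hr'⟩
  have hconn : G'.Connected := by
    have := hG.connected.nonempty
    refine ⟨fun x y => ?_⟩
    obtain ⟨r, hr, hxr⟩ := hroot x
    obtain ⟨r', hr', hyr⟩ := hroot y
    obtain rfl : r = r' := h.inj (hr.trans hr'.symm)
    exact hxr.trans hyr.symm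
  have hle : G' ≤ G := by
    rintro x y ⟨-, ⟨hx, rfl⟩ | ⟨hy, rfl⟩⟩
    · exact (h.adj x hx).symm
    · exact h.adj y hy
  exact ((SimpleGraph.isTree_iff_minimal_connected.1 hG).2 hconn hle hxy).2

/-- An edge leaves the set `D` of descendants of `t` only from `t` to its parent. If the parent were
not in `S`, then everything reachable from `t` inside `S` would be a descendant, with a number of at
least `pos t`; but `f` is earlier. -/
lemma parent_mem (h : IsSearchOrder G pos pa) (hG : G.IsTree) {S : Set V}
    (hS : (G.induce S).Connected) {t f : V} (ht : t ∈ S) (hf : f ∈ S) (hlt : pos f < pos t) :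
    pa t ∈ S := by
  by_contra hpt
  let D : V → Prop := fun x => Relation.ReflTransGen (fun x y => pos x ≠ 0 ∧ y = pa x) x t
  have hD : ∀ x, D x → pos t ≤ pos x := by
    intro x hx
    induction hx using Relation.ReflTransGen.head_induction_on with
    | refl => exact le_rfl
    | head hxy _ ih =>
      obtain ⟨hx, rfl⟩ := hxy
      exact ih.trans (h.lt _ hx).le
  have hreach : (G.induce S).Reachable ⟨t, ht⟩ ⟨f, hf⟩ := hS.preconnected _ _
  rw [SimpleGraph.reachable_iff_reflTransGen] at hreach
  have hDf : ∀ y : S, Relation.ReflTransGen (G.induce S).Adj ⟨t, ht⟩ y → D y.1 := by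
    intro y hreach
    induction hreach with
    | refl => exact .refl
    | @tail y z _ hyz ih =>
      rcases h.eq_parent hG hyz with ⟨hy, hz⟩ | ⟨hz, hy⟩
      · change z.1 = pa y.1 at hz
        rcases Relation.ReflTransGen.cases_head ih with heq | ⟨x, ⟨-, rfl⟩, hx⟩
        · rw [heq] at hz
          exact absurd (hz ▸ z.2) hpt
        · rw [hz]; exact hx
      · exact .head ⟨hz, hy⟩ ih
  exact absurd (hD f (hDf _ hreach)) (by omega)

/-- If two vertices share a bag, then the one whose first bag comes earlier is in the first bag of the
other one. -/
lemma mem_first_bag (h : IsSearchOrder G pos pa) (hG : G.IsTree) {X : Type} {bag : V → Finset X}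
    (hbag : ∀ u, (G.induce {t | u ∈ bag t}).Connected) {u v : X} {tu tv t : V}
    (hu : u ∈ bag tu) (hv : v ∈ bag tv) (hv' : ∀ t, v ∈ bag t → pos tv ≤ pos t)
    (huv : pos tu ≤ pos tv) (htu : u ∈ bag t) (htv : v ∈ bag t) : u ∈ bag tv := by
  -- Walk from the shared bag to the root. As long as `t` comes after `tv`, it also comes after
  -- `tu`, and by `parent_mem` both vertices belong to the bag of the parent. The walk stops at
  -- `tv`, the first bag of `v`.
  induction hd : pos t using Nat.strong_induction_on generalizing t with
  | _ d ih =>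
    rcases (hv' t htv).lt_or_eq with hlt | heq
    · exact ih _ (hd ▸ h.lt t (by omega)) (h.parent_mem hG (hbag u) htu hu (by omega))
        (h.parent_mem hG (hbag v) htv hv hlt) rfl
    · rwa [h.inj heq]

end IsSearchOrder

end ModCount
namespace ModCount

/-! ### The input -/

open Finset

/-- The lists `l 0, …, l (c - 1)` are stored in the arrays `S` (starts) and `E` (entries). -/
structure Stored (c : ℕ) (l : ℕ → List ℕ) (S E : ℕ → ℕ) : Prop where
  start_succ : ∀ i < c, S (i + 1) = S i + (l i).length
  entry : ∀ i < c, ∀ j < (l i).length, E (S i + j) = (l i).getD j 0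

/-- A family of lists, continued by the empty list. -/
def natFamily {c : ℕ} (l : Fin c → List ℕ) (i : ℕ) : List ℕ :=
  if h : i < c then l ⟨i, h⟩ else []

@[simp] lemma natFamily_val {c : ℕ} (l : Fin c → List ℕ) (i : Fin c) : natFamily l i = l i := by
  simp [natFamily]

lemma stored_starts_entries {c : ℕ} (l : Fin c → List ℕ) :
    Stored c (natFamily l) (starts l) (entries l) := by
  constructor
  · intro i hi
    rw [starts, starts, List.take_add_one, List.map_append, List.sum_append]
    simp [hi, natFamily]
  · intro i hi j hj
    have hsplit : List.ofFn l = (List.ofFn l).take i ++ (natFamily l i :: (List.ofFn l).drop (i + 1)) := by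
      conv_lhs => rw [← List.take_append_drop i (List.ofFn l)]
      rw [List.drop_eq_getElem_cons (by simpa using hi)]
      simp [natFamily, hi]
    rw [entries, hsplit, List.flatten_append, List.flatten_cons, List.getD_append_right]
    · rw [List.length_flatten, starts, Nat.add_sub_cancel_left, List.getD_append _ _ _ _ hj]
    · rw [List.length_flatten, starts]
      omega

/-- The number of a vertex of the incidence graph in the input. -/
def vertexCode {n r : ℕ} : Fin n ⊕ Fin r → ℕ
  | .inl i => i
  | .inr j => n + j

lemma vertexCode_lt {n r : ℕ} (v : Fin n ⊕ Fin r) : vertexCode v < n + r := by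
  rcases v with i | j <;> simp only [vertexCode] <;> omega

lemma vertexCode_injective {n r : ℕ} :
    Function.Injective (vertexCode : Fin n ⊕ Fin r → ℕ) := by
  rintro (i | i) (j | j) h <;> simp only [vertexCode] at h
  · rw [Fin.ext h]
  · omega
  · omega
  · rw [Fin.ext (by omega : (i : ℕ) = j)]

lemma exists_vertexCode {n r u : ℕ} (hu : u < n + r) :
    ∃ v : Fin n ⊕ Fin r, vertexCode v = u := by
  by_cases h : u < n
  · exact ⟨.inl ⟨u, h⟩, rfl⟩
  · exact ⟨.inr ⟨u - n, by omega⟩, by simp only [vertexCode]; omega⟩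

lemma mem_vertexList {n r : ℕ} {B : Finset (Fin n ⊕ Fin r)} {x : ℕ} :
    x ∈ vertexList B ↔ ∃ v ∈ B, vertexCode v = x := by
  simp [vertexList, vertexCode]

lemma nodup_vertexList {n r : ℕ} (B : Finset (Fin n ⊕ Fin r)) : (vertexList B).Nodup := by
  rw [vertexList, List.nodup_append']
  refine ⟨((List.nodup_finRange n).filter _).map Fin.val_injective,
    ((List.nodup_finRange r).filter _).map fun i j h => Fin.ext (by simpa using h), ?_⟩
  intro x hx hx'
  simp only [List.mem_map, List.mem_filter] at hx hx'
  obtain ⟨i, -, rfl⟩ := hx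
  obtain ⟨j, -, h⟩ := hx'
  omega

lemma length_vertexList {n r : ℕ} (B : Finset (Fin n ⊕ Fin r)) :
    (vertexList B).length = B.card := by
  classical
  rw [← List.toFinset_card_of_nodup (nodup_vertexList B),
    ← card_image_of_injective B vertexCode_injective]
  congr 1
  ext x
  simp [mem_vertexList]

lemma mem_neighbourList {N : ℕ} {T : SimpleGraph (Fin N)} {t u : Fin N} :
    (u : ℕ) ∈ neighbourList T t ↔ T.Adj t u := by
  simp [neighbourList, Fin.val_inj]

/-! ### Bounds for the total length of the input lists -/

lemma sum_length_neighbourList {N : ℕ} {T : SimpleGraph (Fin N)} (hT : T.IsTree) :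
    ∑ t, (neighbourList T t).length ≤ 2 * N := by
  classical
  have h1 : ∀ t, (neighbourList T t).length = T.degree t := by
    intro t
    rw [neighbourList, List.length_map, ← T.card_neighborFinset_eq_degree,
      ← List.toFinset_card_of_nodup ((List.nodup_finRange N).filter _)]
    congr 1
    ext u
    simp
  simp_rw [h1]
  have h2 := hT.card_edgeFinset
  rw [T.sum_degrees_eq_twice_card_edges]
  rw [Fintype.card_fin] at h2
  omega

lemma Constraint.length_posVars_le {n : ℕ} (c : Constraint n) :
    c.posVars.length ≤ #c.scope := by
  have : ∀ s : Finset (Fin n), (((List.finRange n).filter (· ∈ s)).map Fin.val).length = #s := by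
    intro s
    rw [List.length_map, ← List.toFinset_card_of_nodup ((List.nodup_finRange n).filter _)]
    congr 1
    ext; simp
  cases c with
  | clause pos neg => exact (this pos).trans_le (card_le_card subset_union_left)
  | modulo m s f hf => exact (this s).le

lemma Constraint.length_negVars_le {n : ℕ} (c : Constraint n) :
    c.negVars.length ≤ #c.scope := by
  have : ∀ s : Finset (Fin n), (((List.finRange n).filter (· ∈ s)).map Fin.val).length = #s := by
    intro s
    rw [List.length_map, ← List.toFinset_card_of_nodup ((List.nodup_finRange n).filter _)]
    congr 1
    ext; simp
  cases c with
  | clause pos neg => exact (this neg).trans_le (card_le_card subset_union_right)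
  | modulo m s f hf => exact Nat.zero_le _

lemma Constraint.length_acceptTable {n : ℕ} (c : Constraint n) :
    c.acceptTable.length = c.modulus := by
  cases c <;> simp [acceptTable, modulus]

lemma Constraint.mem_scope_of_mem_posVars {n x : ℕ} {c : Constraint n} (h : x ∈ c.posVars) :
    ∃ i ∈ c.scope, i.val = x := by
  cases c with
  | clause pos neg =>
    simp only [posVars, List.mem_map, List.mem_filter, decide_eq_true_eq] at h
    obtain ⟨i, hi, rfl⟩ := h
    exact ⟨i, mem_union_left _ hi.2, rfl⟩
  | modulo m s f hf =>
    simp only [posVars, List.mem_map, List.mem_filter, decide_eq_true_eq] at h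
    obtain ⟨i, hi, rfl⟩ := h
    exact ⟨i, hi.2, rfl⟩

lemma Constraint.mem_scope_of_mem_negVars {n x : ℕ} {c : Constraint n} (h : x ∈ c.negVars) :
    ∃ i ∈ c.scope, i.val = x := by
  cases c with
  | clause pos neg =>
    simp only [negVars, List.mem_map, List.mem_filter, decide_eq_true_eq] at h
    obtain ⟨i, hi, rfl⟩ := h
    exact ⟨i, mem_union_right _ hi.2, rfl⟩
  | modulo m s f hf => simp [negVars] at h

/-- A relation whose every pair shares the chosen bag of one of its members has at most
`k` times as many pairs as there are vertices. -/
lemma sum_card_le {n r k : ℕ} (R : Fin r → Finset (Fin n)) (B : Fin n ⊕ Fin r → Finset (Fin n ⊕ Fin r))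
    (hB : ∀ v, #(B v) ≤ k)
    (hR : ∀ j, ∀ i ∈ R j, Sum.inl i ∈ B (.inr j) ∨ Sum.inr j ∈ B (.inl i)) :
    ∑ j, #(R j) ≤ k * (n + r) := by
  classical
  have h1 : ∀ j, #(R j) ≤ #{i | Sum.inl i ∈ B (.inr j)} + #{i | Sum.inr j ∈ B (.inl i)} := by
    intro j
    refine (card_le_card fun i hi => ?_).trans (card_union_le _ _)
    simpa using hR j i hi
  have h2 : ∀ v, #{i | Sum.inl i ∈ B v} ≤ k := by
    intro v
    refine le_trans ?_ (hB v)
    rw [← card_image_of_injective _ (Sum.inl_injective (α := Fin n) (β := Fin r))]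
    exact card_le_card fun x hx => by
      obtain ⟨i, hi, rfl⟩ := mem_image.1 hx
      simpa using hi
  have h3 : ∀ v, #{j | Sum.inr j ∈ B v} ≤ k := by
    intro v
    refine le_trans ?_ (hB v)
    rw [← card_image_of_injective _ (Sum.inr_injective (α := Fin n) (β := Fin r))]
    exact card_le_card fun x hx => by
      obtain ⟨i, hi, rfl⟩ := mem_image.1 hx
      simpa using hi
  -- Double counting: the incidences charged to variables are summed by variable, so that each
  -- vertex pays for at most `k`.
  have h4 : ∑ j : Fin r, #{i : Fin n | Sum.inr j ∈ B (.inl i)} =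
      ∑ i : Fin n, #{j : Fin r | Sum.inr j ∈ B (.inl i)} := by
    simp_rw [card_filter]
    exact sum_comm
  calc _ ≤ ∑ j : Fin r, (#{i | Sum.inl i ∈ B (.inr j)} + #{i | Sum.inr j ∈ B (.inl i)}) :=
        sum_le_sum fun j _ => h1 j
    _ ≤ ∑ _j : Fin r, k + ∑ _i : Fin n, k := by
        rw [sum_add_distrib, h4]
        exact add_le_add (sum_le_sum fun j _ => h2 _) (sum_le_sum fun i _ => h3 _)
    _ = k * (n + r) := by simp; ring

/-- An incidence is charged to the end whose first bag comes later; this bag contains the other end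
by `IsSearchOrder.mem_first_bag`. It makes reading all literals affordable. -/
lemma sum_card_scope_le {n r N : ℕ} (F : Fin r → Constraint n)
    (D : TreeDecomposition (incidenceGraph F) N) {pos : Fin N → ℕ}
    {pa : Fin N → Fin N} (h : IsSearchOrder D.tree pos pa) {top : Fin n ⊕ Fin r → Fin N}
    (htop : ∀ v, v ∈ D.bag (top v)) (hmin : ∀ v t, v ∈ D.bag t → pos (top v) ≤ pos t) :
    ∑ j, #(F j).scope ≤ D.width * (n + r) := by
  refine sum_card_le _ (fun v => D.bag (top v))
    (fun v => le_sup (f := fun t => #(D.bag t)) (mem_univ (top v))) fun j i hi => ?_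
  obtain ⟨t, h1, h2⟩ := D.edge (.inl i) (.inr j) (Or.inl ⟨i, j, rfl, rfl, hi⟩)
  rcases le_total (pos (top (.inl i))) (pos (top (.inr j))) with hle | hle
  · exact Or.inl (h.mem_first_bag D.isTree D.connected (htop _) (htop _) (hmin _) hle h1 h2)
  · exact Or.inr (h.mem_first_bag D.isTree D.connected (htop _) (htop _) (hmin _) hle h2 h1)

end ModCount
namespace ModCount

open Finset Function

/-! ### Breadth-first search of the tree -/

/-- The queue `ord` of length `tail` and the visited nodes `vis` of a breadth-first search from the node
`0`, of which the first `h` nodes of the queue have been processed. -/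
structure SearchInv (N : ℕ) (nbr : ℕ → List ℕ) (ord vis : ℕ → ℕ) (tail h : ℕ) : Prop where
  le : h ≤ tail
  zero : 0 < tail ∧ ord 0 = 0
  lt : ∀ q < tail, ord q < N
  inj : ∀ q < tail, ∀ q' < tail, ord q = ord q' → q = q'
  parent : ∀ q < tail, q ≠ 0 → ∃ q' < q, ord q ∈ nbr (ord q')
  vis_iff : ∀ y, vis y ≠ 0 ↔ ∃ q < tail, ord q = y
  closed : ∀ q < h, ∀ y ∈ nbr (ord q), vis y ≠ 0

namespace SearchInv

variable {N : ℕ} {nbr : ℕ → List ℕ} {ord vis : ℕ → ℕ} {tail h : ℕ}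

lemma push (H : SearchInv N nbr ord vis tail h) {y q' : ℕ} (hy : y < N) (hv : vis y = 0)
    (hq' : q' < tail) (hyq : y ∈ nbr (ord q')) :
    SearchInv N nbr (update ord tail y) (update vis y 1) (tail + 1) h := by
  have hold : ∀ q < tail, update ord tail y q = ord q := fun q hq => update_of_ne hq.ne _ _
  have hnew : ∀ q < tail, ord q ≠ y := fun q hq he => (H.vis_iff y).2 ⟨q, hq, he⟩ hv
  refine ⟨by have := H.le; omega, ⟨by omega, by rw [hold 0 H.zero.1, H.zero.2]⟩, ?_, ?_, ?_, ?_, ?_⟩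
  · intro q hq
    rcases Nat.lt_succ_iff_lt_or_eq.1 hq with hq | rfl
    · rw [hold q hq]; exact H.lt q hq
    · simpa using hy
  · intro q hq p hp he
    rcases Nat.lt_succ_iff_lt_or_eq.1 hq with hq | rfl <;>
      rcases Nat.lt_succ_iff_lt_or_eq.1 hp with hp | rfl
    · rw [hold q hq, hold p hp] at he; exact H.inj q hq p hp he
    · rw [hold q hq, update_self] at he; exact absurd he (hnew q hq)
    · rw [hold p hp, update_self] at he; exact absurd he.symm (hnew p hp)
    · rfl
  · intro q hq hq0
    rcases Nat.lt_succ_iff_lt_or_eq.1 hq with hq | rfl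
    · obtain ⟨p, hp, hpq⟩ := H.parent q hq hq0
      exact ⟨p, hp, by rwa [hold q hq, hold p (by omega)]⟩
    · exact ⟨q', hq', by rwa [update_self, hold q' hq']⟩
  · intro x
    by_cases hx : x = y
    · subst hx
      simp only [update_self, ne_eq, one_ne_zero, not_false_eq_true, true_iff]
      exact ⟨tail, by omega, by simp⟩
    · rw [update_of_ne hx, H.vis_iff]
      constructor
      · rintro ⟨q, hq, rfl⟩
        exact ⟨q, by omega, hold q hq⟩
      · rintro ⟨q, hq, he⟩
        rcases Nat.lt_succ_iff_lt_or_eq.1 hq with hq | rfl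
        · exact ⟨q, hq, by rw [← he, hold q hq]⟩
        · rw [update_self] at he; exact absurd he.symm hx
  · intro q hq x hx
    rw [hold q (by have := H.le; omega)] at hx
    by_cases hxy : x = y
    · subst hxy; simp
    · rw [update_of_ne hxy]; exact H.closed q hq x hx

lemma next (H : SearchInv N nbr ord vis tail h) (hlt : h < tail)
    (hc : ∀ y ∈ nbr (ord h), vis y ≠ 0) : SearchInv N nbr ord vis tail (h + 1) :=
  { H with
    le := hlt
    closed := fun q hq => by
      rcases Nat.lt_succ_iff_lt_or_eq.1 hq with hq | rfl
      · exact H.closed q hq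
      · exact hc }

/-- If the queue ran empty after `h < N` nodes, the visited nodes would be closed under neighbours
and contain 0. The hypothesis `hconn`, which is connectedness in the form of an induction principle,
would make all `N` nodes visited, but the queue has only `h` entries. -/
lemma lt_tail (H : SearchInv N nbr ord vis tail h) (hN : h < N)
    (hconn : ∀ S : ℕ → Prop, S 0 → (∀ t, S t → ∀ y ∈ nbr t, S y) → ∀ t < N, S t) : h < tail := by
  by_contra hlt
  have hh : h = tail := by have := H.le; omega
  subst hh
  have hall := hconn (fun t => vis t ≠ 0) ((H.vis_iff 0).2 ⟨0, H.zero⟩) fun t ht y hy => by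
    obtain ⟨q, hq, rfl⟩ := (H.vis_iff t).1 ht
    exact H.closed q hq y hy
  have hsub : range N ⊆ (range h).image ord := by
    intro t ht
    obtain ⟨q, hq, he⟩ := (H.vis_iff t).1 (hall t (mem_range.1 ht))
    exact mem_image.2 ⟨q, mem_range.2 hq, he⟩
  have := (card_le_card hsub).trans card_image_le
  simp only [card_range] at this
  omega

end SearchInv

/-- The nodes of a rooted tree, every node after its parent. -/
structure SearchList (N : ℕ) (nbr : ℕ → List ℕ) (ord : ℕ → ℕ) : Prop where
  lt : ∀ q < N, ord q < N
  inj : ∀ q < N, ∀ q' < N, ord q = ord q' → q = q'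
  parent : ∀ q < N, q ≠ 0 → ∃ q' < q, ord q ∈ nbr (ord q')

/-- The neighbours of the current node are appended to the queue. -/
def searchNode : Prog :=
  .forReg 12 11 (.setReg 13 (.load 8 (.reg 10 + .reg 12)) ;;
    .ite (.eq (.load 12 (.reg 13)) 0)
      (.setMem 12 (.reg 13) 1 ;; .setMem 11 (.reg 14) (.reg 13) ;; .setReg 14 (.reg 14 + 1)) .skip)

/-- Breadth-first search: lists the nodes of the tree in the array `11`. -/
def search : Prog :=
  (.setReg 14 1 ;; .setMem 12 0 1 ;; .setMem 11 0 0) ;;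
  .forReg 8 2 ((.setReg 9 (.load 11 (.reg 8)) ;; .setReg 10 (.load 7 (.reg 9)) ;;
    .setReg 11 (.load 7 (.reg 9 + 1) - .reg 10)) ;; searchNode)

/-- Pushing happens at `tail > h`, so the queue up to position `h` stays fixed. This keeps the
current node in place and, in the caller, the time already accounted for. -/
lemma runs_searchNode {σ : Store} {N t h : ℕ} {nbr : ℕ → List ℕ}
    (hnbr : ∀ t < N, ∀ y ∈ nbr t, y < N) (hst : Stored N nbr (σ.mem 7) (σ.mem 8)) (hN : t < N)
    (h9 : σ.mem 11 h = t) (h10 : σ.reg 10 = σ.mem 7 t) (h11 : σ.reg 11 = (nbr t).length)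
    (hinv : SearchInv N nbr (σ.mem 11) (σ.mem 12) (σ.reg 14) h) (hh : h < σ.reg 14) :
    Runs searchNode σ (5 + (nbr t).length * 30) fun σ' =>
      SearchInv N nbr (σ'.mem 11) (σ'.mem 12) (σ'.reg 14) (h + 1) ∧
        ∀ q ≤ h, σ'.mem 11 q = σ.mem 11 q := by
  refine Runs.mono (Runs.forReg_const (n := (nbr t).length) (fun j σ' =>
    SearchInv N nbr (σ'.mem 11) (σ'.mem 12) (σ'.reg 14) h ∧ h < σ'.reg 14 ∧
      (∀ q ≤ h, σ'.mem 11 q = σ.mem 11 q) ∧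
      ∀ i < j, σ'.mem 12 ((nbr t).getD i 0) ≠ 0) 23 rfl rfl (by decide) h11 ?_ ?_ le_rfl) le_rfl ?_
  · exact ⟨by simpa using hinv, by simpa using hh, fun _ _ => rfl, by simp⟩
  · intro j hj σ' hf hj' ⟨H, hlt, hord, hv⟩
    have hy : σ'.mem 8 (σ'.reg 10 + σ'.reg 12) = (nbr t).getD j 0 := by
      rw [hf.mem 8 rfl, hf.reg 10 rfl, h10, hj', hst.entry t hN j hj]
    have hmem : (nbr t).getD j 0 ∈ nbr t := by
      rw [List.getD_eq_getElem _ _ hj]; exact List.getElem_mem hj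
    refine Runs.straight rfl (by decide) ?_
    by_cases hv0 : σ'.mem 12 ((nbr t).getD j 0) = 0
    · have hp := H.push (hnbr t hN _ hmem) hv0 hlt (by rwa [hord h le_rfl, h9])
      simp only [Prog.run, Test.Holds, IExp.eval_load, IExp.eval_add, IExp.eval_reg, hy,
        Store.mem_setReg, Store.reg_setReg, if_true, IExp.eval_ofNat, hv0]
      simp only [Store.mem_setReg, Store.mem_setMem, Store.reg_setMem, Store.reg_setReg,
        Nat.reduceEqDiff, if_true, if_false]
      refine ⟨hp, by omega, fun q hq => ?_, fun i hi => ?_⟩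
      · rw [update_of_ne (by omega), hord q hq]
      · rcases Nat.lt_succ_iff_lt_or_eq.1 hi with hi | rfl
        · by_cases he : (nbr t).getD i 0 = (nbr t).getD j 0
          · rw [he, update_self]; exact one_ne_zero
          · rw [update_of_ne he]; exact hv i hi
        · rw [update_self]; exact one_ne_zero
    · simp only [Prog.run, Test.Holds, IExp.eval_load, IExp.eval_add, IExp.eval_reg, hy,
        Store.mem_setReg, Store.reg_setReg, if_true, IExp.eval_ofNat, hv0, if_false,
        Nat.reduceEqDiff]
      refine ⟨H, hlt, hord, fun i hi => ?_⟩
      rcases Nat.lt_succ_iff_lt_or_eq.1 hi with hi | rfl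
      · exact hv i hi
      · exact hv0
  · rintro σ' - ⟨H, hlt, hord, hv⟩
    refine ⟨H.next hlt fun y hy => ?_, hord⟩
    rw [hord h le_rfl, h9] at hy
    obtain ⟨i, hi, rfl⟩ := List.getElem_of_mem hy
    rw [← List.getD_eq_getElem _ 0 hi]
    exact hv i hi

lemma runs_search {σ : Store} {N : ℕ} {nbr : ℕ → List ℕ} (hN : 1 ≤ N) (h2 : σ.reg 2 = N)
    (hst : Stored N nbr (σ.mem 7) (σ.mem 8)) (h12 : ∀ i, σ.mem 12 i = 0)
    (hnbr : ∀ t < N, ∀ y ∈ nbr t, y < N)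
    (hconn : ∀ S : ℕ → Prop, S 0 → (∀ t, S t → ∀ y ∈ nbr t, S y) → ∀ t < N, S t)
    (hsum : ∑ t ∈ range N, (nbr t).length ≤ 2 * N) :
    Runs search σ (200 * N) fun σ' => SearchList N nbr (σ'.mem 11) := by
  -- The cost of an iteration is the degree of a node that becomes known only during the run. The
  -- invariant therefore records the elapsed time as a sum over the processed part of the queue.
  have hloop := Runs.forReg_time (n := N)
    (σ := (Prog.setReg 14 1 ;; .setMem 12 0 1 ;; .setMem 11 0 0).run σ)
    (p := (.setReg 9 (.load 11 (.reg 8)) ;; .setReg 10 (.load 7 (.reg 9)) ;;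
      .setReg 11 (.load 7 (.reg 9 + 1) - .reg 10)) ;; searchNode) (x := 8) (y := 2)
    (fun h t σ' => SearchInv N nbr (σ'.mem 11) (σ'.mem 12) (σ'.reg 14) h ∧
      t = ∑ q ∈ range h, (30 * (nbr (σ'.mem 11 q)).length + 30)) rfl rfl (by decide)
    (by simpa [Prog.run] using h2) ?_ ?_
  · obtain ⟨t, a, s, σ', he, hs, hinv, ht⟩ := hloop
    refine Runs.straight_seq rfl (T₂ := s) ⟨a, s, σ', he, le_rfl, ?_⟩ ?_
    · have hle := hinv.le
      exact ⟨fun q hq => hinv.lt q (by omega),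
        fun q hq q' hq' => hinv.inj q (by omega) q' (by omega),
        fun q hq => hinv.parent q (by omega)⟩
    · have hle := hinv.le
      -- No node is queued twice, so the degrees along the queue sum to at most the degree sum of
      -- the tree.
      have hsum' : ∑ q ∈ range N, (nbr (σ'.mem 11 q)).length ≤ ∑ t ∈ range N, (nbr t).length := by
        have hinj : Set.InjOn (σ'.mem 11) (range N) := fun q hq q' hq' =>
          hinv.inj q (by have := mem_range.1 hq; omega) q' (by have := mem_range.1 hq'; omega)
        rw [← sum_image (g := σ'.mem 11) (f := fun t => (nbr t).length) hinj]
        refine sum_le_sum_of_subset fun t ht => ?_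
        obtain ⟨q, hq, rfl⟩ := mem_image.1 ht
        exact mem_range.2 (hinv.lt q (by have := mem_range.1 hq; omega))
      rw [sum_add_distrib, ← mul_sum] at ht
      simp only [sum_const, card_range, smul_eq_mul] at ht
      have : (Prog.setReg 14 1 ;; .setMem 12 0 1 ;; .setMem 11 0 0).cost = 8 := by decide
      omega
  · simp only [Prog.run, Store.mem_setReg, Store.mem_setMem, Store.reg_setReg, Store.reg_setMem,
      IExp.eval_ofNat, range_zero, sum_empty, and_true, Nat.reduceEqDiff, if_true, if_false]
    refine ⟨by omega, ⟨by omega, by simp⟩, ?_, ?_, ?_, ?_, by omega⟩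
    · intro q hq
      obtain rfl : q = 0 := by omega
      simpa using (by omega : 0 < N)
    · intro q hq q' hq' _; omega
    · intro q hq h; omega
    · intro y
      constructor
      · intro h
        refine ⟨0, by omega, ?_⟩
        by_contra hne
        rw [update_self] at hne
        rw [update_of_ne (Ne.symm hne)] at h
        exact h (h12 y)
      · rintro ⟨q, hq, rfl⟩
        obtain rfl : q = 0 := by omega
        simp
  · intro h hh t σ' hf h8 ⟨hinv, ht⟩
    have hlt := hinv.lt_tail hh hconn
    have hst' : Stored N nbr (σ'.mem 7) (σ'.mem 8) := by
      rw [hf.mem 7 rfl, hf.mem 8 rfl]; simpa [Prog.run] using hst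
    set u := σ'.mem 11 h with hu
    have huN : u < N := hinv.lt h hlt
    refine ⟨18 + (5 + (nbr u).length * 30) , Runs.straight_seq rfl (Runs.mono
      (runs_searchNode (t := u) (h := h) hnbr ?_ huN ?_ ?_ ?_ ?_ ?_) le_rfl ?_) ?_⟩
    · simpa [Prog.run] using hst'
    · simp [Prog.run, hu]
    · simp [Prog.run, hu, h8]
    · simp [Prog.run, h8, ← hu, hst'.start_succ u huN]
    · simpa [Prog.run] using hinv
    · simpa [Prog.run] using hlt
    · rintro σ'' - ⟨hinv', hord⟩
      have hord' : ∀ q ≤ h, σ''.mem 11 q = σ'.mem 11 q := by simpa [Prog.run] using hord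
      refine ⟨by simpa using hinv', ?_⟩
      have hs : ∑ q ∈ range h, (30 * (nbr (σ''.mem 11 q)).length + 30) =
          ∑ q ∈ range h, (30 * (nbr (σ'.mem 11 q)).length + 30) :=
        sum_congr rfl fun q hq => by rw [hord' q (mem_range.1 hq).le]
      rw [sum_range_succ, Store.mem_setReg, hord' h le_rfl, ← hu, ht, hs]
      ring
    · have : (Prog.setReg 9 (.load 11 (.reg 8)) ;; .setReg 10 (.load 7 (.reg 9)) ;;
        .setReg 11 (.load 7 (.reg 9 + 1) - .reg 10)).cost = 13 := by decide
      omega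

end ModCount
namespace ModCount

open Finset Function

/-! ### Parameters -/

/-- Computes the greatest modulus (at least `2`) in register `3`, the width of the tree decomposition in
register `4`, and the number of vertices of the incidence graph in register `6`. -/
def parameters : Prog :=
  (.setReg 3 2 ;; .setReg 6 (.reg 0 + .reg 1)) ;;
  .forReg 8 1 (.ite (.lt (.reg 3) (.load 0 (.reg 8))) (.setReg 3 (.load 0 (.reg 8))) .skip) ;;
  .setReg 4 0 ;;
  .forReg 8 2 (.setReg 9 (.load 9 (.reg 8 + 1) - .load 9 (.reg 8)) ;;
    .ite (.lt (.reg 4) (.reg 9)) (.setReg 4 (.reg 9)) .skip)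

/-- Neither `w` nor `k` is part of the input. The greatest modulus serves as radix, raised to 2 so
that Boolean values and the two states of a clause fit; it never exceeds `w`. -/
lemma runs_parameters {σ : Store} {r N w k : ℕ} {bagl : ℕ → List ℕ} (h1 : σ.reg 1 = r)
    (h2 : σ.reg 2 = N) (hw : 2 ≤ w) (hmod : ∀ j < r, σ.mem 0 j ≤ w)
    (hst : Stored N bagl (σ.mem 9) (σ.mem 10)) (hk : ∀ t < N, (bagl t).length ≤ k) :
    Runs parameters σ (50 * (N + r) + 50) fun σ' => 2 ≤ σ'.reg 3 ∧ σ'.reg 3 ≤ w ∧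
      (∀ j < r, σ.mem 0 j ≤ σ'.reg 3) ∧ σ'.reg 4 ≤ k ∧ (∀ t < N, (bagl t).length ≤ σ'.reg 4) ∧
      σ'.reg 6 = σ.reg 0 + r := by
  refine Runs.straight_seq rfl (T₂ := 50 * (N + r) + 40) ?_ (by
    have : (Prog.setReg 3 2 ;; .setReg 6 (.reg 0 + .reg 1)).cost = 6 := by decide
    omega)
  refine Runs.seq (Runs.forReg_const (n := r) (fun i σ' => 2 ≤ σ'.reg 3 ∧ σ'.reg 3 ≤ w ∧
    ∀ j < i, σ.mem 0 j ≤ σ'.reg 3) 20 rfl rfl (by decide) (by simpa [Prog.run] using h1) ?_ ?_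
    le_rfl) (T₂ := 50 * N + 30) (fun σ₁ f₁ q₁ => ?_) (by omega)
  · simpa [Prog.run] using hw
  · intro i hi σ' hf h8 ⟨hW, hWw, hle⟩
    refine Runs.straight rfl (by decide) ?_
    have h0 : σ'.mem 0 = σ.mem 0 := by rw [hf.mem 0 rfl]; simp [Prog.run]
    by_cases hlt : σ'.reg 3 < σ.mem 0 i
    · simp only [Prog.run, Test.Holds, IExp.eval_reg, IExp.eval_load, h8, h0, hlt, if_true,
        Store.reg_setReg, Nat.reduceEqDiff, if_false]
      refine ⟨by omega, hmod i hi, fun j hj => ?_⟩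
      rcases Nat.lt_succ_iff_lt_or_eq.1 hj with hj | rfl
      · have := hle j hj; omega
      · exact le_rfl
    · simp only [Prog.run, Test.Holds, IExp.eval_reg, IExp.eval_load, h8, h0, hlt,
        Store.reg_setReg, Nat.reduceEqDiff, if_false]
      refine ⟨hW, hWw, fun j hj => ?_⟩
      rcases Nat.lt_succ_iff_lt_or_eq.1 hj with hj | rfl
      · exact hle j hj
      · omega
  · refine Runs.straight_seq rfl (T₂ := 50 * N + 20) ?_ (by
      have : (Prog.setReg 4 0).cost = 2 := by decide
      omega)
    have h3 : ∀ σ', Frame (.forReg 8 2 (.setReg 9 (.load 9 (.reg 8 + 1) - .load 9 (.reg 8)) ;;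
        .ite (.lt (.reg 4) (.reg 9)) (.setReg 4 (.reg 9)) .skip)) ((Prog.setReg 4 0).run σ₁) σ' →
        σ'.reg 3 = σ₁.reg 3 ∧ σ'.reg 6 = σ.reg 0 + r := by
      intro σ' hf
      rw [hf.reg 3 rfl, hf.reg 6 rfl]
      simp [Prog.run, f₁.reg 6 rfl, h1]
    refine Runs.mono (Runs.forReg_const (n := N) (fun i σ' => σ'.reg 4 ≤ k ∧
      ∀ t < i, (bagl t).length ≤ σ'.reg 4) 25 rfl rfl (by decide) ?_ ?_ ?_ le_rfl) (by omega) ?_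
    · simpa [Prog.run, f₁.reg 2 rfl] using h2
    · simp [Prog.run]
    · intro i hi σ' hf h8 ⟨hk', hle⟩
      refine Runs.straight rfl (by decide) ?_
      have hl : σ'.mem 9 (i + 1) - σ'.mem 9 i = (bagl i).length := by
        have : σ'.mem 9 = σ.mem 9 := by rw [hf.mem 9 rfl]; simp [Prog.run, f₁.mem 9 rfl]
        rw [this, hst.start_succ i hi]; omega
      by_cases hlt : σ'.reg 4 < (bagl i).length
      · simp only [Prog.run, Test.Holds, IExp.eval_reg, IExp.eval_load, IExp.eval_sub,
          IExp.eval_add, IExp.eval_ofNat, h8, hl, hlt, if_true,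
          Store.reg_setReg, Nat.reduceEqDiff, if_false]
        refine ⟨hk i hi, fun t ht => ?_⟩
        rcases Nat.lt_succ_iff_lt_or_eq.1 ht with ht | rfl
        · have := hle t ht; omega
        · exact le_rfl
      · simp only [Prog.run, Test.Holds, IExp.eval_reg, IExp.eval_load, IExp.eval_sub,
          IExp.eval_add, IExp.eval_ofNat, h8, hl, hlt, if_true,
          Store.reg_setReg, Nat.reduceEqDiff, if_false]
        refine ⟨hk', fun t ht => ?_⟩
        rcases Nat.lt_succ_iff_lt_or_eq.1 ht with ht | rfl
        · exact hle t ht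
        · omega
    · rintro σ' hf ⟨hk', hle⟩
      rw [(h3 σ' hf).1]
      exact ⟨q₁.1, q₁.2.1, q₁.2.2, hk', hle, (h3 σ' hf).2⟩

/-! ### The numbering of the vertices -/

/-- The vertices of the incidence graph that occur in the first `h` bags and in a part of the next bag
have been numbered `1, …, cnt` in the order of their first occurrence. -/
structure NumberInv (M : ℕ) (bag : ℕ → List ℕ) (num vert hp : ℕ → ℕ) (cnt h : ℕ) : Prop where
  vert_num : ∀ u, num u ≠ 0 → num u ≤ cnt ∧ vert (num u) = u
  num_vert : ∀ i, 1 ≤ i → i ≤ cnt → vert i < M ∧ num (vert i) = i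
  first_le : ∀ i, 1 ≤ i → i ≤ cnt → hp i ≤ h
  mem_first : ∀ i, 1 ≤ i → i ≤ cnt → vert i ∈ bag (hp i)
  first : ∀ i, 1 ≤ i → i ≤ cnt → ∀ h' < hp i, vert i ∉ bag h'
  mono : ∀ i i', 1 ≤ i → i ≤ i' → i' ≤ cnt → hp i ≤ hp i'
  closed : ∀ h' < h, ∀ u ∈ bag h', num u ≠ 0

/-- Numbers start at 1, since 0 marks a vertex without number. The current bag is the first one of a
new vertex because all members of earlier bags are numbered already. -/
lemma NumberInv.push {M cnt h u : ℕ} {bag : ℕ → List ℕ} {num vert hp : ℕ → ℕ}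
    (H : NumberInv M bag num vert hp cnt h) (hu : u ∈ bag h) (huM : u < M) (h0 : num u = 0) :
    NumberInv M bag (update num u (cnt + 1)) (update vert (cnt + 1) u) (update hp (cnt + 1) h)
      (cnt + 1) h := by
  have hne : ∀ i, 1 ≤ i → i ≤ cnt → vert i ≠ u := fun i h1 h2 he => by
    have := (H.num_vert i h1 h2).2
    rw [he] at this; omega
  have hv : ∀ i, i ≤ cnt → update vert (cnt + 1) u i = vert i := fun i hi =>
    update_of_ne (by omega) _ _
  have hh : ∀ i, i ≤ cnt → update hp (cnt + 1) h i = hp i := fun i hi =>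
    update_of_ne (by omega) _ _
  have hcase : ∀ i, i ≤ cnt + 1 → i ≤ cnt ∨ i = cnt + 1 := fun i hi => by omega
  refine ⟨?_, ?_, ?_, ?_, ?_, ?_, ?_⟩
  · intro x hx
    by_cases hxu : x = u
    · subst hxu; simp
    · rw [update_of_ne hxu] at hx ⊢
      obtain ⟨h1, h2⟩ := H.vert_num x hx
      exact ⟨by omega, by rw [hv _ h1, h2]⟩
  · intro i h1 hi
    rcases hcase i hi with hi | rfl
    · rw [hv i hi, update_of_ne (hne i h1 hi)]; exact H.num_vert i h1 hi
    · simpa using huM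
  · intro i h1 hi
    rcases hcase i hi with hi | rfl
    · rw [hh i hi]; exact H.first_le i h1 hi
    · simp
  · intro i h1 hi
    rcases hcase i hi with hi | rfl
    · rw [hh i hi, hv i hi]; exact H.mem_first i h1 hi
    · simpa using hu
  · intro i h1 hi
    rcases hcase i hi with hi | rfl
    · rw [hh i hi, hv i hi]; exact H.first i h1 hi
    · rw [update_self, update_self]
      exact fun h' hh' hmem => H.closed h' hh' u hmem h0
  · intro i i' h1 hi hi'
    rcases hcase i' hi' with hi' | rfl
    · rw [hh i' hi', hh i (hi.trans hi')]; exact H.mono i i' h1 hi hi'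
    · rw [update_self]
      rcases hcase i hi with hi | rfl
      · rw [hh i hi]; exact H.first_le i h1 hi
      · simp
  · intro h' hh' x hx
    by_cases hxu : x = u
    · subst hxu; simp
    · rw [update_of_ne hxu]; exact H.closed h' hh' x hx

/-- The vertices of the incidence graph are numbered in the order of their first occurrence in the bags
`bag 0, …, bag (N - 1)`. -/
structure Numbering (N M : ℕ) (bag : ℕ → List ℕ) (num vert hp : ℕ → ℕ) : Prop where
  num_mem : ∀ u < M, 1 ≤ num u ∧ num u ≤ M ∧ vert (num u) = u
  num_vert : ∀ i, 1 ≤ i → i ≤ M → vert i < M ∧ num (vert i) = i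
  first_lt : ∀ i, 1 ≤ i → i ≤ M → hp i < N
  mem_first : ∀ i, 1 ≤ i → i ≤ M → vert i ∈ bag (hp i)
  first : ∀ i, 1 ≤ i → i ≤ M → ∀ h' < hp i, vert i ∉ bag h'
  mono : ∀ i i', 1 ≤ i → i ≤ i' → i' ≤ M → hp i ≤ hp i'

lemma NumberInv.numbering {N M cnt : ℕ} {bag : ℕ → List ℕ} {num vert hp : ℕ → ℕ}
    (H : NumberInv M bag num vert hp cnt N) (hbag : ∀ h, N ≤ h → bag h = [])
    (hcov : ∀ u < M, ∃ h < N, u ∈ bag h) : Numbering N M bag num vert hp := by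
  have hnum : ∀ u < M, num u ≠ 0 := fun u hu => by
    obtain ⟨h, hh, hm⟩ := hcov u hu
    exact H.closed h hh u hm
  -- Every vertex occurs in some bag, so `num` maps the `M` vertices bijectively to `1, …, cnt`.
  have hcM : cnt = M := by
    have h1 : (range M).image num = Icc 1 cnt := by
      ext i
      simp only [mem_image, mem_range, mem_Icc]
      constructor
      · rintro ⟨u, hu, rfl⟩
        exact ⟨Nat.one_le_iff_ne_zero.2 (hnum u hu), (H.vert_num u (hnum u hu)).1⟩
      · rintro ⟨h1, h2⟩
        exact ⟨vert i, H.num_vert i h1 h2⟩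
    have h2 : Set.InjOn num (range M) := fun u hu u' hu' he => by
      rw [← (H.vert_num u (hnum u (mem_range.1 hu))).2, he,
        (H.vert_num u' (hnum u' (mem_range.1 hu'))).2]
    have h3 := card_image_of_injOn h2
    rw [h1] at h3
    simpa using h3
  subst hcM
  exact ⟨fun u hu => ⟨Nat.one_le_iff_ne_zero.2 (hnum u hu), H.vert_num u (hnum u hu)⟩,
    H.num_vert, fun i h1 hi => by
      by_contra hcon
      have := H.mem_first i h1 hi
      rw [hbag _ (by omega)] at this
      simp at this, H.mem_first, H.first, H.mono⟩

/-- The new vertices of a bag are numbered. -/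
def numberBag : Prog :=
  .forReg 12 11 (.setReg 13 (.load 10 (.reg 10 + .reg 12)) ;;
    .ite (.eq (.load 13 (.reg 13)) 0)
      (.setReg 14 (.reg 14 + 1) ;; .setMem 13 (.reg 13) (.reg 14) ;;
        .setMem 14 (.reg 14) (.reg 13) ;; .setMem 15 (.reg 14) (.reg 8)) .skip)

/-- The numbers of the vertices are stored in the array `13`, the inverse in the array `14`, and the
index of the first bag of each vertex in the search order in the array `15`. -/
def numbering : Prog :=
  .setReg 14 0 ;;
  .forReg 8 2 ((.setReg 9 (.load 11 (.reg 8)) ;; .setReg 10 (.load 9 (.reg 9)) ;;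
    .setReg 11 (.load 9 (.reg 9 + 1) - .reg 10)) ;; numberBag)

lemma runs_numberBag {σ : Store} {N M t h : ℕ} {bagl bag : ℕ → List ℕ}
    (hst : Stored N bagl (σ.mem 9) (σ.mem 10)) (ht : t < N) (hbag : bag h = bagl t)
    (hM : ∀ u ∈ bagl t, u < M) (h8 : σ.reg 8 = h)
    (h10 : σ.reg 10 = σ.mem 9 t) (h11 : σ.reg 11 = (bagl t).length)
    (hinv : NumberInv M bag (σ.mem 13) (σ.mem 14) (σ.mem 15) (σ.reg 14) h) :
    Runs numberBag σ (5 + (bagl t).length * 30) fun σ' =>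
      NumberInv M bag (σ'.mem 13) (σ'.mem 14) (σ'.mem 15) (σ'.reg 14) (h + 1) := by
  refine Runs.mono (Runs.forReg_const (n := (bagl t).length) (fun j σ' =>
    NumberInv M bag (σ'.mem 13) (σ'.mem 14) (σ'.mem 15) (σ'.reg 14) h ∧
      ∀ i < j, σ'.mem 13 ((bagl t).getD i 0) ≠ 0) 23 rfl rfl (by decide) h11 ?_ ?_ le_rfl) le_rfl ?_
  · exact ⟨by simpa using hinv, by simp⟩
  · intro j hj σ' hf hj' ⟨H, hv⟩
    have hy : σ'.mem 10 (σ'.reg 10 + σ'.reg 12) = (bagl t).getD j 0 := by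
      rw [hf.mem 10 rfl, hf.reg 10 rfl, h10, hj', hst.entry t ht j hj]
    have hmem : (bagl t).getD j 0 ∈ bagl t := by
      rw [List.getD_eq_getElem _ _ hj]; exact List.getElem_mem hj
    have h8' : σ'.reg 8 = h := by rw [hf.reg 8 rfl, h8]
    refine Runs.straight rfl (by decide) ?_
    by_cases hv0 : σ'.mem 13 ((bagl t).getD j 0) = 0
    · have hp := H.push (hbag ▸ hmem) (hM _ hmem) hv0
      simp only [Prog.run, Test.Holds, IExp.eval_load, IExp.eval_add, IExp.eval_reg, hy,
        Store.mem_setReg, Store.reg_setReg, if_true, IExp.eval_ofNat, hv0,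
        Store.mem_setMem, Store.reg_setMem, Nat.reduceEqDiff, if_false, h8']
      refine ⟨hp, fun i hi => ?_⟩
      by_cases he : (bagl t).getD i 0 = (bagl t).getD j 0
      · rw [he, update_self]; omega
      · rw [update_of_ne he]
        rcases Nat.lt_succ_iff_lt_or_eq.1 hi with hi | rfl
        · exact hv i hi
        · exact absurd rfl he
    · simp only [Prog.run, Test.Holds, IExp.eval_load, IExp.eval_add, IExp.eval_reg, hy,
        Store.mem_setReg, Store.reg_setReg, if_true, IExp.eval_ofNat, hv0, if_false,
        Nat.reduceEqDiff]
      refine ⟨H, fun i hi => ?_⟩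
      rcases Nat.lt_succ_iff_lt_or_eq.1 hi with hi | rfl
      · exact hv i hi
      · exact hv0
  · rintro σ' - ⟨H, hv⟩
    refine { H with
      first_le := fun i h1 hi => (H.first_le i h1 hi).trans (Nat.le_succ h)
      closed := fun h' hh' => ?_ }
    rcases Nat.lt_succ_iff_lt_or_eq.1 hh' with hh' | rfl
    · exact H.closed h' hh'
    · intro u hu
      rw [hbag] at hu
      obtain ⟨i, hi, rfl⟩ := List.getElem_of_mem hu
      rw [← List.getD_eq_getElem _ 0 hi]
      exact hv i hi

lemma runs_numbering {σ : Store} {N M k : ℕ} {ord : ℕ → ℕ} {bagl : ℕ → List ℕ} (h2 : σ.reg 2 = N)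
    (hst : Stored N bagl (σ.mem 9) (σ.mem 10)) (h13 : ∀ i, σ.mem 13 i = 0) (h11 : σ.mem 11 = ord)
    (hord : ∀ h < N, ord h < N) (hM : ∀ t < N, ∀ u ∈ bagl t, u < M)
    (hcov : ∀ u < M, ∃ h < N, u ∈ bagl (ord h)) (hk : ∀ t < N, (bagl t).length ≤ k) :
    Runs numbering σ (N * (30 * k + 30) + 7) fun σ' =>
      Numbering N M (fun h => if h < N then bagl (ord h) else [])
        (σ'.mem 13) (σ'.mem 14) (σ'.mem 15) := by
  set bag : ℕ → List ℕ := fun h => if h < N then bagl (ord h) else [] with hbag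
  refine Runs.straight_seq rfl (T₂ := N * (30 * k + 30) + 5) ?_ (by
    have : (Prog.setReg 14 0).cost = 2 := by decide
    omega)
  refine Runs.mono (Runs.forReg_const (n := N) (fun h σ' =>
    NumberInv M bag (σ'.mem 13) (σ'.mem 14) (σ'.mem 15) (σ'.reg 14) h) (30 * k + 23) rfl rfl
    (by decide) (by simpa [Prog.run] using h2) ?_ ?_ le_rfl) (by ring_nf; omega) ?_
  · simp only [Prog.run, Store.mem_setReg, Store.reg_setReg, Nat.reduceEqDiff, if_true, if_false,
      IExp.eval_ofNat]
    refine ⟨fun u hu => absurd (h13 u) hu, ?_, ?_, ?_, ?_, ?_, ?_⟩ <;> intros <;> omega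
  · intro h hh σ' hf h8 hinv
    have h11' : σ'.mem 11 = ord := by rw [hf.mem 11 rfl]; simpa [Prog.run] using h11
    have hst' : Stored N bagl (σ'.mem 9) (σ'.mem 10) := by
      rw [hf.mem 9 rfl, hf.mem 10 rfl]; simpa [Prog.run] using hst
    have hu := hord h hh
    refine Runs.straight_seq rfl (Runs.mono (runs_numberBag (t := ord h) (h := h) (N := N) (M := M)
      (bag := bag) ?_ hu ?_ (hM _ hu) ?_ ?_ ?_ ?_) le_rfl ?_) ?_
    · simpa [Prog.run] using hst'
    · simp [hbag, hh]
    · simpa [Prog.run] using h8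
    · simp [Prog.run, h8, h11']
    · simp [Prog.run, h8, h11', hst'.start_succ _ hu]
    · simpa [Prog.run] using hinv
    · rintro σ'' - hinv'
      simpa using hinv'
    · have : (Prog.setReg 9 (.load 11 (.reg 8)) ;; .setReg 10 (.load 9 (.reg 9)) ;;
        .setReg 11 (.load 9 (.reg 9 + 1) - .reg 10)).cost = 13 := by decide
      have := hk _ hu
      omega
  · rintro σ' - hinv
    refine hinv.numbering (fun h hh => ?_) fun u hu => ?_
    · simp [hbag, hh]
    · obtain ⟨h, hh, hm⟩ := hcov u hu
      exact ⟨h, hh, by simpa [hbag, hh] using hm⟩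

end ModCount
namespace ModCount

open Finset Function

/-! ### The lists of earlier neighbours -/

lemma take_succ_eq_append_getD {l : List ℕ} {j : ℕ} (hj : j < l.length) :
    l.take (j + 1) = l.take j ++ [l.getD j 0] := by
  rw [List.take_add_one, List.getElem?_eq_getElem hj, List.getD_eq_getElem _ _ hj]
  rfl

lemma getD_append_singleton (l : List ℕ) (x q : ℕ) :
    (l ++ [x]).getD q 0 = if q = l.length then x else l.getD q 0 := by
  rcases lt_trichotomy q l.length with h | h | h
  · rw [List.getD_append _ _ _ _ h, if_neg h.ne]
  · subst h; simp
  · rw [if_neg h.ne', List.getD_eq_default _ _ (by simp; omega), List.getD_eq_default _ _ h.le]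

/-- The numbers of the vertices in a list that are smaller than `i`. -/
def lowerList (num : ℕ → ℕ) (b : List ℕ) (i : ℕ) : List ℕ := (b.map num).filter (· < i)

lemma lowerList_append_singleton (num : ℕ → ℕ) (b : List ℕ) (x i : ℕ) :
    lowerList num (b ++ [x]) i = if num x < i then lowerList num b i ++ [num x]
      else lowerList num b i := by
  simp only [lowerList, List.map_append, List.filter_append, List.map_cons, List.map_nil,
    List.filter_cons, List.filter_nil, decide_eq_true_eq]
  split_ifs <;> simp

/-- The list of the vertex `i` starts with `i`; the list of the additional vertex `0` is empty. -/
def vertexBag (l : ℕ → List ℕ) (i : ℕ) : List ℕ := if i = 0 then [] else i :: l i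

lemma vertexBag_zero (l : ℕ → List ℕ) : vertexBag l 0 = [] := rfl

lemma vertexBag_of_pos (l : ℕ → List ℕ) {i : ℕ} (hi : 1 ≤ i) : vertexBag l i = i :: l i := by
  rw [vertexBag, if_neg (by omega)]

/-- The list of the vertex in register `15` and its greatest proper element are computed from its first
bag. -/
def lowerBag : Prog :=
  .forReg 12 11 (.setReg 13 (.load 13 (.load 10 (.reg 10 + .reg 12))) ;;
    .ite (.lt (.reg 13) (.reg 15))
      (.setMem 16 (.reg 15 * .reg 4 + .reg 14) (.reg 13) ;; .setReg 14 (.reg 14 + 1) ;;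
        .ite (.lt (.reg 16) (.reg 13)) (.setReg 16 (.reg 13)) .skip) .skip)

/-- The rows of the array `16` are the lists of the vertices; their lengths are stored in the array `17`
and the parents in the array `18`. -/
def lowerBags : Prog :=
  .forReg 8 6 ((.setReg 15 (.reg 8 + 1) ;; .setReg 9 (.load 11 (.load 15 (.reg 15))) ;;
    .setReg 10 (.load 9 (.reg 9)) ;; .setReg 11 (.load 9 (.reg 9 + 1) - .reg 10) ;;
    .setMem 16 (.reg 15 * .reg 4) (.reg 15) ;; .setReg 14 1 ;; .setReg 16 0) ;;
    lowerBag ;; (.setMem 17 (.reg 15) (.reg 14) ;; .setMem 18 (.reg 15) (.reg 16)))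

/-- Cell `i * kk` is reserved for `i` itself, hence the offset `q + 1`. The running maximum starts
at 0, so a vertex with an empty list gets the artificial parent 0. -/
lemma runs_lowerBag {σ : Store} {N t i kk : ℕ} {bagl : ℕ → List ℕ} {num : ℕ → ℕ}
    (hst : Stored N bagl (σ.mem 9) (σ.mem 10)) (ht : t < N) (h13 : σ.mem 13 = num)
    (h4 : σ.reg 4 = kk) (h15 : σ.reg 15 = i) (h14 : σ.reg 14 = 1) (h16 : σ.reg 16 = 0)
    (h10 : σ.reg 10 = σ.mem 9 t) (h11 : σ.reg 11 = (bagl t).length) :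
    Runs lowerBag σ (5 + (bagl t).length * 40) fun σ' =>
      σ'.reg 14 = (lowerList num (bagl t) i).length + 1 ∧
      σ'.reg 16 = (lowerList num (bagl t) i).foldl max 0 ∧
      (∀ q < (lowerList num (bagl t) i).length,
        σ'.mem 16 (i * kk + (q + 1)) = (lowerList num (bagl t) i).getD q 0) ∧
      ∀ a ≤ i * kk, σ'.mem 16 a = σ.mem 16 a := by
  refine Runs.mono (Runs.forReg_const (n := (bagl t).length) (fun j σ' =>
      σ'.reg 14 = (lowerList num ((bagl t).take j) i).length + 1 ∧
      σ'.reg 16 = (lowerList num ((bagl t).take j) i).foldl max 0 ∧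
      (∀ q < (lowerList num ((bagl t).take j) i).length,
        σ'.mem 16 (i * kk + (q + 1)) = (lowerList num ((bagl t).take j) i).getD q 0) ∧
      ∀ a ≤ i * kk, σ'.mem 16 a = σ.mem 16 a) 33 rfl rfl (by decide) h11 ?_ ?_ le_rfl) le_rfl ?_
  · simp [lowerList, h14, h16]
  · intro j hj σ' hf hj' ⟨H14, H16, Hmem, Hold⟩
    have hy : σ'.mem 13 (σ'.mem 10 (σ'.reg 10 + σ'.reg 12)) = num ((bagl t).getD j 0) := by
      rw [hf.mem 10 rfl, hf.mem 13 rfl, hf.reg 10 rfl, h10, hj', hst.entry t ht j hj, h13]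
    have h15' : σ'.reg 15 = i := by rw [hf.reg 15 rfl, h15]
    have h4' : σ'.reg 4 = kk := by rw [hf.reg 4 rfl, h4]
    refine Runs.straight rfl (by decide) ?_
    rw [take_succ_eq_append_getD hj, lowerList_append_singleton]
    set x := num ((bagl t).getD j 0)
    set l := lowerList num ((bagl t).take j) i
    by_cases hlt : x < i
    · have hnew : ∀ q < (l ++ [x]).length,
          update (σ'.mem 16) (i * kk + (l.length + 1)) x (i * kk + (q + 1)) =
            (l ++ [x]).getD q 0 := by
        intro q hq
        rw [getD_append_singleton]
        by_cases hql : q = l.length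
        · subst hql; simp
        · rw [if_neg hql, update_of_ne (by omega)]
          exact Hmem q (by simp at hq; omega)
      have hold : ∀ a ≤ i * kk, update (σ'.mem 16) (i * kk + (l.length + 1)) x a = σ.mem 16 a := by
        intro a ha
        rw [update_of_ne (by omega), Hold a ha]
      by_cases hmax : l.foldl max 0 < x
      · simp only [Prog.run, Test.Holds, IExp.eval_load, IExp.eval_add, IExp.eval_reg, hy, h15', hlt,
          Store.mem_setReg, Store.reg_setReg, if_true, IExp.eval_ofNat, IExp.eval_mul, h4',
          Store.mem_setMem, Store.reg_setMem, Nat.reduceEqDiff, if_false, H16, hmax, H14]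
        exact ⟨by simp, by simp [hmax.le], hnew, hold⟩
      · simp only [Prog.run, Test.Holds, IExp.eval_load, IExp.eval_add, IExp.eval_reg, hy, h15', hlt,
          Store.mem_setReg, Store.reg_setReg, if_true, IExp.eval_ofNat, IExp.eval_mul, h4',
          Store.mem_setMem, Store.reg_setMem, Nat.reduceEqDiff, if_false, H16, hmax, H14]
        exact ⟨by simp, by simp [le_of_not_gt hmax], hnew, hold⟩
    · simp only [Prog.run, Test.Holds, IExp.eval_load, IExp.eval_add, IExp.eval_reg, hy, h15', hlt,
        Store.mem_setReg, Store.reg_setReg, if_true, if_false, Nat.reduceEqDiff]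
      exact ⟨H14, H16, Hmem, Hold⟩
  · rintro σ' - h
    simpa using h

lemma runs_lowerBags {σ : Store} {N M kk : ℕ} {bagl l : ℕ → List ℕ} {num hp ord : ℕ → ℕ}
    (hst : Stored N bagl (σ.mem 9) (σ.mem 10)) (h13 : σ.mem 13 = num) (h11 : σ.mem 11 = ord)
    (h15 : σ.mem 15 = hp) (h17 : ∀ i, σ.mem 17 i = 0)
    (h4 : σ.reg 4 = kk) (h6 : σ.reg 6 = M)
    (hN : ∀ i, 1 ≤ i → i ≤ M → ord (hp i) < N) (hk : ∀ t < N, (bagl t).length ≤ kk)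
    (hl : ∀ i, 1 ≤ i → i ≤ M → l i = lowerList num (bagl (ord (hp i))) i ∧ (l i).length + 1 ≤ kk) :
    Runs lowerBags σ (M * (40 * kk + 60) + 5) fun σ' =>
      (∀ i ≤ M, σ'.mem 17 i = (vertexBag l i).length) ∧
      (∀ i ≤ M, ∀ q < (vertexBag l i).length, σ'.mem 16 (i * kk + q) = (vertexBag l i).getD q 0) ∧
      ∀ i, 1 ≤ i → i ≤ M → σ'.mem 18 i = (l i).foldl max 0 := by
  refine Runs.mono (Runs.forReg_const (n := M) (fun m σ' =>
      (∀ i, m < i → σ'.mem 17 i = 0) ∧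
      (∀ i ≤ m, σ'.mem 17 i = (vertexBag l i).length) ∧
      (∀ i ≤ m, ∀ q < (vertexBag l i).length, σ'.mem 16 (i * kk + q) = (vertexBag l i).getD q 0) ∧
      ∀ i, 1 ≤ i → i ≤ m → σ'.mem 18 i = (l i).foldl max 0) (40 * kk + 53) rfl rfl (by decide)
      h6 ?_ ?_ le_rfl) (by ring_nf; omega) fun σ' _ h => h.2
  · refine ⟨fun i _ => h17 i, ?_, ?_, ?_⟩
    · intro i hi
      obtain rfl : i = 0 := by omega
      rw [Store.mem_setReg, h17, vertexBag_zero]; rfl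
    · intro i hi
      obtain rfl : i = 0 := by omega
      simp [vertexBag_zero]
    · intro i h1 h2; omega
  · intro m hm σ' hf h8 ⟨H0, H17, H16, H18⟩
    have h1i : 1 ≤ m + 1 := by omega
    have hiM : m + 1 ≤ M := hm
    obtain ⟨hli, hlen⟩ := hl (m + 1) h1i hiM
    have ht := hN (m + 1) h1i hiM
    have e11 : σ'.mem 11 = ord := by rw [hf.mem 11 rfl, h11]
    have e15 : σ'.mem 15 = hp := by rw [hf.mem 15 rfl, h15]
    have e13 : σ'.mem 13 = num := by rw [hf.mem 13 rfl, h13]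
    have e4 : σ'.reg 4 = kk := by rw [hf.reg 4 rfl, h4]
    have hst' : Stored N bagl (σ'.mem 9) (σ'.mem 10) := by rw [hf.mem 9 rfl, hf.mem 10 rfl]; exact hst
    have hkt := hk _ ht
    refine Runs.straight_seq rfl (Runs.seq (runs_lowerBag (N := N) (t := ord (hp (m + 1)))
      (i := m + 1) (kk := kk) (num := num) (bagl := bagl) ?_ ht ?_ ?_ ?_ ?_ ?_ ?_ ?_) (T₂ := 10)
      (fun σ₁ f₁ q₁ => Runs.straight rfl (by decide) ?_) le_rfl) ?_
    · simpa [Prog.run] using hst'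
    · simpa [Prog.run] using e13
    · simpa [Prog.run] using e4
    · simp [Prog.run, h8]
    · simp [Prog.run]
    · simp [Prog.run]
    · simp [Prog.run, h8, e11, e15]
    · simp [Prog.run, h8, e11, e15, hst'.start_succ _ ht]
    · obtain ⟨q14, q16, qmem, qold⟩ := q₁
      rw [← hli] at q14 q16 qmem
      have g15 : σ₁.reg 15 = m + 1 := by rw [f₁.reg 15 rfl]; simp [Prog.run, h8]
      have g17 : σ₁.mem 17 = σ'.mem 17 := by rw [f₁.mem 17 rfl]; simp [Prog.run]
      have g18 : σ₁.mem 18 = σ'.mem 18 := by rw [f₁.mem 18 rfl]; simp [Prog.run]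
      have g16 : ∀ a ≤ (m + 1) * kk, σ₁.mem 16 a = update (σ'.mem 16) ((m + 1) * kk) (m + 1) a := by
        intro a ha
        rw [qold a ha]
        simp [Prog.run, h8, e4]
      simp only [Prog.run, IExp.eval_reg, Store.mem_setMem, Store.reg_setMem, g15, q14, q16,
        Store.mem_setReg, Nat.reduceEqDiff, if_true, if_false, g17, g18]
      have hcase : ∀ i, i ≤ m + 1 → i ≤ m ∨ i = m + 1 := fun i hi => by omega
      refine ⟨fun i hi => ?_, fun i hi => ?_, fun i hi q hq => ?_, fun i h1 hi => ?_⟩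
      · rw [update_of_ne (by omega)]; exact H0 i (by omega)
      · rcases hcase i hi with hi | rfl
        · rw [update_of_ne (by omega), H17 i hi]
        · rw [update_self, vertexBag_of_pos l h1i]; rfl
      · rcases hcase i hi with hi | rfl
        -- Rows have length at most `kk`, so the row written now does not overlap the earlier ones.
        · have hqk : q < kk := by
            by_cases h0 : i = 0
            · subst h0; simp [vertexBag_zero] at hq
            · rw [vertexBag_of_pos l (by omega)] at hq
              have := (hl i (by omega) (by omega)).2
              simp at hq; omega
          have hlt : i * kk + q < (m + 1) * kk :=
            calc i * kk + q < i * kk + kk := by omega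
              _ = (i + 1) * kk := by ring
              _ ≤ (m + 1) * kk := Nat.mul_le_mul_right _ (by omega)
          rw [g16 _ hlt.le, update_of_ne hlt.ne, H16 i hi q hq]
        · rw [vertexBag_of_pos l h1i] at hq ⊢
          cases q with
          | zero => rw [add_zero, g16 _ le_rfl]; simp
          | succ q =>
            rw [qmem q (by simpa using hq)]
            simp
      · rcases hcase i hi with hi | rfl
        · rw [update_of_ne (by omega), H18 i h1 hi]
        · rw [update_self]
    · have : (Prog.setReg 15 (.reg 8 + 1) ;; .setReg 9 (.load 11 (.load 15 (.reg 15))) ;;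
        .setReg 10 (.load 9 (.reg 9)) ;; .setReg 11 (.load 9 (.reg 9 + 1) - .reg 10) ;;
        .setMem 16 (.reg 15 * .reg 4) (.reg 15) ;; .setReg 14 1 ;; .setReg 16 0).cost ≤ 30 := by
        decide
      omega

/-! ### Assignments as numbers -/

/-- Register `19` becomes the power of the radix in register `3` with the exponent in register `28`. -/
def power : Prog := .setReg 19 1 ;; .forReg 20 28 (.setReg 19 (.reg 19 * .reg 3))

lemma runs_power {σ : Store} {W b : ℕ} (h3 : σ.reg 3 = W) (h28 : σ.reg 28 = b) :
    Runs power σ (11 * b + 7) fun σ' => σ'.reg 19 = W ^ b := by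
  refine Runs.straight_seq rfl (Runs.forReg_const (n := b) (fun j σ' => σ'.reg 19 = W ^ j) 4 rfl rfl
    (by decide) (by simpa [Prog.run] using h28) (by simp [Prog.run]) ?_ le_rfl) (by
      have : (Prog.setReg 19 1).cost = 2 := by decide
      omega)
  intro j hj σ' hf _ h
  refine Runs.straight rfl (by decide) ?_
  have h3' : σ'.reg 3 = W := by rw [hf.reg 3 rfl]; simpa [Prog.run] using h3
  simp [Prog.run, h, h3', pow_succ]

/-- The quotients and remainders of the numbers below register `5` by the radix are stored in the arrays
`21` and `22`. -/
def divMod : Prog :=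
  (.setReg 9 0 ;; .setReg 10 0) ;;
  .forReg 8 5 (.setMem 21 (.reg 8) (.reg 9) ;; .setMem 22 (.reg 8) (.reg 10) ;;
    .setReg 10 (.reg 10 + 1) ;;
    .ite (.eq (.reg 10) (.reg 3)) (.setReg 10 0 ;; .setReg 9 (.reg 9 + 1)) .skip)

/-- The machine has no division of natural numbers. Counting upwards with a carry tabulates all
quotients and remainders that are needed to extract digits, in `O(K)` steps. -/
lemma runs_divMod {σ : Store} {W K : ℕ} (hW : 1 ≤ W) (h3 : σ.reg 3 = W) (h5 : σ.reg 5 = K) :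
    Runs divMod σ (40 * K + 9) fun σ' =>
      ∀ e < K, σ'.mem 21 e = e / W ∧ σ'.mem 22 e = e % W := by
  refine Runs.straight_seq rfl (Runs.mono (Runs.forReg_const (n := K) (fun j σ' =>
    σ'.reg 9 = j / W ∧ σ'.reg 10 = j % W ∧ ∀ e < j, σ'.mem 21 e = e / W ∧ σ'.mem 22 e = e % W)
    33 rfl rfl (by decide) (by simpa [Prog.run] using h5) ?_ ?_ le_rfl) le_rfl
    fun σ' _ h => h.2.2) (by
      have : (Prog.setReg 9 0 ;; .setReg 10 0).cost = 4 := by decide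
      omega)
  · simp [Prog.run]
  · intro j hj σ' hf h8 ⟨h9, h10, hmem⟩
    have h3' : σ'.reg 3 = W := by rw [hf.reg 3 rfl]; simpa [Prog.run] using h3
    refine Runs.straight rfl (by decide) ?_
    have hnew : ∀ e < j + 1, update (σ'.mem 21) j (j / W) e = e / W ∧
        update (σ'.mem 22) j (j % W) e = e % W := by
      intro e he
      rcases Nat.lt_succ_iff_lt_or_eq.1 he with he | rfl
      · rw [update_of_ne he.ne, update_of_ne he.ne]; exact hmem e he
      · simp
    have hdm := Nat.div_add_mod j W
    have hlt := Nat.mod_lt j hW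
    by_cases he : j % W + 1 = W
    · simp only [Prog.run, Test.Holds, IExp.eval_add, IExp.eval_reg, IExp.eval_ofNat, h8, h9, h10,
        Store.mem_setReg, Store.reg_setReg, Store.mem_setMem, Store.reg_setMem, Nat.reduceEqDiff,
        if_true, if_false, h3', he]
      have hj1 : j + 1 = W * (j / W + 1) := by rw [mul_add]; omega
      refine ⟨?_, ?_, hnew⟩
      · rw [hj1, Nat.mul_div_cancel_left _ hW]
      · rw [hj1, Nat.mul_mod_right]
    · simp only [Prog.run, Test.Holds, IExp.eval_add, IExp.eval_reg, IExp.eval_ofNat, h8, h9, h10,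
        Store.mem_setReg, Store.reg_setReg, Store.mem_setMem, Store.reg_setMem, Nat.reduceEqDiff,
        if_true, if_false, h3', he]
      have hj1 : j + 1 = W * (j / W) + (j % W + 1) := by omega
      have hlt' : j % W + 1 < W := by omega
      refine ⟨?_, ?_, hnew⟩
      · rw [hj1, Nat.mul_add_div hW, Nat.div_eq_of_lt hlt', add_zero]
      · rw [hj1, Nat.mul_add_mod, Nat.mod_eq_of_lt hlt']

/-- The number whose digits are the values of the vertices in the list. -/
def encode (W : ℕ) (τ : ℕ → ℕ) : List ℕ → ℕ
  | [] => 0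
  | x :: l => τ x + W * encode W τ l

lemma encode_append_singleton (W : ℕ) (τ : ℕ → ℕ) (l : List ℕ) (x : ℕ) :
    encode W τ (l ++ [x]) = encode W τ l + W ^ l.length * τ x := by
  induction l with
  | nil => simp [encode]
  | cons y l ih =>
    rw [List.cons_append, encode, ih, encode, List.length_cons]
    ring

lemma encode_congr {W : ℕ} {τ τ' : ℕ → ℕ} {l : List ℕ} (h : ∀ x ∈ l, τ x = τ' x) :
    encode W τ l = encode W τ' l := by
  induction l with
  | nil => rfl
  | cons y l ih =>
    rw [encode, encode, h y (by simp), ih fun x hx => h x (by simp [hx])]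

lemma encode_lt {W : ℕ} {τ : ℕ → ℕ} (hτ : ∀ x, τ x < W) (l : List ℕ) :
    encode W τ l < W ^ l.length := by
  induction l with
  | nil => simp [encode]
  | cons y l ih =>
    rw [encode, List.length_cons, pow_succ]
    have h1 := hτ y
    have h2 : W * (encode W τ l + 1) ≤ W * W ^ l.length := Nat.mul_le_mul_left _ ih
    rw [mul_add, mul_one] at h2
    rw [mul_comm (W ^ l.length)]
    omega

/-- A table cell is computed from one particular assignment with the right code. By injectivity it
is the correct value for every assignment with that code. -/
lemma encode_inj {W : ℕ} {τ τ' : ℕ → ℕ} (hτ : ∀ x, τ x < W) (hτ' : ∀ x, τ' x < W) {l : List ℕ}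
    (h : encode W τ l = encode W τ' l) : ∀ x ∈ l, τ x = τ' x := by
  induction l with
  | nil => simp
  | cons y l ih =>
    have hW : 0 < W := (Nat.zero_le _).trans_lt (hτ y)
    rw [encode, encode] at h
    have h1 := congrArg (· % W) h
    have h2 := congrArg (· / W) h
    simp only [Nat.add_mul_mod_self_left, Nat.mod_eq_of_lt (hτ y), Nat.mod_eq_of_lt (hτ' y)] at h1
    simp only [Nat.add_mul_div_left _ _ hW, Nat.div_eq_of_lt (hτ y), Nat.div_eq_of_lt (hτ' y),
      zero_add] at h2
    intro x hx
    rcases List.mem_cons.1 hx with rfl | hx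
    · exact h1
    · exact ih h2 x hx

/-- The digits of register `21` are assigned to the vertices in the list of length register `28` at
register `27`. -/
def decodeDigits : Prog :=
  .forReg 22 28 (.setMem 20 (.load 16 (.reg 27 + .reg 22)) (.load 22 (.reg 21)) ;;
    .setReg 21 (.load 21 (.reg 21)))

/-- After `j` digits the register holds `e / W ^ j`, which stays below `K` and hence inside the
tables, and the digits written encode `e % W ^ j`. Vertices outside the list keep old values, which
are still below `W`. -/
lemma runs_decodeDigits {σ : Store} {W K e a : ℕ} {l : List ℕ} (hW : 1 ≤ W) (h21 : σ.reg 21 = e)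
    (heK : e < K) (he : e < W ^ l.length)
    (hdm : ∀ e < K, σ.mem 21 e = e / W ∧ σ.mem 22 e = e % W)
    (h27 : σ.reg 27 = a) (h28 : σ.reg 28 = l.length) (hl : l.Nodup)
    (h16 : ∀ q < l.length, σ.mem 16 (a + q) = l.getD q 0) (hcur : ∀ x, σ.mem 20 x < W) :
    Runs decodeDigits σ (5 + l.length * 20) fun σ' =>
      encode W (σ'.mem 20) l = e ∧ ∀ x, σ'.mem 20 x < W := by
  refine Runs.mono (Runs.forReg_const (n := l.length) (fun j σ' =>
    σ'.reg 21 = e / W ^ j ∧ encode W (σ'.mem 20) (l.take j) = e % W ^ j ∧ ∀ x, σ'.mem 20 x < W)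
    13 rfl rfl (by decide) h28 ?_ ?_ le_rfl) le_rfl ?_
  · simpa [h21, encode, Nat.mod_one] using hcur
  · intro j hj σ' hf h22 ⟨hr, henc, hlt⟩
    have hx : σ'.mem 16 (σ'.reg 27 + σ'.reg 22) = l.getD j 0 := by
      rw [hf.mem 16 rfl, hf.reg 27 rfl, h27, h22, h16 j hj]
    have hK : e / W ^ j < K := (Nat.div_le_self _ _).trans_lt heK
    obtain ⟨hd, hm⟩ := hdm _ hK
    rw [← hf.mem 21 rfl] at hd
    rw [← hf.mem 22 rfl] at hm
    refine Runs.straight rfl (by decide) ?_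
    simp only [Prog.run, IExp.eval_load, IExp.eval_add, IExp.eval_reg, hx, hr, Store.mem_setReg,
      Store.mem_setMem, Store.reg_setReg, Store.reg_setMem, hd, hm, Nat.reduceEqDiff, if_true, if_false]
    refine ⟨?_, ?_, fun x => ?_⟩
    · rw [Nat.div_div_eq_div_mul, pow_succ]
    · have hnot : l.getD j 0 ∉ l.take j := by
        rw [List.getD_eq_getElem _ _ hj]
        intro hmem
        obtain ⟨i, hi, he⟩ := List.getElem_of_mem hmem
        rw [List.getElem_take] at he
        have := (hl.getElem_inj_iff).1 he
        simp at hi; omega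
      rw [take_succ_eq_append_getD hj, encode_append_singleton, update_self,
        encode_congr (τ' := σ'.mem 20) fun x hx => update_of_ne (ne_of_mem_of_not_mem hx hnot) _ _, henc,
        List.length_take, min_eq_left hj.le, Nat.mod_pow_succ]
    · by_cases hxe : x = l.getD j 0
      · subst hxe; rw [update_self]; exact Nat.mod_lt _ hW
      · rw [update_of_ne hxe]; exact hlt x
  · rintro σ' - ⟨-, henc, hlt⟩
    rw [List.take_length, Nat.mod_eq_of_lt he] at henc
    exact ⟨henc, hlt⟩

/-- Register `26` becomes the number of the assignment of the list of length register `18` behind register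
`29`. -/
def encodeDigits : Prog :=
  .setReg 26 0 ;; .forReg 22 18 (.setReg 26 (.reg 26 * .reg 3 +
    .load 20 (.load 16 (.reg 29 + (.reg 18 - .reg 22)))))

/-- Horner's rule, from the last entry of the list to the first: the invariant is the code of the
last `j` entries. -/
lemma runs_encodeDigits {σ : Store} {W a : ℕ} {l : List ℕ} (h3 : σ.reg 3 = W) (h29 : σ.reg 29 = a)
    (h18 : σ.reg 18 = l.length) (h16 : ∀ q < l.length, σ.mem 16 (a + (q + 1)) = l.getD q 0) :
    Runs encodeDigits σ (7 + l.length * 20) fun σ' =>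
      σ'.reg 26 = encode W (σ.mem 20) l := by
  refine Runs.straight_seq rfl (Runs.mono (Runs.forReg_const (n := l.length) (fun j σ' =>
    σ'.reg 26 = encode W (σ.mem 20) (l.drop (l.length - j))) 13 rfl rfl (by decide)
    (by simpa [Prog.run] using h18) ?_ ?_ le_rfl) le_rfl ?_) (by
      have : (Prog.setReg 26 0).cost = 2 := by decide
      omega)
  · simp [Prog.run, encode]
  · intro j hj σ' hf h22 hr
    have e18 : σ'.reg 18 = l.length := by rw [hf.reg 18 rfl]; simpa [Prog.run] using h18
    have e29 : σ'.reg 29 = a := by rw [hf.reg 29 rfl]; simpa [Prog.run] using h29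
    have e3 : σ'.reg 3 = W := by rw [hf.reg 3 rfl]; simpa [Prog.run] using h3
    have e20 : σ'.mem 20 = σ.mem 20 := by rw [hf.mem 20 rfl]; simp [Prog.run]
    have e16 : σ'.mem 16 (a + (l.length - j)) = l.getD (l.length - (j + 1)) 0 := by
      rw [hf.mem 16 rfl, ← h16 _ (by omega)]
      simp only [Prog.run, Store.mem_setReg]
      congr 1; omega
    refine Runs.straight rfl (by decide) ?_
    simp only [Prog.run, IExp.eval_load, IExp.eval_add, IExp.eval_sub, IExp.eval_mul, IExp.eval_reg,
      Store.reg_setReg, hr, h22, e18, e29, e3, e20, e16, Nat.reduceEqDiff, if_true, if_false]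
    have hlt : l.length - (j + 1) < l.length := by omega
    rw [List.drop_eq_getElem_cons hlt, encode, List.getD_eq_getElem _ _ hlt,
      show l.length - (j + 1) + 1 = l.length - j by omega]
    ring
  · rintro σ' - h
    simpa using h

end ModCount
namespace ModCount

open Finset Function

/-! ### The incidences -/

/-- The cell that tells whether the value `v` of the vertex `a` makes a literal of the vertex `c` true. -/
def litCell (M W a c v : ℕ) : ℕ := (a * (M + 1) + c) * W + v

/-- Mixed radix digits are unique; `a` is the leading digit and needs no bound. -/
lemma litCell_inj {M W a c v a' c' v' : ℕ} (hc : c ≤ M) (hv : v < W) (hc' : c' ≤ M) (hv' : v' < W)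
    (h : litCell M W a c v = litCell M W a' c' v') : a = a' ∧ c = c' ∧ v = v' := by
  have key : ∀ {B x y x' y' : ℕ}, y < B → y' < B → x * B + y = x' * B + y' → x = x' ∧ y = y' := by
    intro B x y x' y' hy hy' h
    have hB : 0 < B := by omega
    have h1 := congrArg (· / B) h
    have h2 := congrArg (· % B) h
    simp only [mul_comm _ B, Nat.mul_add_div hB, Nat.div_eq_of_lt hy, Nat.div_eq_of_lt hy',
      add_zero] at h1
    simp only [mul_comm _ B, Nat.mul_add_mod, Nat.mod_eq_of_lt hy, Nat.mod_eq_of_lt hy'] at h2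
    exact ⟨h1, h2⟩
  obtain ⟨h1, h2⟩ := key hv hv' h
  obtain ⟨h3, h4⟩ := key (Nat.lt_succ_of_le hc) (Nat.lt_succ_of_le hc') h1
  exact ⟨h3, h4, h2⟩

/-- Marks the literals of a constraint that are listed in the array `a` and are made true by `v`. -/
def markList (a v : ℕ) : Prog :=
  .forReg 12 11 (.setMem 19 ((.load 13 (.load a (.reg 10 + .reg 12)) * (.reg 6 + 1) + .reg 14) *
    .reg 3 + .const v) 1)

/-- Marks the literals of all constraints. -/
def markLists : Prog :=
  .forReg 8 1 ((.setReg 14 (.load 13 (.reg 0 + .reg 8)) ;; .setReg 10 (.load 1 (.reg 8)) ;;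
    .setReg 11 (.load 1 (.reg 8 + 1) - .reg 10)) ;; markList 2 1 ;;
    (.setReg 10 (.load 3 (.reg 8)) ;; .setReg 11 (.load 3 (.reg 8 + 1) - .reg 10)) ;; markList 4 0)

lemma runs_markList {σ : Store} {a v M W c b : ℕ} {l : List ℕ} (h11 : σ.reg 11 = l.length)
    (h10 : σ.reg 10 = b) (ha : a ≠ 19) (h6 : σ.reg 6 = M) (h3 : σ.reg 3 = W) (h14 : σ.reg 14 = c)
    (hl : ∀ q < l.length, σ.mem a (b + q) = l.getD q 0) :
    Runs (markList a v) σ (5 + l.length * 30) fun σ' => ∀ x, σ'.mem 19 x = 1 ↔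
      σ.mem 19 x = 1 ∨ ∃ u ∈ l, x = litCell M W (σ.mem 13 u) c v := by
  refine Runs.mono (Runs.forReg_const (n := l.length) (fun j σ' => ∀ x, σ'.mem 19 x = 1 ↔
      σ.mem 19 x = 1 ∨ ∃ u ∈ l.take j, x = litCell M W (σ.mem 13 u) c v) 23 rfl rfl
      (by decide) h11 ?_ ?_ le_rfl) le_rfl ?_
  · simp
  · intro j hj σ' hf h12 h
    have ea : σ'.mem a = σ.mem a :=
      hf.mem a (by simp [Prog.forReg, Prog.writesMem, Ne.symm ha])
    have e13 : σ'.mem 13 = σ.mem 13 := hf.mem 13 rfl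
    have e10 : σ'.reg 10 = b := by rw [hf.reg 10 rfl, h10]
    have e6 : σ'.reg 6 = M := by rw [hf.reg 6 rfl, h6]
    have e3 : σ'.reg 3 = W := by rw [hf.reg 3 rfl, h3]
    have e14 : σ'.reg 14 = c := by rw [hf.reg 14 rfl, h14]
    refine Runs.straight rfl (Nat.le_of_ble_eq_true rfl) ?_
    intro x
    simp only [Prog.run, IExp.eval, Store.mem_setReg, Store.mem_setMem, if_true, ea, e13, e10, e6, e3,
      e14, h12, hl j hj]
    rw [take_succ_eq_append_getD hj]
    change update _ (litCell M W (σ.mem 13 (l.getD j 0)) c v) 1 x = 1 ↔ _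
    by_cases hx : x = litCell M W (σ.mem 13 (l.getD j 0)) c v
    · subst hx
      rw [update_self]
      simp
    · rw [update_of_ne hx, h x]
      simp only [List.mem_append, List.mem_singleton]
      constructor
      · rintro (h | ⟨u, hu, rfl⟩)
        · exact Or.inl h
        · exact Or.inr ⟨u, Or.inl hu, rfl⟩
      · rintro (h | ⟨u, hu | rfl, rfl⟩)
        · exact Or.inl h
        · exact Or.inr ⟨u, hu, rfl⟩
        · exact absurd rfl hx
  · rintro σ' - h
    simpa using h

/-- The address range of the table is quadratic in `M`, but memory is 0 initially and only the cells
of actual literals are written. So the time is linear in the number of literals and constraints,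
while a lookup takes constant time. -/
lemma runs_markLists {σ : Store} {n r M W S : ℕ} {num : ℕ → ℕ} {pos neg : ℕ → List ℕ}
    (h0 : σ.reg 0 = n) (h1 : σ.reg 1 = r) (h6 : σ.reg 6 = M) (h3 : σ.reg 3 = W)
    (h13 : σ.mem 13 = num) (h19 : ∀ x, σ.mem 19 x = 0)
    (hpos : Stored r pos (σ.mem 1) (σ.mem 2)) (hneg : Stored r neg (σ.mem 3) (σ.mem 4))
    (hS : ∑ j ∈ range r, ((pos j).length + (neg j).length) ≤ S) :
    Runs markLists σ (30 * S + 50 * r + 5) fun σ' => ∀ x, σ'.mem 19 x = 1 ↔ ∃ j < r,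
      (∃ u ∈ pos j, x = litCell M W (num u) (num (n + j)) 1) ∨
      ∃ u ∈ neg j, x = litCell M W (num u) (num (n + j)) 0 := by
  refine Runs.forReg (n := r) (fun i σ' => ∀ x, σ'.mem 19 x = 1 ↔ ∃ j < i,
      (∃ u ∈ pos j, x = litCell M W (num u) (num (n + j)) 1) ∨
      ∃ u ∈ neg j, x = litCell M W (num u) (num (n + j)) 0)
      (fun j => 30 * ((pos j).length + (neg j).length) + 43) rfl rfl (by decide) h1 ?_ ?_ ?_
  · simp [h19]
  · intro j hj σ' hf h8 h
    have e13 : σ'.mem 13 = num := by rw [hf.mem 13 rfl, h13]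
    have e0 : σ'.reg 0 = n := by rw [hf.reg 0 rfl, h0]
    have e6 : σ'.reg 6 = M := by rw [hf.reg 6 rfl, h6]
    have e3 : σ'.reg 3 = W := by rw [hf.reg 3 rfl, h3]
    have epos : Stored r pos (σ'.mem 1) (σ'.mem 2) := by rw [hf.mem 1 rfl, hf.mem 2 rfl]; exact hpos
    have eneg : Stored r neg (σ'.mem 3) (σ'.mem 4) := by rw [hf.mem 3 rfl, hf.mem 4 rfl]; exact hneg
    refine Runs.straight_seq rfl (T₂ := 30 * ((pos j).length + (neg j).length) + 25)
      (Runs.seq (runs_markList (b := σ'.mem 1 j) (l := pos j) (M := M) (W := W) (c := num (n + j))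
        ?_ ?_ (by decide) ?_ ?_ ?_ ?_) (fun σ₁ f₁ q₁ => Runs.straight_seq rfl
        (Runs.mono (runs_markList (b := σ'.mem 3 j) (l := neg j) (M := M) (W := W)
          (c := num (n + j)) ?_ ?_ (by decide) ?_ ?_ ?_ ?_) le_rfl ?_) le_rfl) ?_) ?_
    · simp [Prog.run, h8, epos.start_succ j hj]
    · simp [Prog.run, h8]
    · simpa [Prog.run] using e6
    · simpa [Prog.run] using e3
    · simp [Prog.run, e13, e0, h8]
    · simpa [Prog.run] using epos.entry j hj
    · simp [Prog.run, f₁.reg 8 rfl, f₁.mem 3 rfl, h8, eneg.start_succ j hj]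
    · simp [Prog.run, f₁.reg 8 rfl, f₁.mem 3 rfl, h8]
    · simpa [Prog.run, f₁.reg 6 rfl] using e6
    · simpa [Prog.run, f₁.reg 3 rfl] using e3
    · simp [Prog.run, f₁.reg 14 rfl, e13, e0, h8]
    · simpa [Prog.run, f₁.mem 4 rfl] using eneg.entry j hj
    · rintro σ₂ - q₂ x
      have e13' : ((Prog.setReg 10 (.load 3 (.reg 8)) ;;
          .setReg 11 (.load 3 (.reg 8 + 1) - .reg 10)).run σ₁).mem 13 = num := by
        simpa [Prog.run, f₁.mem 13 rfl] using e13
      have e19' : ((Prog.setReg 10 (.load 3 (.reg 8)) ;;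
          .setReg 11 (.load 3 (.reg 8 + 1) - .reg 10)).run σ₁).mem 19 = σ₁.mem 19 := by
        simp [Prog.run]
      have e13'' : ((Prog.setReg 14 (.load 13 (.reg 0 + .reg 8)) ;; .setReg 10 (.load 1 (.reg 8)) ;;
          .setReg 11 (.load 1 (.reg 8 + 1) - .reg 10)).run σ').mem 13 = num := by
        simpa [Prog.run] using e13
      have e19'' : ((Prog.setReg 14 (.load 13 (.reg 0 + .reg 8)) ;; .setReg 10 (.load 1 (.reg 8)) ;;
          .setReg 11 (.load 1 (.reg 8 + 1) - .reg 10)).run σ').mem 19 = σ'.mem 19 := by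
        simp [Prog.run]
      rw [Store.mem_setReg, q₂ x, e13', e19', q₁ x, e13'', e19'', h x]
      constructor
      · rintro ((⟨i, hi, h⟩ | h) | h)
        · exact ⟨i, by omega, h⟩
        · exact ⟨j, by omega, Or.inl h⟩
        · exact ⟨j, by omega, Or.inr h⟩
      · rintro ⟨i, hi, g⟩
        rcases Nat.lt_succ_iff_lt_or_eq.1 hi with hi | rfl
        · exact Or.inl (Or.inl ⟨i, hi, g⟩)
        · exact g.elim (fun g => Or.inl (Or.inr g)) Or.inr
    · have : (Prog.setReg 10 (.load 3 (.reg 8)) ;;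
          .setReg 11 (.load 3 (.reg 8 + 1) - .reg 10)).cost ≤ 15 := by decide
      omega
    · have : (Prog.setReg 14 (.load 13 (.reg 0 + .reg 8)) ;; .setReg 10 (.load 1 (.reg 8)) ;;
          .setReg 11 (.load 1 (.reg 8 + 1) - .reg 10)).cost ≤ 18 := by decide
      omega
  · simp only [add_assoc]
    rw [sum_add_distrib, ← mul_sum]
    simp only [sum_const, card_range, smul_eq_mul]
    omega

/-! ### The weights -/

/-- The Fourier transform of the acceptance table of the constraint in register `9`, of modulus register
`11`, is written behind register `14`. -/
def fourier : Prog :=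
  (.setReg 10 (.load 5 (.reg 9)) ;; .setNum 4 0 (.ofNat 1)) ;;
  .forReg 12 11
    ((.setNum 3 (.reg 14 + .reg 12) (.load 4 0) ;; .setNum 4 1 (.ofNat 0) ;;
      .setNum 4 2 (.ofNat 1)) ;;
    .forReg 16 11 (.setNum 4 1 (.load 4 1 + .ofNat (.load 6 (.reg 10 + .reg 16)) * .load 4 2) ;;
      .setNum 4 2 (.load 4 2 * (.ofNat 1 / .load 4 0))) ;;
    (.setNum 2 (.reg 14 + .reg 12) (.load 4 1 / .ofNat (.reg 11)) ;;
      .setNum 4 0 (.load 4 0 * .root (.reg 11))))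

/-- Write a row of the arrays of weights and factors. -/
def vertexWeight : Prog :=
  .ite (.lt (.reg 13) (.reg 0))
    (.setNum 2 (.reg 14) (.ofNat 1) ;; .setNum 2 (.reg 14 + 1) (.ofNat 1))
    ((.setReg 9 (.reg 13 - .reg 0) ;; .setReg 11 (.load 0 (.reg 9))) ;;
      .ite (.eq (.reg 11) 0)
        (.setNum 2 (.reg 14) (.ofNat 1) ;; .setNum 2 (.reg 14 + 1) (.ofNat 0 - .ofNat 1) ;;
          .setNum 3 (.reg 14) (.ofNat 1))
        (.ite (.eq (.load 1 (.reg 9 + 1)) (.load 1 (.reg 9)))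
          (.setNum 2 (.reg 14) (.ofNat (.load 6 (.load 5 (.reg 9))))) fourier))

/-- Write the arrays of weights and factors. -/
def vertexWeights : Prog :=
  .forReg 8 6 ((.setReg 15 (.reg 8 + 1) ;; .setReg 13 (.load 14 (.reg 15)) ;;
    .setReg 14 (.reg 15 * .reg 3)) ;; vertexWeight)

/-- The transform is evaluated by its definition in `O(m ^ 2)` steps; no fast transform is required.
In round `i`, cell 0 of the array `4` is `ω ^ i`, cell 1 the partial sum and cell 2 the current
power of `1 / ω ^ i`. -/
lemma runs_fourier {σ : Store} {j m b : ℕ} {A : List ℕ} (h9 : σ.reg 9 = j) (h11 : σ.reg 11 = m)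
    (h14 : σ.reg 14 = b) (hA : ∀ q < m, σ.mem 6 (σ.mem 5 j + q) = A.getD q 0) :
    Runs fourier σ (m * (m * 40 + 60) + 15) fun σ' =>
      (∀ s < m, σ'.num 2 (b + s) = (∑ q ∈ range m, (A.getD q 0 : ℂ) *
        (1 / Complex.exp (2 * Real.pi * Complex.I / m) ^ s) ^ q) / m) ∧
      (∀ s < m, σ'.num 3 (b + s) = Complex.exp (2 * Real.pi * Complex.I / m) ^ s) ∧
      ∀ x, (∀ s < m, x ≠ b + s) → σ'.num 2 x = σ.num 2 x ∧ σ'.num 3 x = σ.num 3 x := by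
  set ω := Complex.exp (2 * Real.pi * Complex.I / m) with hω
  refine Runs.straight_seq rfl (T₂ := m * (m * 40 + 60) + 5) ?_ (by
    have : (Prog.setReg 10 (.load 5 (.reg 9)) ;; .setNum 4 0 (.ofNat 1)).cost ≤ 10 := by decide
    omega)
  refine Runs.mono (Runs.forReg_const (n := m) (fun i σ' => σ'.num 4 0 = ω ^ i ∧
      (∀ s < i, σ'.num 2 (b + s) = (∑ q ∈ range m, (A.getD q 0 : ℂ) * (1 / ω ^ s) ^ q) / m) ∧
      (∀ s < i, σ'.num 3 (b + s) = ω ^ s) ∧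
      ∀ x, (∀ s < m, x ≠ b + s) → σ'.num 2 x = σ.num 2 x ∧ σ'.num 3 x = σ.num 3 x)
      (m * 40 + 53) rfl rfl (by decide) (by simpa [Prog.run] using h11) ?_ ?_ (by ring_nf; omega))
      le_rfl fun σ' _ h => h.2
  · simp [Prog.run]
  · intro i hi σ' hf h12 ⟨H0, H2, H3, Hold⟩
    have e11 : σ'.reg 11 = m := by rw [hf.reg 11 rfl]; simpa [Prog.run] using h11
    have e14 : σ'.reg 14 = b := by rw [hf.reg 14 rfl]; simpa [Prog.run] using h14
    have e10 : σ'.reg 10 = σ.mem 5 j := by rw [hf.reg 10 rfl]; simp [Prog.run, h9]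
    have e6 : σ'.mem 6 = σ.mem 6 := by rw [hf.mem 6 rfl]; simp [Prog.run]
    refine Runs.straight_seq rfl (T₂ := m * 40 + 35) (Runs.seq (T₂ := 25)
      (Runs.forReg_const (n := m) (fun q σ'' => σ''.num 4 0 = ω ^ i ∧
        σ''.num 4 2 = (1 / ω ^ i) ^ q ∧
        σ''.num 4 1 = ∑ q ∈ range q, (A.getD q 0 : ℂ) * (1 / ω ^ i) ^ q) 33 rfl rfl (by decide)
        ?_ ?_ ?_ le_rfl) (fun σ₁ f₁ q₁ => Runs.straight rfl (by decide) ?_) (by omega)) ?_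
    · simpa [Prog.run] using e11
    · simp [Prog.run, H0]
    · intro q hq σ'' hf' h16 ⟨G0, G2, G1⟩
      have d6 : σ''.mem 6 = σ.mem 6 := by rw [hf'.mem 6 rfl]; simpa [Prog.run] using e6
      have d10 : σ''.reg 10 = σ.mem 5 j := by rw [hf'.reg 10 rfl]; simpa [Prog.run] using e10
      refine Runs.straight rfl (by decide) ?_
      simp only [Prog.run, NExp.eval_load, NExp.eval_add, NExp.eval_mul, NExp.eval_div,
        NExp.eval_ofNat, IExp.eval_load, IExp.eval_add, IExp.eval_reg, IExp.eval_ofNat,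
        Store.num_setNum, Store.num_setReg, if_true, d6, d10, h16, hA q hq]
      refine ⟨?_, ?_, ?_⟩
      · simpa using G0
      · simp [G2, G0, pow_succ]
      · simp [G1, G2, sum_range_succ]
    · obtain ⟨G0, G2, G1⟩ := q₁
      have d11 : σ₁.reg 11 = m := by rw [f₁.reg 11 rfl]; simpa [Prog.run] using e11
      have d14 : σ₁.reg 14 = b := by rw [f₁.reg 14 rfl]; simpa [Prog.run] using e14
      have d12 : σ₁.reg 12 = i := by rw [f₁.reg 12 rfl]; simpa [Prog.run] using h12
      have d2 : σ₁.num 2 = σ'.num 2 := by rw [f₁.num 2 rfl]; simp [Prog.run]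
      have d3 : σ₁.num 3 = update (σ'.num 3) (b + i) (ω ^ i) := by
        rw [f₁.num 3 rfl]; simp [Prog.run, e14, h12, H0]
      simp only [Prog.run, NExp.eval_load, NExp.eval_mul, NExp.eval_div, NExp.eval_root,
        NExp.eval_ofNat, IExp.eval_add, IExp.eval_reg, IExp.eval_ofNat,
        Store.num_setNum, Store.num_setReg, if_true, if_false, Nat.reduceEqDiff, d11, d14, d12, d2,
        d3, G1, G0, Store.reg_setNum]
      refine ⟨?_, fun s hs => ?_, fun s hs => ?_, fun x hx => ?_⟩
      · simp [pow_succ, hω]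
      · rcases Nat.lt_succ_iff_lt_or_eq.1 hs with hs | rfl
        · rw [update_of_ne (by omega)]; exact H2 s hs
        · rw [update_self]
      · rcases Nat.lt_succ_iff_lt_or_eq.1 hs with hs | rfl
        · rw [update_of_ne (by omega)]; exact H3 s hs
        · rw [update_self]
      · rw [update_of_ne (hx i hi), update_of_ne (hx i hi)]; exact Hold x hx
    · have : (Prog.setNum 3 (.reg 14 + .reg 12) (.load 4 0) ;; .setNum 4 1 (.ofNat 0) ;;
          .setNum 4 2 (.ofNat 1)).cost ≤ 16 := by decide
      omega

/-- The weight of a value of a vertex, given by its number in the input. -/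
noncomputable def vertexWt {n r : ℕ} (F : Fin r → Constraint n) (u s : ℕ) : ℂ :=
  if u < n then if s < 2 then 1 else 0
  else if h : u - n < r then (F ⟨u - n, h⟩).weight s else 0

/-- The factor for a true literal of a vertex, given by its number in the input. -/
noncomputable def vertexFac {n r : ℕ} (F : Fin r → Constraint n) (u s : ℕ) : ℂ :=
  if u < n then 0 else if h : u - n < r then (F ⟨u - n, h⟩).factor s else 0

/-- Only a modulo constraint with variables needs more than constant time, and `hK` provides `W * W
≤ K` for it. In the other cases only the nonzero entries are written, which is why `hz` asks for a
zero row. -/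
lemma runs_vertexWeight {σ : Store} {n r u b W K : ℕ} (F : Fin r → Constraint n)
    (h0 : σ.reg 0 = n) (h13 : σ.reg 13 = u) (hu : u < n + r) (h14 : σ.reg 14 = b) (hW : 2 ≤ W)
    (hF : ∀ j, (F j).modulus ≤ W) (hmod : ∀ j : Fin r, σ.mem 0 j = (F j).modulus)
    (hpos : ∀ j : Fin r, σ.mem 1 (j + 1) = σ.mem 1 j ↔ (F j).posVars = [])
    (hacc : ∀ j : Fin r, ∀ q < (F j).modulus, σ.mem 6 (σ.mem 5 j + q) = (F j).acceptTable.getD q 0)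
    (hK1 : 1 ≤ K) (hK : ∀ j : Fin r, (F j).posVars ≠ [] → W * W ≤ K)
    (hz : ∀ s < W, σ.num 2 (b + s) = 0 ∧ σ.num 3 (b + s) = 0) :
    Runs vertexWeight σ (180 * K) fun σ' =>
      (∀ s < W, σ'.num 2 (b + s) = vertexWt F u s ∧ σ'.num 3 (b + s) = vertexFac F u s) ∧
      ∀ x, (∀ s < W, x ≠ b + s) → σ'.num 2 x = σ.num 2 x ∧ σ'.num 3 x = σ.num 3 x := by
  have hb0 : ∀ x, (∀ s < W, x ≠ b + s) → x ≠ b := fun x hx => by simpa using hx 0 (by omega)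
  have hb1 : ∀ x, (∀ s < W, x ≠ b + s) → x ≠ b + 1 := fun x hx => hx 1 (by omega)
  have hup : ∀ (f : ℕ → ℂ) (y z : ℂ) (s : ℕ), update (update f b y) (b + 1) z (b + s) =
      if s = 0 then y else if s = 1 then z else f (b + s) := by
    intro f y z s
    rcases s with - | - | s
    · rw [update_of_ne (by omega)]; simp
    · simp
    · rw [update_of_ne (by omega), update_of_ne (by omega)]; simp
  refine Runs.ite (T₁ := 176 * K) (fun hlt => Runs.straight rfl ?_ ?_) (fun hlt => ?_) ?_
  · exact le_trans (by decide : _ ≤ 176) (by omega)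
  · have hun : u < n := by simpa [Test.Holds, h0, h13] using hlt
    simp only [Prog.run, NExp.eval_ofNat, IExp.eval_add, IExp.eval_reg, IExp.eval_ofNat,
        Store.num_setNum, Store.reg_setNum, if_true, if_false, Nat.reduceEqDiff, h14]
    refine ⟨fun s hs => ⟨?_, ?_⟩, fun x hx => ⟨?_, trivial⟩⟩
    · rw [hup, vertexWt, if_pos hun, (hz s hs).1]
      rcases s with - | - | s <;> simp
    · rw [vertexFac, if_pos hun, (hz s hs).2]
    · rw [update_of_ne (hb1 x hx), update_of_ne (hb0 x hx)]
  · have hun : ¬ u < n := by simpa [Test.Holds, h0, h13] using hlt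
    have hj : u - n < r := by omega
    set c := F ⟨u - n, hj⟩ with hc
    set m := c.modulus with hm
    have hwt : ∀ s, vertexWt F u s = c.weight s := fun s => by
      rw [vertexWt, if_neg hun, dif_pos hj]
    have hfac : ∀ s, vertexFac F u s = c.factor s := fun s => by
      rw [vertexFac, if_neg hun, dif_pos hj]
    have e0 : σ.mem 0 (u - n) = m := hmod ⟨u - n, hj⟩
    simp only [hwt, hfac]
    refine Runs.straight_seq rfl (T₂ := 160 * K) (Runs.ite (T₁ := 156 * K)
      (fun hm0 => Runs.straight rfl ?_ ?_) (fun hm0 => Runs.ite (T₁ := 140 * K)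
        (fun he => Runs.straight rfl ?_ ?_) (fun he => ?_) ?_) ?_) ?_
    · exact le_trans (by decide : _ ≤ 156) (by omega)
    · have hm0 : m = 0 := by simpa [Test.Holds, Prog.run, h0, h13, e0] using hm0
      simp only [Prog.run, NExp.eval_ofNat, NExp.eval_sub, IExp.eval_add, IExp.eval_reg,
        IExp.eval_ofNat, Store.num_setNum, Store.reg_setNum, Store.reg_setReg, Store.num_setReg,
        if_true, if_false, Nat.reduceEqDiff, h14]
      refine ⟨fun s hs => ⟨?_, ?_⟩, fun x hx => ⟨?_, ?_⟩⟩
      · rw [hup, Constraint.weight, if_pos hm0, (hz s hs).1]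
        simp
      · rw [Constraint.factor, if_pos hm0]
        by_cases hs0 : s = 0
        · subst hs0; simp
        · rw [update_of_ne (by omega), (hz s hs).2, if_neg hs0]
      · rw [update_of_ne (hb1 x hx), update_of_ne (hb0 x hx)]
      · rw [update_of_ne (hb0 x hx)]
    · exact le_trans (by decide : _ ≤ 140) (by omega)
    · have hm0 : m ≠ 0 := by simpa [Test.Holds, Prog.run, h0, h13, e0] using hm0
      have he : c.posVars = [] := (hpos ⟨u - n, hj⟩).1 (by
        simpa [Test.Holds, Prog.run, h0, h13] using he)
      have hA : σ.mem 6 (σ.mem 5 (u - n)) = c.acceptTable.getD 0 0 := by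
        simpa using hacc ⟨u - n, hj⟩ 0 (Nat.pos_of_ne_zero hm0)
      simp only [Prog.run, NExp.eval_ofNat, IExp.eval_sub, IExp.eval_load, IExp.eval_reg,
        Store.num_setNum, Store.reg_setReg, Store.num_setReg, Store.mem_setReg,
        if_true, if_false, Nat.reduceEqDiff, h14, h0, h13, hA]
      refine ⟨fun s hs => ⟨?_, ?_⟩, fun x hx => ⟨?_, trivial⟩⟩
      · rw [Constraint.weight, if_neg hm0, if_pos he]
        by_cases hs0 : s = 0
        · subst hs0; simp
        · rw [update_of_ne (by omega), (hz s hs).1, if_neg hs0]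
      · rw [Constraint.factor, if_neg hm0, if_pos he, (hz s hs).2]
      · rw [update_of_ne (hb0 x hx)]
    · have hm0 : m ≠ 0 := by simpa [Test.Holds, Prog.run, h0, h13, e0] using hm0
      have he : c.posVars ≠ [] := fun h => he (by
        simpa [Test.Holds, Prog.run, h0, h13] using (hpos ⟨u - n, hj⟩).2 h)
      have hmW : m ≤ W := hF _
      refine Runs.mono (runs_fourier (j := u - n) (m := m) (b := b) (A := c.acceptTable)
        ?_ ?_ ?_ ?_) ?_ ?_
      · simp [Prog.run, h0, h13]
      · simp [Prog.run, h0, h13, e0]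
      · simp [Prog.run, h14]
      · simpa [Prog.run] using hacc ⟨u - n, hj⟩
      · have h1 : m * (m * 40 + 60) ≤ W * (W * 40 + 60) := Nat.mul_le_mul hmW (by omega)
        have h2 : W * (W * 40 + 60) ≤ 100 * (W * W) := by nlinarith
        have := hK _ he
        omega
      · rintro σ' - ⟨H2, H3, Hold⟩
        have hold : ∀ x, (∀ s < m, x ≠ b + s) →
            σ'.num 2 x = σ.num 2 x ∧ σ'.num 3 x = σ.num 3 x := by
          simpa [Prog.run] using Hold
        refine ⟨fun s hs => ?_, fun x hx => hold x fun s hs => hx s (by omega)⟩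
        rw [Constraint.weight, if_neg hm0, if_neg he, Constraint.factor, if_neg hm0, if_neg he]
        by_cases hsm : s < m
        · rw [if_pos hsm, if_pos hsm]; exact ⟨H2 s hsm, H3 s hsm⟩
        · rw [if_neg hsm, if_neg hsm, (hold (b + s) fun s' hs' => by omega).1,
            (hold (b + s) fun s' hs' => by omega).2]
          exact hz s hs
    · have : (Test.eq (.load 1 (.reg 9 + 1)) (.load 1 (.reg 9))).steps ≤ 10 := by decide
      omega
    · have : (Test.eq (.reg 11) 0).steps ≤ 4 := by decide
      omega
    · have : (Prog.setReg 9 (.reg 13 - .reg 0) ;; .setReg 11 (.load 0 (.reg 9))).cost ≤ 10 := by decide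
      omega
  · have : (Test.lt (.reg 13) (.reg 0)).steps ≤ 4 := by decide
    omega

lemma runs_vertexWeights {σ : Store} {n r M W K : ℕ} {vert : ℕ → ℕ} (F : Fin r → Constraint n)
    (h0 : σ.reg 0 = n) (h6 : σ.reg 6 = M) (h3 : σ.reg 3 = W) (h14 : σ.mem 14 = vert)
    (hvert : ∀ i, 1 ≤ i → i ≤ M → vert i < n + r) (hW : 2 ≤ W)
    (hF : ∀ j, (F j).modulus ≤ W) (hmod : ∀ j : Fin r, σ.mem 0 j = (F j).modulus)
    (hpos : ∀ j : Fin r, σ.mem 1 (j + 1) = σ.mem 1 j ↔ (F j).posVars = [])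
    (hacc : ∀ j : Fin r, ∀ q < (F j).modulus, σ.mem 6 (σ.mem 5 j + q) = (F j).acceptTable.getD q 0)
    (hK1 : 1 ≤ K) (hK : ∀ j : Fin r, (F j).posVars ≠ [] → W * W ≤ K)
    (hz : ∀ x, σ.num 2 x = 0 ∧ σ.num 3 x = 0) :
    Runs vertexWeights σ (210 * (M * K) + 5) fun σ' => ∀ i, 1 ≤ i → i ≤ M → ∀ s < W,
      σ'.num 2 (i * W + s) = vertexWt F (vert i) s ∧
      σ'.num 3 (i * W + s) = vertexFac F (vert i) s := by
  -- The second part of the invariant, that the rows not reached yet are still 0, supplies the zero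
  -- row for the next vertex.
  refine Runs.mono (Runs.forReg_const (n := M) (fun m σ' =>
    (∀ i, 1 ≤ i → i ≤ m → ∀ s < W, σ'.num 2 (i * W + s) = vertexWt F (vert i) s ∧
      σ'.num 3 (i * W + s) = vertexFac F (vert i) s) ∧
    ∀ x, (m + 1) * W ≤ x → σ'.num 2 x = 0 ∧ σ'.num 3 x = 0) (180 * K + 20) rfl rfl (by decide)
    h6 ?_ ?_ le_rfl) ?_ fun σ' _ h => h.1
  · exact ⟨fun i h1 h2 => by omega, fun x _ => hz x⟩
  · intro m hm σ' hf h8 ⟨H, Hz⟩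
    have e0 : σ'.reg 0 = n := by rw [hf.reg 0 rfl, h0]
    have e3 : σ'.reg 3 = W := by rw [hf.reg 3 rfl, h3]
    have e14 : σ'.mem 14 = vert := by rw [hf.mem 14 rfl, h14]
    refine Runs.straight_seq rfl (Runs.mono (runs_vertexWeight (u := vert (m + 1))
      (b := (m + 1) * W) (W := W) (K := K) F ?_ ?_ (hvert _ (by omega) hm) ?_ hW hF ?_ ?_ ?_ hK1 hK ?_)
      le_rfl ?_) ?_
    · simpa [Prog.run] using e0
    · simp [Prog.run, h8, e14]
    · simp [Prog.run, h8, e3]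
    · simpa [Prog.run, hf.mem 0 rfl] using hmod
    · simpa [Prog.run, hf.mem 1 rfl] using hpos
    · simpa [Prog.run, hf.mem 5 rfl, hf.mem 6 rfl] using hacc
    · intro s hs
      simpa [Prog.run] using Hz ((m + 1) * W + s) (by omega)
    · rintro σ'' - ⟨G, Gold⟩
      have Gold' : ∀ x, (∀ s < W, x ≠ (m + 1) * W + s) →
          σ''.num 2 x = σ'.num 2 x ∧ σ''.num 3 x = σ'.num 3 x := by
        simpa [Prog.run] using Gold
      refine ⟨fun i h1 hi s hs => ?_, fun x hx => ?_⟩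
      · rcases Nat.le_succ_iff.1 hi with hi | rfl
        · have hlt : i * W + s < (m + 1) * W :=
            calc i * W + s < i * W + W := by omega
              _ = (i + 1) * W := by ring
              _ ≤ (m + 1) * W := Nat.mul_le_mul_right _ (by omega)
          have := Gold' (i * W + s) fun s' _ => by omega
          rw [Store.num_setReg, this.1, this.2]
          exact H i h1 hi s hs
        · exact G s hs
      · have hx' : (m + 1) * W + W ≤ x := by
          calc (m + 1) * W + W = (m + 1 + 1) * W := by ring
            _ ≤ x := hx
        have := Gold' x fun s' _ => by omega
        rw [Store.num_setReg, this.1, this.2]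
        exact Hz x (by omega)
    · have : (Prog.setReg 15 (.reg 8 + 1) ;; .setReg 13 (.load 14 (.reg 15)) ;;
        .setReg 14 (.reg 15 * .reg 3)).cost ≤ 20 := by decide
      omega
  · have : M * (180 * K + 20 + 7) ≤ M * (210 * K) := Nat.mul_le_mul_left _ (by omega)
    have h2 : M * (210 * K) = 210 * (M * K) := by ring
    omega

/-- The tables of the vertices are filled with ones. -/
def clearTables : Prog :=
  .setReg 9 ((.reg 6 + 1) * .reg 5) ;; .forReg 8 9 (.setNum 0 (.reg 8) (.ofNat 1))

lemma runs_clearTables {σ : Store} {M K : ℕ} (h6 : σ.reg 6 = M) (h5 : σ.reg 5 = K) :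
    Runs clearTables σ (12 * ((M + 1) * K) + 12) fun σ' => ∀ x < (M + 1) * K, σ'.num 0 x = 1 := by
  refine Runs.straight_seq rfl (Runs.forReg_const (n := (M + 1) * K)
    (fun j σ' => ∀ x < j, σ'.num 0 x = 1) 5 rfl rfl (by decide)
    (by simp [Prog.run, h6, h5]) (by simp) ?_ le_rfl) (by
      have : (Prog.setReg 9 ((.reg 6 + 1) * .reg 5)).cost ≤ 7 := by decide
      omega)
  intro j hj σ' hf h8 h
  refine Runs.straight rfl (by decide) ?_
  intro x hx
  simp only [Prog.run, NExp.eval_ofNat, IExp.eval_ofNat, IExp.eval_reg, h8, Store.num_setReg,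
    Store.num_setNum, if_true]
  rcases Nat.lt_succ_iff_lt_or_eq.1 hx with hx | rfl
  · rw [update_of_ne hx.ne]; exact h x hx
  · simp

end ModCount
namespace ModCount

open Finset Function

/-! ### The messages -/

/-- The factor of the vertices `a` and `c` under the assignment `τ`. -/
def pairFactor (M W : ℕ) (lit : ℕ → ℕ) (fac : ℕ → ℂ) (a c : ℕ) (τ : ℕ → ℕ) : ℂ :=
  if lit (litCell M W a c (τ a)) = 1 then fac (c * W + τ c) else 1

/-- The weight of `i` and its factors with the vertices in its list. -/
def localFactor (M W : ℕ) (l : ℕ → List ℕ) (lit : ℕ → ℕ) (wt fac : ℕ → ℂ) (i : ℕ) (τ : ℕ → ℕ) : ℂ :=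
  wt (i * W + τ i) * ((l i).map fun u =>
    pairFactor M W lit fac i u τ * pairFactor M W lit fac u i τ).prod

/-- The locality that elimination requires. The local factor takes both orders of each pair, because
the greater vertex may be the variable or the constraint; the order that does not match contributes
1. -/
lemma localFactor_congr {M W : ℕ} {l : ℕ → List ℕ} {lit : ℕ → ℕ} {wt fac : ℕ → ℂ} {i : ℕ}
    {τ τ' : ℕ → ℕ} (h : ∀ x ∈ i :: l i, τ x = τ' x) :
    localFactor M W l lit wt fac i τ = localFactor M W l lit wt fac i τ' := by
  have hi := h i (by simp)
  rw [localFactor, localFactor, hi]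
  congr 2
  refine List.map_congr_left fun u hu => ?_
  have hu' := h u (by simp [hu])
  simp only [pairFactor, hi, hu']

/-- The store contains the lists of the vertices, the table of the literals, the weights and the
factors. -/
structure Tables (M W kk K : ℕ) (l : ℕ → List ℕ) (par lit : ℕ → ℕ) (wt fac : ℕ → ℂ) (σ : Store) :
    Prop where
  radix : σ.reg 3 = W
  width : σ.reg 4 = kk
  size : σ.reg 5 = K
  card : σ.reg 6 = M
  row : ∀ i ≤ M, ∀ q < (vertexBag l i).length, σ.mem 16 (i * kk + q) = (vertexBag l i).getD q 0
  row_length : ∀ i ≤ M, σ.mem 17 i = (vertexBag l i).length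
  parent : ∀ i, 1 ≤ i → i ≤ M → σ.mem 18 i = par i
  literals : σ.mem 19 = lit
  divMod : ∀ e < K, σ.mem 21 e = e / W ∧ σ.mem 22 e = e % W
  weights : σ.num 2 = wt
  factors : σ.num 3 = fac

/-- The program does not write the tables. -/
def Prog.keepsTables (p : Prog) : Bool :=
  !(p.writesReg 3 || p.writesReg 4 || p.writesReg 5 || p.writesReg 6 || p.writesMem 16 ||
    p.writesMem 17 || p.writesMem 18 || p.writesMem 19 || p.writesMem 21 || p.writesMem 22 ||
    p.writesNum 2 || p.writesNum 3)

section

variable {M W kk K : ℕ} {l : ℕ → List ℕ} {par lit : ℕ → ℕ} {wt fac : ℕ → ℂ} {σ σ' : Store}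

lemma Tables.frame {p : Prog} (h : Tables M W kk K l par lit wt fac σ) (f : Frame p σ σ')
    (hp : p.keepsTables = true) : Tables M W kk K l par lit wt fac σ' := by
  simp only [Prog.keepsTables, Bool.not_eq_true', Bool.or_eq_false_iff] at hp
  obtain ⟨⟨⟨⟨⟨⟨⟨⟨⟨⟨⟨h3, h4⟩, h5⟩, h6⟩, h16⟩, h17⟩, h18⟩, h19⟩, h21⟩, h22⟩, h2⟩, h3'⟩ := hp
  constructor
  · rw [f.reg 3 h3]; exact h.radix
  · rw [f.reg 4 h4]; exact h.width
  · rw [f.reg 5 h5]; exact h.size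
  · rw [f.reg 6 h6]; exact h.card
  · rw [f.mem 16 h16]; exact h.row
  · rw [f.mem 17 h17]; exact h.row_length
  · rw [f.mem 18 h18]; exact h.parent
  · rw [f.mem 19 h19]; exact h.literals
  · rw [f.mem 21 h21, f.mem 22 h22]; exact h.divMod
  · rw [f.num 2 h2]; exact h.weights
  · rw [f.num 3 h3']; exact h.factors

lemma Tables.lower (h : Tables M W kk K l par lit wt fac σ) {i : ℕ} (h1 : 1 ≤ i) (hi : i ≤ M) :
    ∀ q < (l i).length, σ.mem 16 (i * kk + (q + 1)) = (l i).getD q 0 := by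
  intro q hq
  rw [h.row i hi (q + 1) (by rw [vertexBag_of_pos l h1]; simpa using hq), vertexBag_of_pos l h1]
  simp

end

/-! ### The elimination program and its cost -/

/-- Multiplies cell `0` of the array `4` by the factors of the vertex in register `15`. -/
def multiplyFactors : Prog :=
  .forReg 22 18 (.setReg 25 (.load 16 (.reg 29 + (.reg 22 + 1))) ;;
    .ite (.eq (.load 19 ((.reg 15 * (.reg 6 + 1) + .reg 25) * .reg 3 + .load 20 (.reg 15))) 1)
      (.setNum 4 0 (.load 4 0 * .load 3 (.reg 25 * .reg 3 + .load 20 (.reg 25)))) .skip ;;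
    .ite (.eq (.load 19 ((.reg 25 * (.reg 6 + 1) + .reg 15) * .reg 3 + .load 20 (.reg 25))) 1)
      (.setNum 4 0 (.load 4 0 * .load 3 (.reg 15 * .reg 3 + .load 20 (.reg 15)))) .skip)

/-- Adds the sum over the values of the vertex in register `15` to cell `1` of the array `4`. -/
def sumValues : Prog :=
  .forReg 24 3 ((.setMem 20 (.reg 15) (.reg 24) ;;
    .setNum 4 0 (.load 0 (.reg 15 * .reg 5 + (.reg 24 + .reg 3 * .reg 23)) *
      .load 2 (.reg 15 * .reg 3 + .reg 24))) ;;
    multiplyFactors ;; .setNum 4 1 (.load 4 1 + .load 4 0))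

/-- The message of the vertex in register `15` is written to the array `1`. -/
def computeMessage : Prog :=
  power ;; .forReg 23 19 (.setReg 21 (.reg 23) ;; decodeDigits ;; .setNum 4 1 (.ofNat 0) ;;
    sumValues ;; .setNum 1 (.reg 23) (.load 4 1))

/-- The table of the parent in register `17` is multiplied by the message. -/
def pushMessage : Prog :=
  power ;; .forReg 23 19 (.setReg 21 (.reg 23) ;; decodeDigits ;; encodeDigits ;;
    .setNum 0 (.reg 17 * .reg 5 + .reg 23) (.load 0 (.reg 17 * .reg 5 + .reg 23) * .load 1 (.reg 26)))

/-- All vertices are eliminated. -/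
def eliminate : Prog :=
  .forReg 8 6 ((.setReg 15 (.reg 6 - .reg 8) ;; .setReg 18 (.load 17 (.reg 15) - 1) ;;
    .setReg 17 (.load 18 (.reg 15)) ;; .setReg 29 (.reg 15 * .reg 4) ;;
    .setReg 27 (.reg 29 + 1) ;; .setReg 28 (.reg 18)) ;; computeMessage ;;
    (.setReg 28 (.load 17 (.reg 17)) ;; .setReg 27 (.reg 17 * .reg 4)) ;; pushMessage)

section

variable {M W kk K i : ℕ} {l : ℕ → List ℕ} {par lit : ℕ → ℕ} {wt fac : ℕ → ℂ} {σ : Store}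

lemma runs_multiplyFactors (h : Tables M W kk K l par lit wt fac σ) (h1 : 1 ≤ i) (hi : i ≤ M)
    (h15 : σ.reg 15 = i) (h18 : σ.reg 18 = (l i).length) (h29 : σ.reg 29 = i * kk) :
    Runs multiplyFactors σ (5 + (l i).length * 80) fun σ' =>
      σ'.num 4 0 = σ.num 4 0 * ((l i).map fun u => pairFactor M W lit fac i u (σ.mem 20) *
        pairFactor M W lit fac u i (σ.mem 20)).prod ∧ σ'.num 4 1 = σ.num 4 1 := by
  refine Runs.mono (Runs.forReg_const (n := (l i).length) (fun j σ' =>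
      σ'.num 4 0 = σ.num 4 0 * (((l i).take j).map fun u => pairFactor M W lit fac i u (σ.mem 20) *
        pairFactor M W lit fac u i (σ.mem 20)).prod ∧ σ'.num 4 1 = σ.num 4 1) 73 rfl rfl
      (by decide) h18 ?_ ?_ le_rfl) le_rfl ?_
  · simp
  · intro j hj σ' hf h22 ⟨H0, H1⟩
    have h' := h.frame hf rfl
    have e15 : σ'.reg 15 = i := by rw [hf.reg 15 rfl, h15]
    have e29 : σ'.reg 29 = i * kk := by rw [hf.reg 29 rfl, h29]
    have e20 : σ'.mem 20 = σ.mem 20 := hf.mem 20 rfl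
    have e16 := h'.lower h1 hi j hj
    refine Runs.straight rfl (by decide) ?_
    rw [take_succ_eq_append_getD hj, List.map_append, List.prod_append, ← mul_assoc, ← H0]
    simp only [Prog.run, Test.Holds, IExp.eval_reg, IExp.eval_load, IExp.eval_add, IExp.eval_mul,
      IExp.eval_ofNat, Store.reg_setReg, Store.mem_setReg, Nat.reduceEqDiff, if_true, if_false, e29,
      h22, e16, e15, h'.card, h'.radix, e20, h'.literals, NExp.eval_load, NExp.eval_mul]
    by_cases ha : lit (litCell M W i ((l i).getD j 0) (σ.mem 20 i)) = 1 <;>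
    by_cases hb : lit (litCell M W ((l i).getD j 0) i (σ.mem 20 ((l i).getD j 0))) = 1 <;>
    · have ha' := ha
      have hb' := hb
      rw [litCell] at ha' hb'
      simp [pairFactor, ha, hb, ha', hb', H1, h'.factors, h'.literals, h'.card, h'.radix, e15, e20,
        mul_assoc, -List.getD_eq_getElem?_getD]
  · rintro σ' - hq
    simpa using hq

/-- The vertex `i` is the lowest digit of its own table, so the cell for its value `s` is `s + W *
e`, where `e` is the code of the other vertices. No encoding is needed inside the sum. -/
lemma runs_sumValues (h : Tables M W kk K l par lit wt fac σ) (h1 : 1 ≤ i) (hi : i ≤ M)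
    (h15 : σ.reg 15 = i) (h18 : σ.reg 18 = (l i).length) (h29 : σ.reg 29 = i * kk)
    (hcur : ∀ x, σ.mem 20 x < W) :
    Runs sumValues σ (5 + W * ((l i).length * 80 + 60)) fun σ' =>
      σ'.num 4 1 = σ.num 4 1 + ∑ s ∈ range W, σ.num 0 (i * K + (s + W * σ.reg 23)) *
        localFactor M W l lit wt fac i (update (σ.mem 20) i s) ∧ ∀ x, σ'.mem 20 x < W := by
  refine Runs.mono (Runs.forReg_const (n := W) (fun j σ' =>
      σ'.num 4 1 = σ.num 4 1 + ∑ s ∈ range j, σ.num 0 (i * K + (s + W * σ.reg 23)) *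
        localFactor M W l lit wt fac i (update (σ.mem 20) i s) ∧ (∀ x, σ'.mem 20 x < W) ∧
        ∀ x, x ≠ i → σ'.mem 20 x = σ.mem 20 x) ((l i).length * 80 + 53) rfl rfl
      (by decide) h.radix ?_ ?_ le_rfl) le_rfl fun σ' _ hq => ⟨hq.1, hq.2.1⟩
  · simpa using hcur
  · intro j hj σ' hf h24 ⟨H, Hcur, Hold⟩
    have h' := h.frame hf rfl
    have e15 : σ'.reg 15 = i := by rw [hf.reg 15 rfl, h15]
    have e0 : σ'.num 0 = σ.num 0 := hf.num 0 rfl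
    have e23 : σ'.reg 23 = σ.reg 23 := hf.reg 23 rfl
    have hcell : ∀ p : Prog, p = (.setMem 20 (.reg 15) (.reg 24) ;;
      .setNum 4 0 (.load 0 (.reg 15 * .reg 5 + (.reg 24 + .reg 3 * .reg 23)) *
      .load 2 (.reg 15 * .reg 3 + .reg 24))) → (p.run σ').mem 20 = update (σ.mem 20) i j ∧
      (p.run σ').num 4 0 = σ.num 0 (i * K + (j + W * σ.reg 23)) * wt (i * W + j) ∧
      (p.run σ').num 4 1 = σ'.num 4 1 := by
      rintro p rfl
      refine ⟨?_, ?_, ?_⟩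
      · simp only [Prog.run, IExp.eval_reg, Store.mem_setNum, Store.mem_setMem, if_true, e15, h24]
        funext x
        by_cases hx : x = i
        · subst hx; simp
        · rw [update_of_ne hx, update_of_ne hx, Hold x hx]
      · simp [Prog.run, e15, h24, e0, e23, h'.size, h'.radix, h'.weights]
      · simp [Prog.run]
    obtain ⟨c20, c0, c1⟩ := hcell _ rfl
    have f0 := Runs.frame_run (p := .setMem 20 (.reg 15) (.reg 24) ;;
      .setNum 4 0 (.load 0 (.reg 15 * .reg 5 + (.reg 24 + .reg 3 * .reg 23)) *
      .load 2 (.reg 15 * .reg 3 + .reg 24))) rfl σ'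
    refine Runs.straight_seq rfl (Runs.seq (runs_multiplyFactors (h'.frame f0 rfl) h1 hi ?_ ?_ ?_)
      (T₂ := 15) (fun σ₁ f₁ q₁ => Runs.straight rfl (by decide) ?_) le_rfl) ?_
    · rw [f0.reg 15 rfl, e15]
    · rw [f0.reg 18 rfl, hf.reg 18 rfl, h18]
    · rw [f0.reg 29 rfl, hf.reg 29 rfl, h29]
    · have e20 : σ₁.mem 20 = update (σ.mem 20) i j := by rw [f₁.mem 20 rfl, c20]
      have hnum : σ₁.num 4 1 + σ₁.num 4 0 = σ.num 4 1 + ∑ s ∈ range (j + 1),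
          σ.num 0 (i * K + (s + W * σ.reg 23)) *
            localFactor M W l lit wt fac i (update (σ.mem 20) i s) := by
        rw [q₁.1, q₁.2, c1, c0, c20, H, sum_range_succ, localFactor, update_self, add_assoc, mul_assoc]
      refine ⟨?_, fun x => ?_, fun x hx => ?_⟩
      · simpa [Prog.run] using hnum
      · by_cases hx : x = i
        · subst hx; simpa [Prog.run, e20] using hj
        · simpa [Prog.run, e20, hx] using hcur x
      · simp [Prog.run, e20, hx]
    · have : (Prog.setMem 20 (.reg 15) (.reg 24) ;;
        .setNum 4 0 (.load 0 (.reg 15 * .reg 5 + (.reg 24 + .reg 3 * .reg 23)) *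
        .load 2 (.reg 15 * .reg 3 + .reg 24))).cost ≤ 30 := by decide
      omega

/-- `G` stands for the product of the messages of the children, which the table of `i` holds by
`hG`. There are `W ^ b` entries with `W` terms of cost `O(kk)` each, and `b + 1 ≤ kk` bounds this by
`O(K * kk)`. -/
lemma runs_computeMessage (h : Tables M W kk K l par lit wt fac σ) (h1 : 1 ≤ i) (hi : i ≤ M)
    (hW : 2 ≤ W) (hK : K = W ^ kk) (hlen : (l i).length + 1 ≤ kk) (hnd : (l i).Nodup)
    (h15 : σ.reg 15 = i) (h18 : σ.reg 18 = (l i).length) (h29 : σ.reg 29 = i * kk)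
    (h27 : σ.reg 27 = i * kk + 1) (h28 : σ.reg 28 = (l i).length)
    (hcur : ∀ x, σ.mem 20 x < W) (hil : i ∉ l i) {G μ : (ℕ → ℕ) → ℂ}
    (hG : ∀ τ : ℕ → ℕ, (∀ x, τ x < W) → σ.num 0 (i * K + encode W τ (i :: l i)) = G τ)
    (hμ : ∀ τ : ℕ → ℕ, μ τ = ∑ s ∈ range W, G (update τ i s) *
      localFactor M W l lit wt fac i (update τ i s))
    (hμc : ∀ τ τ' : ℕ → ℕ, (∀ x ∈ l i, τ x = τ' x) → μ τ = μ τ') :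
    Runs computeMessage σ (250 * (K * kk)) fun σ' =>
      (∀ τ : ℕ → ℕ, (∀ x, τ x < W) → σ'.num 1 (encode W τ (l i)) = μ τ) ∧ ∀ x, σ'.mem 20 x < W := by
  set b := (l i).length with hb
  have hWb : W ^ b * W ≤ K := by
    rw [hK, ← pow_succ]
    exact Nat.pow_le_pow_right (by omega) hlen
  have hWb1 : 1 ≤ W ^ b := Nat.one_le_pow _ _ (by omega)
  have hKkk : kk ≤ K * kk := Nat.le_mul_of_pos_left _ (by nlinarith)
  have hcost : W * (b * 80 + 60) ≤ 80 * (W * kk) := by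
    calc W * (b * 80 + 60) ≤ W * (80 * kk) := Nat.mul_le_mul_left _ (by omega)
      _ = 80 * (W * kk) := by ring
  have hWkk : 2 * kk ≤ W * kk := Nat.mul_le_mul_right _ hW
  have hloop : W ^ b * (150 * (W * kk)) ≤ 150 * (K * kk) := by
    calc W ^ b * (150 * (W * kk)) = 150 * (W ^ b * W * kk) := by ring
      _ ≤ 150 * (K * kk) := by gcongr
  refine Runs.seq (runs_power h.radix h28) (T₂ := 5 + 150 * (K * kk)) (fun σ₀ f₀ h19 => ?_)
    (by omega)
  refine Runs.mono (Runs.forReg_const (n := W ^ b) (fun e σ' =>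
    (∀ τ : ℕ → ℕ, (∀ x, τ x < W) → encode W τ (l i) < e → σ'.num 1 (encode W τ (l i)) = μ τ) ∧
      ∀ x, σ'.mem 20 x < W) (20 * kk + 80 * (W * kk) + 40) rfl rfl (by decide) h19 ?_ ?_ ?_)
      le_rfl fun σ' _ hq => ⟨fun τ hτ => hq.1 τ hτ (encode_lt hτ _), hq.2⟩
  · refine ⟨fun τ _ hlt => by omega, fun x => ?_⟩
    rw [Store.mem_setReg, f₀.mem 20 rfl]; exact hcur x
  · intro e he σ' hf h23 ⟨Hμ, Hcur⟩
    have h' := (h.frame f₀ rfl).frame hf rfl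
    refine Runs.straight_seq rfl (T₂ := 20 * kk + 80 * (W * kk) + 35) ?_ (by
      have : (Prog.setReg 21 (.reg 23)).cost ≤ 2 := by decide
      omega)
    have f₁ := Runs.frame_run (p := .setReg 21 (.reg 23)) rfl σ'
    have h1' := h'.frame f₁ rfl
    refine Runs.seq (runs_decodeDigits (W := W) (K := K) (e := e) (a := i * kk + 1) (l := l i)
      (by omega) ?_ ?_ he h1'.divMod ?_ ?_ hnd ?_ ?_) (T₂ := 80 * (W * kk) + 30)
      (fun σ₂ f₂ q₂ => ?_) (by omega)
    · simp [Prog.run, h23]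
    · nlinarith
    · rw [f₁.reg 27 rfl, hf.reg 27 rfl, f₀.reg 27 rfl, h27]
    · rw [f₁.reg 28 rfl, hf.reg 28 rfl, f₀.reg 28 rfl, h28]
    · intro q hq
      rw [add_assoc, add_comm 1 q]
      exact h1'.lower h1 hi q hq
    · simpa [Prog.run] using Hcur
    obtain ⟨henc, hcur₂⟩ := q₂
    have h2' := h1'.frame f₂ rfl
    refine Runs.straight_seq rfl (T₂ := 80 * (W * kk) + 20) ?_ (by
      have : (Prog.setNum 4 1 (.ofNat 0)).cost ≤ 5 := by decide
      omega)
    have f₃ := Runs.frame_run (p := .setNum 4 1 (.ofNat 0)) rfl σ₂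
    refine Runs.seq (runs_sumValues (h2'.frame f₃ rfl) h1 hi ?_ ?_ ?_ ?_) (T₂ := 10)
      (fun σ₄ f₄ q₄ => Runs.straight rfl (by decide) ?_) (by rw [← hb]; omega)
    · rw [f₃.reg 15 rfl, f₂.reg 15 rfl, f₁.reg 15 rfl, hf.reg 15 rfl, f₀.reg 15 rfl, h15]
    · rw [f₃.reg 18 rfl, f₂.reg 18 rfl, f₁.reg 18 rfl, hf.reg 18 rfl, f₀.reg 18 rfl, h18]
    · rw [f₃.reg 29 rfl, f₂.reg 29 rfl, f₁.reg 29 rfl, hf.reg 29 rfl, f₀.reg 29 rfl, h29]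
    · rw [f₃.mem 20 rfl]; exact hcur₂
    · have e23 : ((Prog.setNum 4 1 (.ofNat 0)).run σ₂).reg 23 = e := by
        rw [f₃.reg 23 rfl, f₂.reg 23 rfl, f₁.reg 23 rfl, h23]
      have e23' : σ₄.reg 23 = e := by rw [f₄.reg 23 rfl, e23]
      have e0 : ((Prog.setNum 4 1 (.ofNat 0)).run σ₂).num 0 = σ.num 0 := by
        rw [f₃.num 0 rfl, f₂.num 0 rfl, f₁.num 0 rfl, hf.num 0 rfl, f₀.num 0 rfl]
      have e20 : ((Prog.setNum 4 1 (.ofNat 0)).run σ₂).mem 20 = σ₂.mem 20 := f₃.mem 20 rfl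
      have e1 : σ₄.num 1 = σ'.num 1 := by
        rw [f₄.num 1 rfl, f₃.num 1 rfl, f₂.num 1 rfl, f₁.num 1 rfl]
      have e4 : ((Prog.setNum 4 1 (.ofNat 0)).run σ₂).num 4 1 = 0 := by simp [Prog.run]
      have hval : σ₄.num 4 1 = μ (σ₂.mem 20) := by
        rw [q₄.1, e4, zero_add, hμ, e23, e0, e20]
        refine sum_congr rfl fun s hs => ?_
        rw [mem_range] at hs
        rw [← hG _ (fun x => ?_), encode, update_self,
          encode_congr (τ := update (σ₂.mem 20) i s) (τ' := σ₂.mem 20)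
            (fun x hx => update_of_ne (ne_of_mem_of_not_mem hx hil) _ _), henc]
        by_cases hx : x = i
        · subst hx; rwa [update_self]
        · rw [update_of_ne hx]; exact hcur₂ x
      refine ⟨fun τ hτ hlt => ?_, fun x => by simpa [Prog.run] using q₄.2 x⟩
      simp only [Prog.run, IExp.eval_reg, NExp.eval_load, IExp.eval_ofNat, Store.num_setReg,
        Store.num_setNum, if_true, e23', e1, hval]
      rcases Nat.lt_succ_iff_lt_or_eq.1 hlt with hlt | heq
      · rw [update_of_ne hlt.ne]; exact Hμ τ hτ hlt
      · rw [heq, update_self]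
        exact hμc _ _ (encode_inj hcur₂ hτ (henc.trans heq.symm))
  · have : W ^ b * (20 * kk + 80 * (W * kk) + 40 + 7) ≤ W ^ b * (150 * (W * kk)) :=
      Nat.mul_le_mul_left _ (by omega)
    omega

/-- By `hsub` an assignment of the list of `p` determines the entry of the message. Each cell of the
table is decoded, re-encoded over `l i` and multiplied once. The block of `p` has `K` cells, so the
other tables are untouched. -/
lemma runs_pushMessage {p : ℕ} (h : Tables M W kk K l par lit wt fac σ) (h1 : 1 ≤ i) (hi : i ≤ M)
    (hW : 2 ≤ W) (hK : K = W ^ kk) (hkk : 1 ≤ kk) (hlen : (l i).length ≤ kk) (hp : p ≤ M)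
    (hlenp : (vertexBag l p).length ≤ kk) (hnd : (vertexBag l p).Nodup)
    (hsub : ∀ x ∈ l i, x ∈ vertexBag l p)
    (h17 : σ.reg 17 = p) (h18 : σ.reg 18 = (l i).length) (h29 : σ.reg 29 = i * kk)
    (h27 : σ.reg 27 = p * kk) (h28 : σ.reg 28 = (vertexBag l p).length)
    (hcur : ∀ x, σ.mem 20 x < W) {μ : (ℕ → ℕ) → ℂ}
    (hmsg : ∀ τ : ℕ → ℕ, (∀ x, τ x < W) → σ.num 1 (encode W τ (l i)) = μ τ)
    (hμc : ∀ τ τ' : ℕ → ℕ, (∀ x ∈ l i, τ x = τ' x) → μ τ = μ τ') :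
    Runs pushMessage σ (150 * (K * kk)) fun σ' =>
      (∀ τ : ℕ → ℕ, (∀ x, τ x < W) → σ'.num 0 (p * K + encode W τ (vertexBag l p)) =
        σ.num 0 (p * K + encode W τ (vertexBag l p)) * μ τ) ∧
      (∀ x, x < p * K ∨ (p + 1) * K ≤ x → σ'.num 0 x = σ.num 0 x) ∧ ∀ x, σ'.mem 20 x < W := by
  set b := (vertexBag l p).length with hb
  have hWb : W ^ b ≤ K := by
    rw [hK]
    exact Nat.pow_le_pow_right (by omega) hlenp
  have hK1 : 1 ≤ K := hK ▸ Nat.one_le_pow _ _ (by omega)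
  have hKkk : kk ≤ K * kk := Nat.le_mul_of_pos_left _ hK1
  have hp1 : (p + 1) * K = p * K + K := by ring
  refine Runs.seq (runs_power h.radix h28) (T₂ := 5 + 120 * (K * kk)) (fun σ₀ f₀ h19 => ?_)
    (by omega)
  refine Runs.mono (Runs.forReg_const (n := W ^ b) (fun e σ' =>
    (∀ τ : ℕ → ℕ, (∀ x, τ x < W) → encode W τ (vertexBag l p) < e →
      σ'.num 0 (p * K + encode W τ (vertexBag l p)) =
        σ.num 0 (p * K + encode W τ (vertexBag l p)) * μ τ) ∧
      (∀ x, x < p * K ∨ p * K + e ≤ x → σ'.num 0 x = σ.num 0 x) ∧ ∀ x, σ'.mem 20 x < W)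
      (40 * kk + 50) rfl rfl (by decide) h19 ?_ ?_ ?_)
      le_rfl fun σ' _ hq => ⟨fun τ hτ => hq.1 τ hτ (encode_lt hτ _),
        fun x hx => hq.2.1 x (by omega), hq.2.2⟩
  · refine ⟨fun τ _ hlt => by omega, fun x _ => ?_, fun x => ?_⟩
    · rw [Store.num_setReg, f₀.num 0 rfl]
    · rw [Store.mem_setReg, f₀.mem 20 rfl]; exact hcur x
  · intro e he σ' hf h23 ⟨Hμ, Hold, Hcur⟩
    have h' := (h.frame f₀ rfl).frame hf rfl
    refine Runs.straight_seq rfl (T₂ := 40 * kk + 45) ?_ (by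
      have : (Prog.setReg 21 (.reg 23)).cost ≤ 2 := by decide
      omega)
    have f₁ := Runs.frame_run (p := .setReg 21 (.reg 23)) rfl σ'
    have h1' := h'.frame f₁ rfl
    refine Runs.seq (runs_decodeDigits (W := W) (K := K) (e := e) (a := p * kk)
      (l := vertexBag l p) (by omega) ?_ (by omega) he h1'.divMod ?_ ?_ hnd ?_ ?_)
      (T₂ := 20 * kk + 35) (fun σ₂ f₂ q₂ => ?_) (by omega)
    · simp [Prog.run, h23]
    · rw [f₁.reg 27 rfl, hf.reg 27 rfl, f₀.reg 27 rfl, h27]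
    · rw [f₁.reg 28 rfl, hf.reg 28 rfl, f₀.reg 28 rfl, h28]
    · exact h1'.row p hp
    · simpa [Prog.run] using Hcur
    obtain ⟨henc, hcur₂⟩ := q₂
    have h2' := h1'.frame f₂ rfl
    refine Runs.seq (runs_encodeDigits (W := W) (a := i * kk) (l := l i) h2'.radix ?_ ?_
      (h2'.lower h1 hi)) (T₂ := 25)
      (fun σ₃ f₃ q₃ => Runs.straight rfl (by decide) ?_) (by omega)
    · rw [f₂.reg 29 rfl, f₁.reg 29 rfl, hf.reg 29 rfl, f₀.reg 29 rfl, h29]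
    · rw [f₂.reg 18 rfl, f₁.reg 18 rfl, hf.reg 18 rfl, f₀.reg 18 rfl, h18]
    have h3' := h2'.frame f₃ rfl
    have e23 : σ₃.reg 23 = e := by rw [f₃.reg 23 rfl, f₂.reg 23 rfl, f₁.reg 23 rfl, h23]
    have e17 : σ₃.reg 17 = p := by
      rw [f₃.reg 17 rfl, f₂.reg 17 rfl, f₁.reg 17 rfl, hf.reg 17 rfl, f₀.reg 17 rfl, h17]
    have e0 : σ₃.num 0 = σ'.num 0 := by rw [f₃.num 0 rfl, f₂.num 0 rfl, f₁.num 0 rfl]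
    have e1 : σ₃.num 1 = σ.num 1 := by
      rw [f₃.num 1 rfl, f₂.num 1 rfl, f₁.num 1 rfl, hf.num 1 rfl, f₀.num 1 rfl]
    have e20 : σ₃.mem 20 = σ₂.mem 20 := f₃.mem 20 rfl
    simp only [Prog.run, IExp.eval_reg, IExp.eval_add, IExp.eval_mul, NExp.eval_load, NExp.eval_mul,
      Store.num_setReg, Store.num_setNum, Store.mem_setReg, Store.mem_setNum, if_true, e23, e17,
      e0, e1, e20, h3'.size, q₃, hmsg _ hcur₂, Hold (p * K + e) (by omega)]
    refine ⟨fun τ hτ hlt => ?_, fun x hx => ?_, hcur₂⟩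
    · rcases Nat.lt_succ_iff_lt_or_eq.1 hlt with hlt | heq
      · rw [update_of_ne (by omega)]; exact Hμ τ hτ hlt
      · rw [heq, update_self, hμc _ τ fun x hx =>
          encode_inj hcur₂ hτ (henc.trans heq.symm) x (hsub x hx)]
    · rw [update_of_ne (by omega)]; exact Hold x (by omega)
  · have : W ^ b * (40 * kk + 50 + 7) ≤ K * (120 * kk) := Nat.mul_le_mul hWb (by omega)
    have h2 : K * (120 * kk) = 120 * (K * kk) := by ring
    omega

/-- After `m` rounds the table of each remaining vertex, including the artificial vertex 0, is the
product of the messages of its eliminated children; initially this is the empty product. Children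
have greater numbers, so the table of a vertex is complete when its turn comes. -/
lemma runs_eliminate (h : Tables M W kk K l par lit wt fac σ) (hW : 2 ≤ W) (hK : K = W ^ kk)
    (hkk : 1 ≤ kk) (he : IsElimination M l par)
    (hlen : ∀ i, 1 ≤ i → i ≤ M → (l i).length + 1 ≤ kk)
    (hnd : ∀ i, 1 ≤ i → i ≤ M → (l i).Nodup) (hcur : ∀ x, σ.mem 20 x < W)
    (hone : ∀ x < (M + 1) * K, σ.num 0 x = 1) :
    Runs eliminate σ (450 * (M * (K * kk)) + 5) fun σ' =>
      σ'.num 0 0 = ∏ c ∈ Ioc 0 M, if par c = 0 then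
        message M W par (localFactor M W l lit wt fac) c (fun _ => 0) else 1 := by
  have hK1 : 1 ≤ K := hK ▸ Nat.one_le_pow _ _ (by omega)
  have hKkk : 1 ≤ K * kk := Nat.mul_pos hK1 hkk
  have hbag : ∀ p ≤ M, (vertexBag l p).length ≤ kk ∧ (vertexBag l p).Nodup := by
    intro p hp
    by_cases h0 : p = 0
    · subst h0; simp [vertexBag_zero]
    · rw [vertexBag_of_pos l (by omega)]
      refine ⟨hlen p (by omega) hp, List.nodup_cons.2 ⟨fun hx => ?_, hnd p (by omega) hp⟩⟩
      have := he.lt p (by omega) hp p hx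
      omega
  have hL : ∀ i, 1 ≤ i → i ≤ M → ∀ τ τ' : ℕ → ℕ, (∀ x ∈ i :: l i, τ x = τ' x) →
      localFactor M W l lit wt fac i τ = localFactor M W l lit wt fac i τ' :=
    fun i _ _ τ τ' hτ => localFactor_congr hτ
  refine Runs.mono (Runs.forReg_const (n := M) (fun m σ' =>
    (∀ p, p + m ≤ M → ∀ τ : ℕ → ℕ, (∀ x, τ x < W) →
      σ'.num 0 (p * K + encode W τ (vertexBag l p)) = ∏ c ∈ Ioc (M - m) M, if par c = p then
        message M W par (localFactor M W l lit wt fac) c τ else 1) ∧ ∀ x, σ'.mem 20 x < W)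
      (400 * (K * kk) + 40) rfl rfl (by decide) h.card ?_ ?_ le_rfl) ?_ ?_
  · refine ⟨fun p hp τ hτ => ?_, by simpa using hcur⟩
    rw [Store.num_setReg, hone]
    · simp
    · have h1 := encode_lt hτ (vertexBag l p)
      have h2 : W ^ (vertexBag l p).length ≤ K := by
        rw [hK]; exact Nat.pow_le_pow_right (by omega) (hbag p (by omega)).1
      have h3 : (p + 1) * K ≤ (M + 1) * K := Nat.mul_le_mul_right _ (by omega)
      have h4 : (p + 1) * K = p * K + K := by ring
      omega
  · intro m hm σ' hf h8 ⟨HT, Hcur⟩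
    obtain ⟨i, hi⟩ : ∃ i, i = M - m := ⟨_, rfl⟩
    have h1i : 1 ≤ i := by omega
    have hiM : i ≤ M := by omega
    have h' := h.frame hf rfl
    have hpar := he.par_lt i h1i hiM
    have hsub : ∀ x ∈ l i, x ∈ vertexBag l (par i) := by
      intro x hx
      by_cases h0 : par i = 0
      · rw [he.nil i h1i hiM h0] at hx; simp at hx
      · rw [vertexBag_of_pos l (by omega)]
        simpa using he.subset i h1i hiM h0 x hx
    have hil : i ∉ l i := fun hx => by have := he.lt i h1i hiM i hx; omega
    set μ := message M W par (localFactor M W l lit wt fac) i with hμd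
    have hμc : ∀ τ τ' : ℕ → ℕ, (∀ x ∈ l i, τ x = τ' x) → μ τ = μ τ' :=
      fun τ τ' hτ => message_congr he hL h1i hiM hτ
    have f₀ := Runs.frame_run (p := .setReg 15 (.reg 6 - .reg 8) ;;
      .setReg 18 (.load 17 (.reg 15) - 1) ;; .setReg 17 (.load 18 (.reg 15)) ;;
      .setReg 29 (.reg 15 * .reg 4) ;; .setReg 27 (.reg 29 + 1) ;; .setReg 28 (.reg 18)) rfl σ'
    have h0' := h'.frame f₀ rfl
    have e17 : σ'.mem 17 i = (l i).length + 1 := by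
      rw [h'.row_length i hiM, vertexBag_of_pos l h1i]; rfl
    have e18 : σ'.mem 18 i = par i := h'.parent i h1i hiM
    refine Runs.straight_seq rfl (T₂ := 400 * (K * kk) + 12) (Runs.seq (runs_computeMessage h0' h1i hiM
      hW hK (hlen i h1i hiM) (hnd i h1i hiM) ?_ ?_ ?_ ?_ ?_ ?_ hil (G := fun τ => ∏ c ∈ Ioc i M,
        if par c = i then message M W par (localFactor M W l lit wt fac) c τ else 1) (μ := μ)
        ?_ (fun τ => message_eq _ _ _ _ _ _) hμc)
      (T₂ := 150 * (K * kk) + 12)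
      (fun σ₁ f₁ q₁ => Runs.straight_seq (T₂ := 150 * (K * kk)) rfl ?_ ?_) (by omega)) ?_
    · simp [Prog.run, h'.card, h8, ← hi]
    · simp [Prog.run, h'.card, h8, ← hi, e17]
    · simp [Prog.run, h'.card, h8, ← hi, h'.width]
    · simp [Prog.run, h'.card, h8, ← hi, h'.width]
    · simp [Prog.run, h'.card, h8, ← hi, e17]
    · rw [f₀.mem 20 rfl]; exact Hcur
    · intro τ hτ
      have := HT i (by omega) τ hτ
      rw [← hi, vertexBag_of_pos l h1i] at this
      rw [f₀.num 0 rfl]; exact this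
    · have f₂ := Runs.frame_run (p := .setReg 28 (.load 17 (.reg 17)) ;;
        .setReg 27 (.reg 17 * .reg 4)) rfl σ₁
      have h1' := h0'.frame f₁ rfl
      have g17 : σ₁.reg 17 = par i := by
        rw [f₁.reg 17 rfl]; simp [Prog.run, h'.card, h8, ← hi, e18]
      refine Runs.mono (runs_pushMessage (i := i) (p := par i) (h1'.frame f₂ rfl) h1i hiM hW hK hkk
        (by have := hlen i h1i hiM; omega) (by omega) (hbag _ (by omega)).1 (hbag _ (by omega)).2 hsub
        ?_ ?_ ?_ ?_ ?_ ?_ (μ := μ) ?_ hμc) le_rfl ?_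
      · rw [f₂.reg 17 rfl, g17]
      · rw [f₂.reg 18 rfl, f₁.reg 18 rfl]; simp [Prog.run, h'.card, h8, ← hi, e17]
      · rw [f₂.reg 29 rfl, f₁.reg 29 rfl]; simp [Prog.run, h'.card, h8, ← hi, h'.width]
      · simp [Prog.run, g17, h1'.width]
      · simp [Prog.run, g17, h1'.row_length (par i) (by omega)]
      · rw [f₂.mem 20 rfl]; exact q₁.2
      · rw [f₂.num 1 rfl]; exact q₁.1
      · rintro σ₃ - ⟨Q1, Q2, Q3⟩
        have e0 : ((Prog.setReg 28 (.load 17 (.reg 17)) ;;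
            .setReg 27 (.reg 17 * .reg 4)).run σ₁).num 0 = σ'.num 0 := by
          rw [f₂.num 0 rfl, f₁.num 0 rfl, f₀.num 0 rfl]
        rw [e0] at Q1 Q2
        refine ⟨fun p hp τ hτ => ?_, by simpa using Q3⟩
        have hI : Ioc (M - (m + 1)) M = insert i (Ioc (M - m) M) := by ext x; simp; omega
        rw [Store.num_setReg, hI, prod_insert (by simp; omega)]
        -- The new message enters the table of the parent; the tables of all other vertices lie in
        -- disjoint blocks.
        by_cases hpi : par i = p
        · rw [if_pos hpi, ← hpi, Q1 τ hτ, HT (par i) (by omega) τ hτ, mul_comm]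
        · rw [if_neg hpi, one_mul, ← HT p (by omega) τ hτ]
          apply Q2
          have h1 := encode_lt hτ (vertexBag l p)
          have h2 : W ^ (vertexBag l p).length ≤ K := by
            rw [hK]; exact Nat.pow_le_pow_right (by omega) (hbag p (by omega)).1
          have h4 : (p + 1) * K = p * K + K := by ring
          rcases lt_or_gt_of_ne hpi with hlt | hlt
          · right
            have h3 : (par i + 1) * K ≤ p * K := Nat.mul_le_mul_right _ (by omega)
            omega
          · left
            have h3 : (p + 1) * K ≤ par i * K := Nat.mul_le_mul_right _ (by omega)
            omega
    · have : (Prog.setReg 28 (.load 17 (.reg 17)) ;; .setReg 27 (.reg 17 * .reg 4)).cost ≤ 12 := by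
        decide
      omega
    · have : (Prog.setReg 15 (.reg 6 - .reg 8) ;; .setReg 18 (.load 17 (.reg 15) - 1) ;;
        .setReg 17 (.load 18 (.reg 15)) ;; .setReg 29 (.reg 15 * .reg 4) ;;
        .setReg 27 (.reg 29 + 1) ;; .setReg 28 (.reg 18)).cost ≤ 28 := by decide
      omega
  · have h1 : M * (400 * (K * kk) + 40 + 7) ≤ M * (450 * (K * kk)) := Nat.mul_le_mul_left _ (by omega)
    have h2 : M * (450 * (K * kk)) = 450 * (M * (K * kk)) := by ring
    omega
  · rintro σ' - ⟨HT, -⟩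
    -- The artificial vertex 0 has the empty list, so its table is the single cell 0.
    have := HT 0 (by omega) (fun _ => 0) (fun _ => by omega)
    simpa [vertexBag_zero, encode] using this

end

end ModCount
namespace ModCount

open Finset Function

/-! ### The elimination order of a tree decomposition -/

/-- An injective list of `N` nodes contains all of them; the position in the list is the numbering,
and the recorded earlier neighbour is the parent. -/
lemma SearchList.exists_isSearchOrder {N : ℕ} {T : SimpleGraph (Fin N)} {ord : ℕ → ℕ}
    (h : SearchList N (natFamily (neighbourList T)) ord) :
    ∃ pos pa, IsSearchOrder T pos pa ∧ ∀ t : Fin N, pos t < N ∧ ord (pos t) = t := by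
  have hsurj : ∀ t : Fin N, ∃ q < N, ord q = t := by
    have hinj : Injective fun q : Fin N => (⟨ord q, h.lt q q.2⟩ : Fin N) := fun q q' he =>
      Fin.ext (h.inj q q.2 q' q'.2 (congrArg Fin.val he))
    intro t
    obtain ⟨q, hq⟩ := (Finite.injective_iff_surjective.1 hinj) t
    exact ⟨q, q.2, congrArg Fin.val hq⟩
  choose pos hpos hord using hsurj
  have hpa : ∀ t : Fin N, ∃ s : Fin N, pos t ≠ 0 → pos s < pos t ∧ T.Adj s t := by
    intro t
    by_cases h0 : pos t = 0
    · exact ⟨t, fun h => absurd h0 h⟩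
    · obtain ⟨q, hq, hmem⟩ := h.parent (pos t) (hpos t) h0
      have hqN : q < N := hq.trans (hpos t)
      refine ⟨⟨ord q, h.lt q hqN⟩, fun _ => ⟨?_, ?_⟩⟩
      · have : pos ⟨ord q, h.lt q hqN⟩ = q := h.inj _ (hpos _) _ hqN (hord _)
        rwa [this]
      · rw [hord] at hmem
        have := natFamily_val (neighbourList T) ⟨ord q, h.lt q hqN⟩
        dsimp only at this
        rw [this] at hmem
        exact mem_neighbourList.1 hmem
  choose pa hpa using hpa
  refine ⟨pos, pa, ⟨fun t t' he => ?_, fun t ht => (hpa t ht).1, fun t ht => (hpa t ht).2⟩,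
    fun t => ⟨hpos t, hord t⟩⟩
  ext
  rw [← hord t, he, hord t']

lemma le_foldl_max {l : List ℕ} {a x : ℕ} (hx : x = a ∨ x ∈ l) : x ≤ l.foldl max a := by
  induction l generalizing a x with
  | nil => simp_all
  | cons y l ih =>
    rw [List.foldl_cons]
    rcases hx with rfl | hx
    · exact (le_max_left _ _).trans (ih (Or.inl rfl))
    · rcases List.mem_cons.1 hx with rfl | hx
      · exact (le_max_right _ _).trans (ih (Or.inl rfl))
      · exact ih (Or.inr hx)

lemma foldl_max_mem (l : List ℕ) (a : ℕ) : l.foldl max a = a ∨ l.foldl max a ∈ l := by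
  induction l generalizing a with
  | nil => exact Or.inl rfl
  | cons y l ih =>
    rw [List.foldl_cons]
    rcases ih (max a y) with h | h
    · rw [h]
      rcases max_choice a y with h' | h' <;> simp [h']
    · exact Or.inr (List.mem_cons_of_mem _ h)

/-- The bags of a tree decomposition in the order `ord`, as lists. -/
def orderedBag {n r N : ℕ} {F : Fin r → Constraint n} (D : TreeDecomposition (incidenceGraph F) N)
    (ord : ℕ → ℕ) (h : ℕ) : List ℕ :=
  if h < N then natFamily (fun t => vertexList (D.bag t)) (ord h) else []

section

variable {n r N : ℕ} {F : Fin r → Constraint n} {D : TreeDecomposition (incidenceGraph F) N}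
  {ord num vert hp : ℕ → ℕ}

lemma mem_orderedBag (ho : ∀ h < N, ord h < N) {h u : ℕ} :
    u ∈ orderedBag D ord h ↔
      ∃ (hh : h < N), ∃ v ∈ D.bag ⟨ord h, ho h hh⟩, vertexCode v = u := by
  by_cases hh : h < N
  · have := natFamily_val (fun t => vertexList (D.bag t)) ⟨ord h, ho h hh⟩
    dsimp only at this
    rw [orderedBag, if_pos hh, this, mem_vertexList]
    simp [hh]
  · simp [orderedBag, hh]

lemma length_orderedBag_le (ho : ∀ h < N, ord h < N) (h : ℕ) :
    (orderedBag D ord h).length ≤ D.width := by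
  by_cases hh : h < N
  · have := natFamily_val (fun t => vertexList (D.bag t)) ⟨ord h, ho h hh⟩
    dsimp only at this
    rw [orderedBag, if_pos hh, this, length_vertexList]
    exact le_sup (f := fun t => #(D.bag t)) (mem_univ _)
  · simp [orderedBag, hh]

lemma nodup_orderedBag (ho : ∀ h < N, ord h < N) (h : ℕ) : (orderedBag D ord h).Nodup := by
  by_cases hh : h < N
  · have := natFamily_val (fun t => vertexList (D.bag t)) ⟨ord h, ho h hh⟩
    dsimp only at this
    rw [orderedBag, if_pos hh, this]
    exact nodup_vertexList _
  · simp [orderedBag, hh]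

lemma lt_of_mem_orderedBag (ho : ∀ h < N, ord h < N) {h u : ℕ} (hu : u ∈ orderedBag D ord h) :
    u < n + r := by
  obtain ⟨-, v, -, rfl⟩ := (mem_orderedBag ho).1 hu
  exact vertexCode_lt v

/-- The numbering refines the order of the first bags, so `IsSearchOrder.mem_first_bag` applies.
This is the only way in which the tree structure enters the elimination. -/
lemma mem_orderedBag_first (ho : SearchList N (natFamily (neighbourList D.tree)) ord)
    (hn : Numbering N (n + r) (orderedBag D ord) num vert hp) {h u v : ℕ}
    (hu : u ∈ orderedBag D ord h) (hv : v ∈ orderedBag D ord h) (huv : num u ≤ num v) :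
    u ∈ orderedBag D ord (hp (num v)) := by
  obtain ⟨pos, pa, hs, hpos⟩ := ho.exists_isSearchOrder
  have huM := lt_of_mem_orderedBag ho.lt hu
  have hvM := lt_of_mem_orderedBag ho.lt hv
  obtain ⟨nu1, nuM, nu⟩ := hn.num_mem u huM
  obtain ⟨nv1, nvM, nv⟩ := hn.num_mem v hvM
  have hu1 := hn.mem_first _ nu1 nuM
  have hv1 := hn.mem_first _ nv1 nvM
  have hvf := hn.first _ nv1 nvM
  have hmono := hn.mono _ _ nu1 huv nvM
  have hposord : ∀ q (hq : q < N), pos ⟨ord q, ho.lt q hq⟩ = q := fun q hq =>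
    ho.inj _ (hpos _).1 _ hq (hpos _).2
  rw [nu] at hu1
  rw [nv] at hv1 hvf
  obtain ⟨hh, u', hu', rfl⟩ := (mem_orderedBag ho.lt).1 hu
  obtain ⟨_, v', hv', rfl⟩ := (mem_orderedBag ho.lt).1 hv
  obtain ⟨hhu, u'', hu'', heu⟩ := (mem_orderedBag ho.lt).1 hu1
  obtain ⟨hhv, v'', hv'', hev⟩ := (mem_orderedBag ho.lt).1 hv1
  obtain rfl := vertexCode_injective heu
  obtain rfl := vertexCode_injective hev
  refine (mem_orderedBag ho.lt).2 ⟨hhv, u'', ?_, rfl⟩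
  refine hs.mem_first_bag D.isTree D.connected hu'' hv'' (fun t ht => ?_) ?_ hu' hv'
  · rw [hposord _ hhv]
    by_contra hlt
    refine hvf (pos t) (by omega) ((mem_orderedBag ho.lt).2 ⟨(hpos t).1, v'', ?_, rfl⟩)
    have : (⟨ord (pos t), ho.lt _ (hpos t).1⟩ : Fin N) = t := Fin.ext (hpos t).2
    rwa [this]
  · rw [hposord _ hhu, hposord _ hhv]; exact hmono

lemma mem_lowerList_iff {i x : ℕ} :
    x ∈ lowerList num (orderedBag D ord (hp i)) i ↔
      x < i ∧ ∃ u ∈ orderedBag D ord (hp i), num u = x := by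
  simp only [lowerList, List.mem_filter, List.mem_map, decide_eq_true_eq]
  tauto

lemma nodup_lowerList (ho : ∀ h < N, ord h < N)
    (hn : Numbering N (n + r) (orderedBag D ord) num vert hp) (i : ℕ) :
    (lowerList num (orderedBag D ord (hp i)) i).Nodup := by
  refine List.Nodup.filter _ (List.Nodup.map_on (fun u hu u' hu' he => ?_) (nodup_orderedBag ho _))
  rw [← (hn.num_mem u (lt_of_mem_orderedBag ho hu)).2.2, he,
    (hn.num_mem u' (lt_of_mem_orderedBag ho hu')).2.2]

/-- The first bag of `i` contains `i` itself, which is filtered out; this leaves room for the digit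
of `i` within `W ^ k` cells. -/
lemma length_lowerList (ho : ∀ h < N, ord h < N)
    (hn : Numbering N (n + r) (orderedBag D ord) num vert hp) {i : ℕ} (h1 : 1 ≤ i)
    (hi : i ≤ n + r) : (lowerList num (orderedBag D ord (hp i)) i).length + 1 ≤ D.width := by
  refine le_trans ?_ (length_orderedBag_le (D := D) ho (hp i))
  rw [← List.length_map (f := num) (as := orderedBag D ord (hp i)), lowerList, Nat.succ_le_iff,
    List.length_filter_lt_length_iff_exists]
  exact ⟨i, List.mem_map.2 ⟨vert i, hn.mem_first i h1 hi, (hn.num_vert i h1 hi).2⟩, by simp⟩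

/-- Let `p` be the greatest member of the list of `i`. Any other member `x` shares the first bag of
`i` with `p` and is smaller, so `mem_orderedBag_first` puts `x` into the first bag of `p`, and thus
into the list of `p`. -/
lemma isElimination (ho : SearchList N (natFamily (neighbourList D.tree)) ord)
    (hn : Numbering N (n + r) (orderedBag D ord) num vert hp) :
    IsElimination (n + r) (fun i => lowerList num (orderedBag D ord (hp i)) i)
      (fun i => (lowerList num (orderedBag D ord (hp i)) i).foldl max 0) := by
  have hlt : ∀ i, ∀ x ∈ lowerList num (orderedBag D ord (hp i)) i, 1 ≤ x ∧ x < i := by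
    intro i x hx
    obtain ⟨hxi, u, hu, rfl⟩ := mem_lowerList_iff.1 hx
    exact ⟨(hn.num_mem u (lt_of_mem_orderedBag ho.lt hu)).1, hxi⟩
  refine ⟨fun i _ _ => hlt i, fun i h1 hi => ?_, fun i h1 hi h0 => ?_, fun i h1 hi h0 x hx => ?_⟩
  · rcases foldl_max_mem (lowerList num (orderedBag D ord (hp i)) i) 0 with h | h
    · rw [h]; omega
    · exact (hlt i _ h).2
  · refine List.eq_nil_iff_forall_not_mem.2 fun x hx => ?_
    have h2 := le_foldl_max (a := 0) (Or.inr hx)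
    have h3 := (hlt i x hx).1
    omega
  · have hmem := (foldl_max_mem (lowerList num (orderedBag D ord (hp i)) i) 0).resolve_left h0
    have hle := le_foldl_max (a := 0) (Or.inr hx)
    generalize (lowerList num (orderedBag D ord (hp i)) i).foldl max 0 = p at *
    obtain ⟨-, v, hv, rfl⟩ := mem_lowerList_iff.1 hmem
    obtain ⟨-, u, hu, rfl⟩ := mem_lowerList_iff.1 hx
    rcases hle.lt_or_eq with hlt | heq
    · exact Or.inr (mem_lowerList_iff.2 ⟨hlt, u, mem_orderedBag_first ho hn hu hv hle, rfl⟩)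
    · exact Or.inl heq

lemma sum_length_lists_le (ho : SearchList N (natFamily (neighbourList D.tree)) ord) :
    ∑ j ∈ range r, ((natFamily (fun j => (F j).posVars) j).length +
      (natFamily (fun j => (F j).negVars) j).length) ≤ 2 * (D.width * (n + r)) := by
  obtain ⟨pos, pa, hs, hpos⟩ := ho.exists_isSearchOrder
  have htop : ∀ v, ∃ t, v ∈ D.bag t ∧ ∀ t', v ∈ D.bag t' → pos t ≤ pos t' := by
    intro v
    obtain ⟨t, ht⟩ := D.cover v
    obtain ⟨t, ht, hmin⟩ := exists_min_image ({t | v ∈ D.bag t} : Finset (Fin N)) pos ⟨t, by simpa using ht⟩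
    exact ⟨t, by simpa using ht, fun t' ht' => hmin t' (by simpa using ht')⟩
  choose top h1 h2 using htop
  refine le_trans ?_ (Nat.mul_le_mul_left 2 (sum_card_scope_le F D hs h1 h2))
  rw [← Fin.sum_univ_eq_sum_range fun j => (natFamily (fun j => (F j).posVars) j).length +
      (natFamily (fun j => (F j).negVars) j).length, mul_sum]
  refine sum_le_sum fun j _ => ?_
  rw [natFamily_val, natFamily_val]
  have := (F j).length_posVars_le
  have := (F j).length_negVars_le
  omega

/-- An edge of the incidence graph lies in a bag. This pays for the quadratic Fourier transform
within `W ^ k` steps. -/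
lemma two_le_width {j : Fin r} (hj : (F j).posVars ≠ []) : 2 ≤ D.width := by
  obtain ⟨x, hx⟩ := List.exists_mem_of_ne_nil _ hj
  obtain ⟨i, hi, -⟩ := Constraint.mem_scope_of_mem_posVars hx
  obtain ⟨t, h1, h2⟩ := D.edge (.inl i) (.inr j) (Or.inl ⟨i, j, rfl, rfl, hi⟩)
  have : 1 < #(D.bag t) := one_lt_card.2 ⟨_, h1, _, h2, by simp⟩
  exact le_trans this (le_sup (f := fun t => #(D.bag t)) (mem_univ t))

/-! ### The model count as a sum over all assignments -/

/-- The table of the literals of the system. -/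
def IsLitTable (F : Fin r → Constraint n) (M W : ℕ) (num lit : ℕ → ℕ) : Prop :=
  ∀ x, lit x = 1 ↔ ∃ j : Fin r, (∃ u ∈ (F j).posVars, x = litCell M W (num u) (num (n + j)) 1) ∨
    ∃ u ∈ (F j).negVars, x = litCell M W (num u) (num (n + j)) 0

lemma lit_iff {W v : ℕ} {lit : ℕ → ℕ} {bag : ℕ → List ℕ} (hW : 2 ≤ W)
    (hn : Numbering N (n + r) bag num vert hp) (hl : IsLitTable F (n + r) W num lit)
    (hv : v < W) {a c : ℕ} (hc : c ≤ n + r) :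
    lit (litCell (n + r) W a c v) = 1 ↔ ∃ (j : Fin r) (i : Fin n), a = num i ∧ c = num (n + j) ∧
      i ∈ (F j).scope ∧ (F j).Lit i v := by
  have hj : ∀ j : Fin r, num (n + j) ≤ n + r := fun j =>
    (hn.num_mem (n + j) (by omega)).2.1
  rw [hl]
  constructor
  · rintro ⟨j, ⟨u, hu, he⟩ | ⟨u, hu, he⟩⟩
    · obtain ⟨rfl, rfl, rfl⟩ := litCell_inj hc hv (hj j) (by omega) he
      obtain ⟨i, hi, rfl⟩ := Constraint.mem_scope_of_mem_posVars hu
      exact ⟨j, i, rfl, rfl, hi, Or.inl ⟨rfl, hu⟩⟩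
    · obtain ⟨rfl, rfl, rfl⟩ := litCell_inj hc hv (hj j) (by omega) he
      obtain ⟨i, hi, rfl⟩ := Constraint.mem_scope_of_mem_negVars hu
      exact ⟨j, i, rfl, rfl, hi, Or.inr ⟨rfl, hu⟩⟩
  · rintro ⟨j, i, rfl, rfl, -, ⟨rfl, hu⟩ | ⟨rfl, hu⟩⟩
    · exact ⟨j, Or.inl ⟨i, hu, rfl⟩⟩
    · exact ⟨j, Or.inr ⟨i, hu, rfl⟩⟩

/-- Products over the numbers of the vertices. -/
lemma prod_Ioc_eq {bag : ℕ → List ℕ} (hn : Numbering N (n + r) bag num vert hp) (f : ℕ → ℂ) :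
    ∏ i ∈ Ioc 0 (n + r), f i = (∏ i : Fin n, f (num i)) * ∏ j : Fin r, f (num (n + j)) := by
  have h : ∏ i ∈ Ioc 0 (n + r), f i = ∏ v : Fin n ⊕ Fin r, f (num (vertexCode v)) := by
    symm
    refine prod_bij (fun v _ => num (vertexCode v)) (fun v _ => ?_) (fun v _ v' _ he => ?_)
      (fun i hi => ?_) fun _ _ => rfl
    · have := hn.num_mem _ (vertexCode_lt v)
      rw [mem_Ioc]; omega
    · apply vertexCode_injective
      rw [← (hn.num_mem _ (vertexCode_lt v)).2.2, he, (hn.num_mem _ (vertexCode_lt v')).2.2]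
    · rw [mem_Ioc] at hi
      obtain ⟨h1, h2⟩ := hn.num_vert i (by omega) (by omega)
      obtain ⟨v, hv⟩ := exists_vertexCode h1
      exact ⟨v, mem_univ v, by rw [hv, h2]⟩
  rw [h, Fintype.prod_sum_type]
  rfl

lemma prod_localFactor {W : ℕ} {lit : ℕ → ℕ} {wt fac : ℕ → ℂ} (hW : 2 ≤ W)
    (ho : SearchList N (natFamily (neighbourList D.tree)) ord)
    (hn : Numbering N (n + r) (orderedBag D ord) num vert hp)
    (hl : IsLitTable F (n + r) W num lit) {τ : ℕ → ℕ} (hτ : ∀ x, τ x < W) :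
    ∏ i ∈ Ioc 0 (n + r), localFactor (n + r) W
      (fun i => lowerList num (orderedBag D ord (hp i)) i) lit wt fac i τ =
    (∏ i ∈ Ioc 0 (n + r), wt (i * W + τ i)) *
      ∏ a ∈ Ioc 0 (n + r), ∏ c ∈ Ioc 0 (n + r), pairFactor (n + r) W lit fac a c τ := by
  -- A factor other than 1 comes from an incidence, and incident vertices share a bag. So the
  -- smaller one is in the list of the greater one and no factor is lost.
  have hshare : ∀ a c, c ≤ n + r → pairFactor (n + r) W lit fac a c τ ≠ 1 →
      a ≠ c ∧ (a < c → a ∈ lowerList num (orderedBag D ord (hp c)) c) ∧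
        (c < a → c ∈ lowerList num (orderedBag D ord (hp a)) a) := by
    intro a c hc hne
    have hlit : lit (litCell (n + r) W a c (τ a)) = 1 := by
      by_contra hcon
      exact hne (by rw [pairFactor, if_neg hcon])
    obtain ⟨j, i, rfl, rfl, hi, -⟩ := (lit_iff hW hn hl (hτ a) hc).1 hlit
    obtain ⟨t, h1, h2⟩ := D.edge (.inl i) (.inr j) (Or.inl ⟨i, j, rfl, rfl, hi⟩)
    obtain ⟨pos, pa, -, hpos⟩ := ho.exists_isSearchOrder
    have ht : (⟨ord (pos t), ho.lt _ (hpos t).1⟩ : Fin N) = t := Fin.ext (hpos t).2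
    have h1' : (i : ℕ) ∈ orderedBag D ord (pos t) :=
      (mem_orderedBag ho.lt).2 ⟨(hpos t).1, .inl i, by rwa [ht], rfl⟩
    have h2' : n + j ∈ orderedBag D ord (pos t) :=
      (mem_orderedBag ho.lt).2 ⟨(hpos t).1, .inr j, by rwa [ht], rfl⟩
    refine ⟨fun he => ?_, fun hlt => ?_, fun hlt => ?_⟩
    · have h3 := (hn.num_mem i (by omega)).2.2
      rw [he, (hn.num_mem (n + j) (by omega)).2.2] at h3
      omega
    · exact mem_lowerList_iff.2 ⟨hlt, i, mem_orderedBag_first ho hn h1' h2' hlt.le, rfl⟩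
    · exact mem_lowerList_iff.2 ⟨hlt, n + j, mem_orderedBag_first ho hn h2' h1' hlt.le, rfl⟩
  -- `prod_prod_lt` asks for a trivial diagonal at all numbers, but the literal table is understood
  -- only for vertices; the conditional covers the rest.
  have hdiag : ∀ i, (if i ≤ n + r then pairFactor (n + r) W lit fac i i τ else 1) = 1 := by
    intro i
    split_ifs with hi
    · by_contra hne
      exact (hshare i i hi hne).1 rfl
    · rfl
  have hE := isElimination ho hn
  have hpairs : ∏ a ∈ Ioc 0 (n + r), ∏ c ∈ Ioc 0 (n + r), pairFactor (n + r) W lit fac a c τ =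
      ∏ i ∈ Ioc 0 (n + r), ∏ u ∈ Ioo 0 i,
        pairFactor (n + r) W lit fac i u τ * pairFactor (n + r) W lit fac u i τ := by
    have h := prod_prod_lt (n + r)
      (fun a c => if c ≤ n + r then pairFactor (n + r) W lit fac a c τ else 1) hdiag
    have h1 : ∏ a ∈ Ioc 0 (n + r), ∏ c ∈ Ioc 0 (n + r),
        (if c ≤ n + r then pairFactor (n + r) W lit fac a c τ else 1) =
        ∏ a ∈ Ioc 0 (n + r), ∏ c ∈ Ioc 0 (n + r), pairFactor (n + r) W lit fac a c τ :=
      prod_congr rfl fun a _ => prod_congr rfl fun c hc => if_pos (mem_Ioc.1 hc).2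
    rw [← h1, ← h]
    refine prod_congr rfl fun i hi => prod_congr rfl fun u hu => ?_
    rw [mem_Ioc] at hi
    rw [mem_Ioo] at hu
    rw [if_pos (by omega), if_pos hi.2]
  rw [hpairs, ← prod_mul_distrib]
  refine prod_congr rfl fun i hi => ?_
  rw [mem_Ioc] at hi
  rw [localFactor]
  congr 1
  rw [← List.prod_toFinset _ (nodup_lowerList ho.lt hn i)]
  refine prod_subset (fun x hx => ?_) fun u hu hnot => ?_
  · have := hE.lt i (by omega) hi.2 x (List.mem_toFinset.1 hx)
    rw [mem_Ioo]; omega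
  · rw [mem_Ioo] at hu
    rw [List.mem_toFinset] at hnot
    have h1 : pairFactor (n + r) W lit fac i u τ = 1 := by
      by_contra hne
      exact hnot ((hshare i u (by omega) hne).2.2 hu.2)
    have h2 : pairFactor (n + r) W lit fac u i τ = 1 := by
      by_contra hne
      exact hnot ((hshare u i hi.2 hne).2.1 hu.2)
    rw [h1, h2, mul_one]

open Classical in
/-- The sum over all assignments of the product of the local factors is the model count. -/
lemma sumTo_prod_localFactor {W : ℕ} {lit : ℕ → ℕ} {wt fac : ℕ → ℂ} (hW : 2 ≤ W)
    (hF : ∀ j, (F j).modulus ≤ W)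
    (ho : SearchList N (natFamily (neighbourList D.tree)) ord)
    (hn : Numbering N (n + r) (orderedBag D ord) num vert hp)
    (hl : IsLitTable F (n + r) W num lit)
    (hwt : ∀ i, 1 ≤ i → i ≤ n + r → ∀ s < W, wt (i * W + s) = vertexWt F (vert i) s)
    (hfac : ∀ i, 1 ≤ i → i ≤ n + r → ∀ s < W, fac (i * W + s) = vertexFac F (vert i) s) :
    sumTo W (n + r) (fun τ => ∏ i ∈ Ioc 0 (n + r), localFactor (n + r) W
      (fun i => lowerList num (orderedBag D ord (hp i)) i) lit wt fac i τ) (fun _ => 0) =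
    modelCount F := by
  have hi1 : ∀ i : Fin n, 1 ≤ num i ∧ num i ≤ n + r ∧ vert (num i) = i := fun i =>
    hn.num_mem i (by omega)
  have hj1 : ∀ j : Fin r, 1 ≤ num (n + j) ∧ num (n + j) ≤ n + r ∧ vert (num (n + j)) = n + j :=
    fun j => hn.num_mem (n + j) (by omega)
  rw [sumTo_eq_sum, ← sum_eq_modelCount F hW hF, ← Fintype.sum_prod_type']
  -- Reindexing by the elimination numbers turns the assignments of `1, …, n + r` into pairs of
  -- values of the variables and states of the constraints.
  have hbij : Bijective fun v : Fin n ⊕ Fin r =>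
      (⟨num (vertexCode v) - 1, by
        have := hn.num_mem _ (vertexCode_lt v); omega⟩ : Fin (n + r)) := by
    constructor
    · intro v v' he
      have h1 := hn.num_mem _ (vertexCode_lt v)
      have h2 := hn.num_mem _ (vertexCode_lt v')
      have h3 := congrArg Fin.val he
      dsimp only at h3
      apply vertexCode_injective
      rw [← h1.2.2, ← h2.2.2]
      congr 1
      omega
    · intro i
      obtain ⟨h1, h2⟩ := hn.num_vert (i + 1) (by omega) (by omega)
      obtain ⟨v, hv⟩ := exists_vertexCode h1
      exact ⟨v, Fin.ext (by simp [hv, h2])⟩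
  let e := Equiv.ofBijective _ hbij
  refine Fintype.sum_equiv ((e.symm.arrowCongr (Equiv.refl (Fin W))).trans
    (Equiv.sumArrowEquivProdArrow _ _ _)) _ _ fun g => ?_
  set τ := extend (fun _ => 0) g with hτ
  have hτW : ∀ x, τ x < W := by
    intro x
    rw [hτ, extend]
    split_ifs
    · exact Fin.is_lt _
    · omega
  have hval : ∀ v : Fin n ⊕ Fin r, (g (e v) : ℕ) = τ (num (vertexCode v)) := by
    intro v
    have := hn.num_mem _ (vertexCode_lt v)
    rw [hτ, extend, dif_pos ⟨this.1, this.2.1⟩]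
    rfl
  rw [prod_localFactor hW ho hn hl hτW]
  have hx : ∀ i : Fin n, (((e.symm.arrowCongr (Equiv.refl (Fin W))).trans
      (Equiv.sumArrowEquivProdArrow _ _ _)) g).1 i = g (e (.inl i)) := fun _ => rfl
  have hs : ∀ j : Fin r, (((e.symm.arrowCongr (Equiv.refl (Fin W))).trans
      (Equiv.sumArrowEquivProdArrow _ _ _)) g).2 j = g (e (.inr j)) := fun _ => rfl
  have hvx : ∀ i : Fin n, (g (e (.inl i)) : ℕ) = τ (num i) := fun i => hval (.inl i)
  have hvs : ∀ j : Fin r, (g (e (.inr j)) : ℕ) = τ (num (n + j)) := fun j => hval (.inr j)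
  simp only [hx, hs, hvx, hvs]
  have hpair : ∀ a c, c ≤ n + r → pairFactor (n + r) W lit fac a c τ ≠ 1 →
      ∃ (j : Fin r) (i : Fin n), a = num i ∧ c = num (n + j) := by
    intro a c hc hne
    have hlit : lit (litCell (n + r) W a c (τ a)) = 1 := by
      by_contra hcon
      exact hne (by rw [pairFactor, if_neg hcon])
    obtain ⟨j, i, ha, hc', -⟩ := (lit_iff hW hn hl (hτW a) hc).1 hlit
    exact ⟨j, i, ha, hc'⟩
  have hne : ∀ (i : Fin n) (j : Fin r), num i ≠ num (n + j) := fun i j he => by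
    have h1 := (hi1 i).2.2
    rw [he, (hj1 j).2.2] at h1
    omega
  have hwi : ∀ i : Fin n, wt (num i * W + τ (num i)) = if τ (num i) < 2 then 1 else 0 := by
    intro i
    rw [hwt _ (hi1 i).1 (hi1 i).2.1 _ (hτW _), (hi1 i).2.2, vertexWt, if_pos i.2]
  have hwj : ∀ j : Fin r, wt (num (n + j) * W + τ (num (n + j))) =
      (F j).weight (τ (num (n + j))) := by
    intro j
    rw [hwt _ (hj1 j).1 (hj1 j).2.1 _ (hτW _), (hj1 j).2.2, vertexWt, if_neg (by omega)]
    simp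
  have hfj : ∀ j : Fin r, fac (num (n + j) * W + τ (num (n + j))) =
      (F j).factor (τ (num (n + j))) := by
    intro j
    rw [hfac _ (hj1 j).1 (hj1 j).2.1 _ (hτW _), (hj1 j).2.2, vertexFac, if_neg (by omega)]
    simp
  have hpf : ∀ (i : Fin n) (j : Fin r), pairFactor (n + r) W lit fac (num i) (num (n + j)) τ =
      if (F j).Lit i (τ (num i)) then (F j).factor (τ (num (n + j))) else 1 := by
    intro i j
    rw [pairFactor, hfj]
    refine if_congr ?_ rfl rfl
    rw [lit_iff hW hn hl (hτW _) (hj1 j).2.1]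
    constructor
    · rintro ⟨j', i', h1, h2, -, h3⟩
      have h4 := (hi1 i).2.2
      rw [h1, (hi1 i').2.2] at h4
      have h5 := (hj1 j).2.2
      rw [h2, (hj1 j').2.2] at h5
      obtain rfl := Fin.ext h4
      obtain rfl : j' = j := Fin.ext (by omega)
      exact h3
    · intro h3
      refine ⟨j, i, rfl, rfl, ?_, h3⟩
      rcases h3 with ⟨-, h3⟩ | ⟨-, h3⟩
      · obtain ⟨i', hi', he⟩ := Constraint.mem_scope_of_mem_posVars h3
        rwa [← Fin.ext he]
      · obtain ⟨i', hi', he⟩ := Constraint.mem_scope_of_mem_negVars h3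
        rwa [← Fin.ext he]
  have h1 : ∀ (i : Fin n) (i' : Fin n), pairFactor (n + r) W lit fac (num i) (num i') τ = 1 := by
    intro i i'
    by_contra hcon
    obtain ⟨j, -, -, h⟩ := hpair _ _ (hi1 i').2.1 hcon
    exact hne i' j h
  -- With `h1`, only pairs of a variable followed by a constraint are left in the product over
  -- ordered pairs, so every incidence counts once.
  have h2 : ∀ (j : Fin r) c, c ≤ n + r → pairFactor (n + r) W lit fac (num (n + j)) c τ = 1 := by
    intro j c hc
    by_contra hcon
    obtain ⟨-, i, h, -⟩ := hpair _ _ hc hcon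
    exact hne i j h.symm
  rw [prod_Ioc_eq hn, prod_Ioc_eq hn fun a => ∏ c ∈ Ioc 0 (n + r), pairFactor (n + r) W lit fac a c τ,
    prod_eq_one fun (j : Fin r) _ => prod_eq_one fun c hc => h2 j c (mem_Ioc.1 hc).2, mul_one]
  simp only [prod_Ioc_eq hn fun c => pairFactor (n + r) W lit fac _ c τ, h1, prod_const_one, one_mul,
    hpf, hwi, hwj]
  rw [prod_comm, mul_assoc]

end

end ModCount
namespace ModCount

open Finset Function

/-! ### The counting program -/

lemma Frame.seq {p q : Prog} {σ σ' σ'' : Store} (h : Frame p σ σ') (h' : Frame q σ' σ'') :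
    Frame (p ;; q) σ σ'' where
  reg x hx := by
    simp only [Prog.writesReg, Bool.or_eq_false_iff] at hx
    rw [h'.reg x hx.2, h.reg x hx.1]
  mem a ha := by
    simp only [Prog.writesMem, Bool.or_eq_false_iff] at ha
    rw [h'.mem a ha.2, h.mem a ha.1]
  num a ha := by
    simp only [Prog.writesNum, Bool.or_eq_false_iff] at ha
    rw [h'.num a ha.2, h.num a ha.1]

/-- The tables that guide the elimination: the radix, the width, and the numbering of the vertices
of the incidence graph. -/
def preparation : Prog := parameters ;; search ;; numbering

/-- The evaluation of the sum over all states. -/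
def counting : Prog :=
  .setReg 28 (.reg 4) ;; power ;; .setReg 5 (.reg 19) ;; lowerBags ;; divMod ;; markLists ;;
    vertexWeights ;; clearTables ;; eliminate

section

variable {n r N : ℕ} {F : Fin r → Constraint n} {D : TreeDecomposition (incidenceGraph F) N}

lemma card_bag_le_width (D : TreeDecomposition (incidenceGraph F) N) (t : Fin N) :
    #(D.bag t) ≤ D.width :=
  Finset.le_sup (f := fun t => #(D.bag t)) (mem_univ t)

lemma one_le_width (D : TreeDecomposition (incidenceGraph F) N) (h : 1 ≤ n + r) :
    1 ≤ D.width := by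
  obtain ⟨v, -⟩ := exists_vertexCode (n := n) (r := r) (u := 0) h
  obtain ⟨t, ht⟩ := D.cover v
  exact (Finset.card_pos.2 ⟨v, ht⟩).trans_le (card_bag_le_width D t)

lemma one_le_nodes (D : TreeDecomposition (incidenceGraph F) N) (h : 1 ≤ n + r) : 1 ≤ N := by
  obtain ⟨v, -⟩ := exists_vertexCode (n := n) (r := r) (u := 0) h
  obtain ⟨t, -⟩ := D.cover v
  exact t.pos

lemma length_natFamily_vertexList (D : TreeDecomposition (incidenceGraph F) N) {t : ℕ}
    (ht : t < N) : (natFamily (fun t => vertexList (D.bag t)) t).length = #(D.bag ⟨t, ht⟩) := by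
  rw [natFamily, dif_pos ht, length_vertexList]

/-- Connectedness in the form that `SearchInv.lt_tail` uses, by induction along a walk from the node
0. -/
lemma forall_of_closed_neighbourList {T : SimpleGraph (Fin N)} (hT : T.Connected) {S : ℕ → Prop}
    (h0 : S 0) (hS : ∀ t, S t → ∀ y ∈ natFamily (neighbourList T) t, S y) {t : ℕ} (ht : t < N) :
    S t := by
  have hadj : ∀ x y : Fin N, T.Adj x y → S x → S y := fun x y hxy hx =>
    hS x hx y (by rw [natFamily_val]; exact mem_neighbourList.2 hxy)
  obtain ⟨p⟩ := hT.preconnected ⟨0, by omega⟩ ⟨t, ht⟩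
  have key : ∀ x y : Fin N, T.Walk x y → S x → S y := by
    intro x y p
    induction p with
    | nil => exact id
    | cons hxy _ ih => exact fun hx => ih (hadj _ _ hxy hx)
  exact key _ _ p h0

lemma lt_of_mem_neighbourList {T : SimpleGraph (Fin N)} {t y : ℕ}
    (hy : y ∈ natFamily (neighbourList T) t) : y < N := by
  rw [natFamily] at hy
  split_ifs at hy with ht
  · simp only [neighbourList, List.mem_map] at hy
    obtain ⟨u, -, rfl⟩ := hy
    exact u.2
  · simp at hy

lemma runs_preparation {w : ℕ} (hw : 2 ≤ w) (hnr : 1 ≤ n + r) (hF : ∀ j, (F j).modulus ≤ w) :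
    Runs preparation (input F D) (400 * (D.width * N) + 50 * (n + r)) fun σ =>
      (2 ≤ σ.reg 3 ∧ σ.reg 3 ≤ w ∧ (∀ j, (F j).modulus ≤ σ.reg 3) ∧ σ.reg 4 = D.width ∧
        σ.reg 6 = n + r) ∧
      SearchList N (natFamily (neighbourList D.tree)) (σ.mem 11) ∧
      Numbering N (n + r) (orderedBag D (σ.mem 11)) (σ.mem 13) (σ.mem 14) (σ.mem 15) := by
  have hk := one_le_width D hnr
  have hN := one_le_nodes D hnr
  have hlen : ∀ t < N, (natFamily (fun t => vertexList (D.bag t)) t).length ≤ D.width :=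
    fun t ht => (length_natFamily_vertexList D ht).trans_le (card_bag_le_width D _)
  have hbag : Stored N (natFamily fun t => vertexList (D.bag t)) ((input F D).mem 9)
      ((input F D).mem 10) := stored_starts_entries _
  refine Runs.seq (T₂ := 200 * N + (N * (30 * D.width + 30) + 7))
    (runs_parameters (r := r) (N := N) (w := w) (k := D.width) rfl rfl hw (fun j hj => ?_) hbag hlen)
    (fun σ₁ f₁ h₁ => Runs.seq (runs_search (N := N) (nbr := natFamily (neighbourList D.tree)) hN
        (f₁.reg 2 rfl) ?_ (fun i => ?_) (fun t _ y hy => lt_of_mem_neighbourList hy)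
        (fun S h0 hS t ht => forall_of_closed_neighbourList D.isTree.connected h0 hS ht) ?_)
      (fun σ₂ f₂ h₂ => Runs.mono (runs_numbering (N := N) (k := D.width)
        (bagl := natFamily fun t => vertexList (D.bag t)) (M := n + r) (ord := σ₂.mem 11)
        ((f₂.reg 2 rfl).trans (f₁.reg 2 rfl)) ?_ (fun i => ?_) rfl h₂.lt (fun t ht u hu => ?_)
        (fun u hu => ?_) hlen) le_rfl fun σ₃ f₃ h₃ => ?_) le_rfl) ?_
  · change (if h : j < r then (F ⟨j, h⟩).modulus else 0) ≤ w
    rw [dif_pos hj]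
    exact hF _
  · rw [f₁.mem 7 rfl, f₁.mem 8 rfl]
    exact stored_starts_entries _
  · rw [f₁.mem 12 rfl]; rfl
  · rw [← Fin.sum_univ_eq_sum_range (fun t => (natFamily (neighbourList D.tree) t).length)]
    simpa using sum_length_neighbourList D.isTree
  · rw [f₂.mem 9 rfl, f₂.mem 10 rfl, f₁.mem 9 rfl, f₁.mem 10 rfl]
    exact hbag
  · rw [f₂.mem 13 rfl, f₁.mem 13 rfl]; rfl
  · rw [natFamily, dif_pos ht] at hu
    obtain ⟨v, -, rfl⟩ := mem_vertexList.1 hu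
    exact vertexCode_lt v
  · obtain ⟨v, rfl⟩ := exists_vertexCode hu
    obtain ⟨t, ht⟩ := D.cover v
    obtain ⟨pos, pa, -, hpos⟩ := h₂.exists_isSearchOrder
    refine ⟨pos t, (hpos t).1, ?_⟩
    rw [(hpos t).2, natFamily_val]
    exact mem_vertexList.2 ⟨v, ht, rfl⟩
  · obtain ⟨h3, h3w, hmod, h4, hlen4, h6⟩ := h₁
    rw [f₃.reg 3 rfl, f₂.reg 3 rfl, f₃.reg 4 rfl, f₂.reg 4 rfl, f₃.reg 6 rfl, f₂.reg 6 rfl,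
      f₃.mem 11 rfl]
    refine ⟨⟨h3, h3w, fun j => ?_, le_antisymm h4 (Finset.sup_le fun t _ => ?_), h6⟩, h₂, h₃⟩
    · refine le_trans (le_of_eq ?_) (hmod j j.2)
      change _ = (if h : (j : ℕ) < r then (F ⟨j, h⟩).modulus else 0)
      rw [dif_pos j.2]
    · exact (length_natFamily_vertexList D t.2).symm.trans_le (hlen4 t t.2)
  · have h1 : N ≤ D.width * N := Nat.le_mul_of_pos_left _ hk
    have h2 : N * (30 * D.width + 30) = 30 * (D.width * N) + 30 * N := by ring
    omega

lemma runs_counting {w : ℕ} (hnr : 1 ≤ n + r) {σ : Store} (f : Frame preparation (input F D) σ)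
    (h3 : 2 ≤ σ.reg 3) (hw : σ.reg 3 ≤ w) (hmod : ∀ j, (F j).modulus ≤ σ.reg 3)
    (h4 : σ.reg 4 = D.width) (h6 : σ.reg 6 = n + r)
    (ho : SearchList N (natFamily (neighbourList D.tree)) (σ.mem 11))
    (hn : Numbering N (n + r) (orderedBag D (σ.mem 11)) (σ.mem 13) (σ.mem 14) (σ.mem 15)) :
    Runs counting σ (1300 * ((n + r) * (w ^ D.width * D.width))) fun σ' =>
      σ'.num 0 0 = modelCount F := by
  have hk := one_le_width D hnr
  generalize hWd : σ.reg 3 = W at *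
  have hin : ∀ a, preparation.writesMem a = false → σ.mem a = (input F D).mem a := f.mem
  have hnum : ∀ a, σ.num a = fun _ => 0 := fun a => f.num a rfl
  -- Absorbs the terms of order `(n + r) * k`, which come from the lists and the literals, into `(n
  -- + r) * W ^ k`.
  have hpw : D.width < W ^ D.width := Nat.lt_pow_self h3
  have hlen : ∀ t < N, (natFamily (fun t => vertexList (D.bag t)) t).length ≤ D.width :=
    fun t ht => (length_natFamily_vertexList D ht).trans_le (card_bag_le_width D _)
  have hbag : Stored N (natFamily fun t => vertexList (D.bag t)) (σ.mem 9) (σ.mem 10) := by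
    rw [hin 9 rfl, hin 10 rfl]
    exact stored_starts_entries _
  have hpos : Stored r (natFamily fun j => (F j).posVars) (σ.mem 1) (σ.mem 2) := by
    rw [hin 1 rfl, hin 2 rfl]
    exact stored_starts_entries _
  have hneg : Stored r (natFamily fun j => (F j).negVars) (σ.mem 3) (σ.mem 4) := by
    rw [hin 3 rfl, hin 4 rfl]
    exact stored_starts_entries _
  have hacc : Stored r (natFamily fun j => (F j).acceptTable) (σ.mem 5) (σ.mem 6) := by
    rw [hin 5 rfl, hin 6 rfl]
    exact stored_starts_entries _
  have hmem0 : ∀ j : Fin r, σ.mem 0 j = (F j).modulus := fun j => by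
    rw [hin 0 rfl]
    change (if h : (j : ℕ) < r then (F ⟨j, h⟩).modulus else 0) = _
    rw [dif_pos j.2]
  have hempty : ∀ j : Fin r, σ.mem 1 (j + 1) = σ.mem 1 j ↔ (F j).posVars = [] := fun j => by
    rw [hpos.start_succ j j.2, natFamily_val]
    simp
  have htab : ∀ j : Fin r, ∀ q < (F j).modulus,
      σ.mem 6 (σ.mem 5 j + q) = (F j).acceptTable.getD q 0 := fun j q hq => by
    have := hacc.entry j j.2 q (by rwa [natFamily_val, Constraint.length_acceptTable])
    rwa [natFamily_val] at this
  have hsq : ∀ j : Fin r, (F j).posVars ≠ [] → W * W ≤ W ^ D.width := fun j hj => by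
    rw [← sq]
    exact Nat.pow_le_pow_right (by omega) (two_le_width (D := D) hj)
  set l : ℕ → List ℕ := fun i => lowerList (σ.mem 13) (orderedBag D (σ.mem 11) (σ.mem 15 i)) i
    with hl
  set par : ℕ → ℕ := fun i => (l i).foldl max 0 with hpar
  have hlow : ∀ i, 1 ≤ i → i ≤ n + r →
      l i = lowerList (σ.mem 13)
        (natFamily (fun t => vertexList (D.bag t)) (σ.mem 11 (σ.mem 15 i))) i ∧
      (l i).length + 1 ≤ D.width := fun i h1 hi =>
    ⟨by simp only [hl, orderedBag]; rw [if_pos (hn.first_lt i h1 hi)],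
      length_lowerList ho.lt hn h1 hi⟩
  refine Runs.mono (T := 2 + (11 * D.width + 7 + (2 + ((n + r) * (40 * D.width + 60) + 5 +
      (40 * W ^ D.width + 9 + (30 * (2 * (D.width * (n + r))) + 50 * r + 5 +
      (210 * ((n + r) * W ^ D.width) + 5 + (12 * ((n + r + 1) * W ^ D.width) + 12 +
      (450 * ((n + r) * (W ^ D.width * D.width)) + 5)))))))))
    (Q := fun σ' => σ'.num 0 0 = modelCount F) ?_ ?_ fun _ _ h => h
  · have g₀ := Runs.frame_run (p := .setReg 28 (.reg 4)) rfl σ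
    refine Runs.straight_seq rfl ?_ le_rfl
    generalize hσ₀ : (Prog.setReg 28 (.reg 4)).run σ = σ₀ at *
    have h28 : σ₀.reg 28 = D.width := by rw [← hσ₀]; exact h4
    refine Runs.seq (runs_power ((g₀.reg 3 rfl).trans hWd) h28) (fun σ₁ f₁ h₁ => ?_) le_rfl
    have g₁ := (g₀.seq f₁).seq (Runs.frame_run (p := .setReg 5 (.reg 19)) rfl σ₁)
    refine Runs.straight_seq rfl ?_ le_rfl
    have h5 : ((Prog.setReg 5 (.reg 19)).run σ₁).reg 5 = W ^ D.width := h₁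
    generalize (Prog.setReg 5 (.reg 19)).run σ₁ = σ₂ at *
    refine Runs.seq (runs_lowerBags (l := l) (by rw [g₁.mem 9 rfl, g₁.mem 10 rfl]; exact hbag)
      (g₁.mem 13 rfl) (g₁.mem 11 rfl) (g₁.mem 15 rfl)
      (fun i => by rw [g₁.mem 17 rfl, hin 17 rfl]; rfl) ((g₁.reg 4 rfl).trans h4)
      ((g₁.reg 6 rfl).trans h6) (fun i h1 hi => ho.lt _ (hn.first_lt i h1 hi)) hlen hlow)
      (fun σ₃ f₃ h₃ => ?_) le_rfl
    have g₃ := g₁.seq f₃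
    refine Runs.seq (runs_divMod (by omega) ((g₃.reg 3 rfl).trans hWd)
      ((f₃.reg 5 rfl).trans h5)) (fun σ₄ f₄ h₄ => ?_) le_rfl
    have g₄ := g₃.seq f₄
    refine Runs.seq (runs_markLists (n := n) (r := r) (num := σ.mem 13) ((g₄.reg 0 rfl).trans (f.reg 0 rfl))
      ((g₄.reg 1 rfl).trans (f.reg 1 rfl)) ((g₄.reg 6 rfl).trans h6) ((g₄.reg 3 rfl).trans hWd)
      (g₄.mem 13 rfl) (fun x => by rw [g₄.mem 19 rfl, hin 19 rfl]; rfl)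
      (by rw [g₄.mem 1 rfl, g₄.mem 2 rfl]; exact hpos)
      (by rw [g₄.mem 3 rfl, g₄.mem 4 rfl]; exact hneg) (sum_length_lists_le ho))
      (fun σ₅ f₅ h₅ => ?_) le_rfl
    have g₅ := g₄.seq f₅
    refine Runs.seq (runs_vertexWeights (M := n + r) (W := W) (K := W ^ D.width)
      (vert := σ.mem 14) F ((g₅.reg 0 rfl).trans (f.reg 0 rfl)) ((g₅.reg 6 rfl).trans h6)
      ((g₅.reg 3 rfl).trans hWd) (g₅.mem 14 rfl) (fun i h1 hi => (hn.num_vert i h1 hi).1) h3 hmod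
      (by rw [g₅.mem 0 rfl]; exact hmem0) (by rw [g₅.mem 1 rfl]; exact hempty)
      (by rw [g₅.mem 5 rfl, g₅.mem 6 rfl]; exact htab) (by omega) hsq
      (fun x => by rw [g₅.num 2 rfl, g₅.num 3 rfl, hnum, hnum]; exact ⟨rfl, rfl⟩))
      (fun σ₆ f₆ h₆ => ?_) le_rfl
    have g₆ := g₅.seq f₆
    have g₃₆ := (f₄.seq f₅).seq f₆
    refine Runs.seq (runs_clearTables ((g₆.reg 6 rfl).trans h6)
      (((f₃.seq g₃₆).reg 5 rfl).trans h5)) (fun σ₇ f₇ h₇ => ?_) le_rfl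
    have g₇ := g₆.seq f₇
    have g₃₇ := g₃₆.seq f₇
    have hT : Tables (n + r) W D.width (W ^ D.width) l par (σ₅.mem 19) (σ₆.num 2) (σ₆.num 3) σ₇ :=
      { radix := (g₇.reg 3 rfl).trans hWd
        width := (g₇.reg 4 rfl).trans h4
        size := ((f₃.seq g₃₇).reg 5 rfl).trans h5
        card := (g₇.reg 6 rfl).trans h6
        row := by rw [g₃₇.mem 16 rfl]; exact h₃.2.1
        row_length := by rw [g₃₇.mem 17 rfl]; exact h₃.1
        parent := by rw [g₃₇.mem 18 rfl]; exact h₃.2.2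
        literals := (f₆.seq f₇).mem 19 rfl
        divMod := by
          have f₄₇ := (f₅.seq f₆).seq f₇
          rw [f₄₇.mem 21 rfl, f₄₇.mem 22 rfl]; exact h₄
        weights := f₇.num 2 rfl
        factors := f₇.num 3 rfl }
    have hlit : IsLitTable F (n + r) W (σ.mem 13) (σ₅.mem 19) := fun x => by
      rw [h₅ x]
      constructor
      · rintro ⟨j, hj, h⟩
        rw [show natFamily (fun j => (F j).posVars) j = _ from natFamily_val _ ⟨j, hj⟩,
          show natFamily (fun j => (F j).negVars) j = _ from natFamily_val _ ⟨j, hj⟩] at h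
        exact ⟨⟨j, hj⟩, h⟩
      · rintro ⟨j, h⟩
        refine ⟨j, j.2, ?_⟩
        rwa [natFamily_val, natFamily_val]
    refine Runs.mono (runs_eliminate hT h3 rfl hk (isElimination ho hn)
      (fun i h1 hi => (hlow i h1 hi).2) (fun i _ _ => nodup_lowerList ho.lt hn i)
      (fun x => ?_) h₇) le_rfl fun σ₈ _ h₈ => ?_
    · rw [g₇.mem 20 rfl, hin 20 rfl]
      exact (show 0 < W by omega)
    · have hsum := sumTo_eq_message (W := W) (isElimination ho hn)
        (L := localFactor (n + r) W l (σ₅.mem 19) (σ₆.num 2) (σ₆.num 3))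
        (fun i _ _ τ τ' hτ => localFactor_congr hτ) (fun _ => 0)
      refine h₈.trans (hsum.symm.trans ?_)
      exact sumTo_prod_localFactor h3 hmod ho hn hlit (fun i h1 hi s hs => (h₆ i h1 hi s hs).1)
        (fun i h1 hi s hs => (h₆ i h1 hi s hs).2)
  · have hWw : W ^ D.width ≤ w ^ D.width := Nat.pow_le_pow_left hw _
    have hM : (n + r) * (W ^ D.width * D.width) ≤ (n + r) * (w ^ D.width * D.width) := by gcongr
    refine le_trans ?_ (Nat.mul_le_mul_left 1300 hM)
    -- After the monomials are made opaque and compared with each other, the sum of all running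
    -- times is linear arithmetic.
    generalize W ^ D.width = K at hpw ⊢
    generalize D.width = k at hpw hk ⊢
    have e1 : K ≤ K * k := Nat.le_mul_of_pos_right _ hk
    have e2 : K * k ≤ (n + r) * (K * k) := Nat.le_mul_of_pos_left _ hnr
    have e3 : (n + r) * K ≤ (n + r) * (K * k) := Nat.mul_le_mul_left _ e1
    have e4 : (n + r) * k ≤ (n + r) * K := Nat.mul_le_mul_left _ hpw.le
    have e5 : n + r ≤ (n + r) * k := Nat.le_mul_of_pos_right _ hk
    have t1 : (n + r) * (40 * k + 60) = 40 * ((n + r) * k) + 60 * (n + r) := by ring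
    have t2 : k * (n + r) = (n + r) * k := mul_comm _ _
    have t3 : (n + r + 1) * K = (n + r) * K + K := by ring
    rw [t1, t2, t3]
    generalize (n + r) * (K * k) = X at *
    generalize (n + r) * K = Y at *
    generalize (n + r) * k = Z at *
    omega

lemma exec_preparation_counting {w : ℕ} (hw : 2 ≤ w) (hnr : 1 ≤ n + r)
    (hF : ∀ j, (F j).modulus ≤ w) :
    ∃ a s σ, Exec (preparation ;; counting) (input F D) a s σ ∧ σ.num 0 0 = modelCount F ∧
      a ≤ 1300 * ((n + r) * (w ^ D.width * D.width)) ∧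
      s ≤ 1350 * ((n + r) * (w ^ D.width * D.width)) + 400 * (D.width * N) := by
  obtain ⟨a₁, s₁, σ₁, e₁, hs₁, ⟨h3, h3w, hmod, h4, h6⟩, ho, hn⟩ :=
    runs_preparation (D := D) hw hnr hF
  obtain ⟨a₂, s₂, σ₂, e₂, hs₂, h₂⟩ := runs_counting hnr e₁.frame h3 h3w hmod h4 h6 ho hn
  -- The phase whose time depends on the number of tree nodes performs no complex operation, so `N`
  -- does not enter the bound for `a`.
  have ha₁ := e₁.ops_eq_zero rfl
  have ha₂ := e₂.ops_le_steps
  have hle : n + r ≤ (n + r) * (w ^ D.width * D.width) := Nat.le_mul_of_pos_right _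
    (Nat.mul_pos (pow_pos (by omega) _) (one_le_width D hnr))
  exact ⟨_, _, σ₂, e₁.seq e₂, h₂, by omega, by omega⟩

end

end ModCount

theorem mainTheorem5 :
    ∃ (P : ModCount.Prog) (C : ℝ), ∀ (n r : ℕ) (F : Fin r → ModCount.Constraint n) (w : ℕ),
      2 ≤ w → 1 ≤ n + r → (∀ j, (F j).modulus ≤ w) →
      ∀ (N k : ℕ) (D : ModCount.TreeDecomposition (ModCount.incidenceGraph F) N), D.width = k →
      ∃ (a s : ℕ) (σ : ModCount.Store),
        ModCount.Exec P (ModCount.input F D) a s σ ∧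
        σ.num 0 0 = (ModCount.modelCount F : ℂ) ∧
        (a : ℝ) ≤ C * ((w : ℝ) ^ k * k * Real.log w * (n + r)) ∧
        (s : ℝ) ≤ C * ((w : ℝ) ^ k * k * Real.log w * (n + r) + k * N) := by
  refine ⟨.seq ModCount.preparation ModCount.counting, 2700, fun n r F w hw hnr hF N k D hD => ?_⟩
  subst hD
  obtain ⟨a, s, σ, e, h, ha, hs⟩ := ModCount.exec_preparation_counting (D := D) hw hnr hF
  -- The bounds so far have no logarithm. Since `w ≥ 2`, inserting it costs a factor of 2, which
  -- makes the constant `2700 = 2 * 1350`.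
  have hlog : (1 : ℝ) ≤ 2 * Real.log w := by
    have h2 : Real.log 2 ≤ Real.log w := Real.log_le_log (by norm_num) (by exact_mod_cast hw)
    linarith [Real.log_two_gt_d9]
  have ha' : (a : ℝ) ≤ 1300 * ((n + r) * ((w : ℝ) ^ D.width * D.width)) := by exact_mod_cast ha
  have hs' : (s : ℝ) ≤ 1350 * ((n + r) * ((w : ℝ) ^ D.width * D.width)) + 400 * (D.width * N) := by
    exact_mod_cast hs
  have hX : (0 : ℝ) ≤ (n + r) * ((w : ℝ) ^ D.width * D.width) := by positivity
  have hXlog := mul_le_mul_of_nonneg_left hlog hX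
  have hkN : (0 : ℝ) ≤ D.width * N := by positivity
  refine ⟨a, s, σ, e, h, ?_, ?_⟩ <;> nlinarith
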